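/- Let $I=[0,1]$, $n\ge 1$, and let $m$ be Lebesgue measure on $I^n$. *Partitions.* A rectangular partition of $I^n$ is a finite partition into rectangles $B_j=\prod_{i=1}^n B_{ij}$ with $B_{ij}=[a_{ij},b_{ij})$ if $b_{ij}<1$ and $B_{ij}=[a_{ij},b_{ij}]$ if $b_{ij}=1$, where $0\le a_{ij}<b_{ij}\le 1$. Its crossing points are the vertices of its rectangles that lie in the interior of $I^n$. A Jabłoński map is a map $f:I^n\to I^n$ together with a rectangular partition on each rectangle $B_j$ of which $f(x)=(\varphi_{1,j}(x_1),\dots,\varphi_{n,j}(x_n))$, with components $\varphi_{i,j}:[a_{ij},b_{ij}]\to[0,1]$. *Bounded variation.* For $h\in L^1(I^n)$ let $V_i h$ be the infimum, over all $g=h$ a.e. whose variation in the $i$-th variable is a measurable function of the other variables, of the integral of that variation over $[0,1]^{n-1}$; put $Vh=\max_i V_ih$ and $\|h\|_{BV}=\|h\|_1+Vh$. The transfer operator $\mathcal L_f$ of $f$ is defined by $\int_A\mathcal L_fh\,dm=\int_{f^{-1}A}h\,dm$ for all Borel sets $A$. *Random maps.* Let $\Omega$ be a Polish space with a Borel probability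 measure $\mathbb P$, and let $\sigma:\Omega\to\Omega$ be an invertible, bimeasurable, ergodic, $\mathbb P$-preserving transformation. Let $\mathscr F=\{f_\omega\}_{\omega\in\Omega}$ be an admissible random Jabłoński map; that is, each $f_\omega$ is a Jabłoński map whose components on its partition $\mathcal B^\omega$ are $C^2$ and monotonic on the closed intervals, and: 1. there is a rectangular partition $\mathcal B$, the same for all $\omega$, on whose rectangles $B_s=\prod_i B_{is}$ each $f_\omega$ likewise has the form $(\varphi_{\omega,1,s}(x_1),\dots,\varphi_{\omega,n,s}(x_n))$, with components that are $C^2$ and monotonic on the closed intervals $\overline{B_{is}}$; 2. with $\gamma_i(\omega)=\inf_{s}\inf_{t\in\overline{B_{is}}}|\varphi_{\omega,i,s}'(t)|$, one has $\gamma_i(\omega)>0$ for $\mathbb P$-a.e. $\omega$ and every $i$, and $\int_\Omega\min_i\log\gamma_i(\omega)\,d\mathbb P(\omega)>0$; 3. $\omega\mapsto\mathcal L_\omega:=\mathcal L_{f_\omega}\in L(BV(I^n))$ is $\mathbb P$-continuous: $\Omega$ is a countable union of Borel sets on each of which this map is continuous for the operator norm. Assume also that $\int_\Omega\log^+\|\mathcal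 L_\omega\|_{BV}\,d\mathbb P(\omega)<\infty$. *Notation.* Let $\gamma(\omega)=\prod_{i=1}^n\gamma_i(\omega)$. Let $M(\omega)$ be the maximum, over $z\in\mathbb R$ and $d\in\{1,\dots,n\}$, of the number of rectangles of $\mathcal B^{\sigma\omega}$ whose interior meets the hyperplane $x_d=z$. Let $c_t(\omega)$ be the number of crossing points of $\mathcal B^{\sigma\omega}$, and suppose that $c_t$ is measurable. Suppose that $$\delta:=\int_\Omega\log\frac{\gamma(\omega)}{M(\omega)}\,d\mathbb P(\omega)>0 .$$ *Statement.* If the skew product $F(\omega,x)=(\sigma\omega,f_\omega(x))$ on $\Omega\times I^n$ has $r\ge1$ mutually singular ergodic invariant probability measures that are absolutely continuous with respect to $\mathbb P\times m$, then $$\int_\Omega\log\Big(2^{n-1}\Big(\frac{c_t(\omega)}{r}+1\Big)\Big)\,d\mathbb P(\omega)\ \ge\ \delta ,$$ where the left-hand side, an integral of a nonnegative function, may be $+\infty$. -/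

import Mathlib

open MeasureTheory Filter Topology

namespace Jablonski

/-- The unit cube `I^n`, `I = [0,1]`; its `volume` is the `n`-dimensional Lebesgue measure. -/
abbrev Cube (n : ℕ) : Type := Fin n → unitInterval

/-! ### Functions of bounded variation (Tonelli–Cesari) -/

noncomputable section

/-- The variation of `g` in the `i`-th variable, the other variables being those of `x`.
It does not depend on `x i`. -/
def lineVariation {n : ℕ} (i : Fin n) (g : Cube n → ℝ) (x : Cube n) : ENNReal :=
  eVariationOn (fun t : unitInterval => g (Function.update x i t)) Set.univ

/-- The `i`-th variation of (the a.e. class of) `h`: the infimum, over all versions `g` of `h`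
whose line variation is measurable, of the integral of the line variation. Since `lineVariation i g`
does not depend on the `i`-th coordinate, which ranges over an interval of length one, the integral
over the cube is the integral over the projected cube `[0,1]^(n-1)`. -/
def dirVariation {n : ℕ} (i : Fin n) (h : Cube n → ℝ) : ENNReal :=
  ⨅ (g : Cube n → ℝ) (_ : g =ᵐ[volume] h) (_ : Measurable (lineVariation i g)),
    ∫⁻ x, lineVariation i g x

/-- Total variation: the maximum of the directional variations. -/
def totalVariation {n : ℕ} (h : Cube n → ℝ) : ENNReal :=
  ⨆ i : Fin n, dirVariation i h

/-- `‖h‖_BV = ‖h‖₁ + V h`, with value `∞` when `h` is not in `BV(I^n)`. -/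
def bvNorm {n : ℕ} (h : Cube n → ℝ) : ENNReal :=
  (∫⁻ x, ‖h x‖ₑ) + totalVariation h

/-- The operator norm on `BV(I^n)` of a map between functions on the cube. -/
def bvOpNorm {n : ℕ} (T : (Cube n → ℝ) → Cube n → ℝ) : ENNReal :=
  ⨆ (h : Cube n → ℝ) (_ : Integrable h volume) (_ : bvNorm h ≤ 1), bvNorm (T h)

/-- The transfer (Perron–Frobenius) operator of `f`: the density of the image under `f` of the
signed measure with density `h`. For nonsingular `f` it is the operator characterised by
`∫_A L_f h = ∫_{f⁻¹ A} h`. -/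
def transfer {n : ℕ} (f : Cube n → Cube n) (h : Cube n → ℝ) : Cube n → ℝ :=
  SignedMeasure.rnDeriv (((volume : Measure (Cube n)).withDensityᵥ h).map f) volume

/-- `ℙ`-continuity of `ω ↦ L_{f ω} ∈ L(BV, BV)` for the operator norm: `Ω` is a countable union of
Borel sets on each of which the restriction is continuous. -/
def IsPContinuous {Ω : Type*} [TopologicalSpace Ω] [MeasurableSpace Ω] {n : ℕ}
    (f : Ω → Cube n → Cube n) : Prop :=
  ∃ S : ℕ → Set Ω, (∀ k, MeasurableSet (S k)) ∧ (⋃ k, S k) = Set.univ ∧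
    ∀ k, ∀ ω ∈ S k,
      Tendsto (fun ω' => bvOpNorm (fun h => transfer (f ω') h - transfer (f ω) h))
        (𝓝[S k] ω) (𝓝 0)

end

/-! ### Rectangular partitions -/

/-- The `j`-th piece of a family of rectangles in the cube: the product over `i` of
`[lo j i, hi j i)`, closed on the right when `hi j i = 1`. -/
def piece {n q : ℕ} (lo hi : Fin q → Fin n → ℝ) (j : Fin q) : Set (Cube n) :=
  {x | ∀ i, lo j i ≤ x i ∧ ((x i : ℝ) < hi j i ∨ hi j i = 1)}

/-- A finite partition of `I^n` into nondegenerate rectangles. -/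
structure RectPartition (n : ℕ) where
  q : ℕ
  lo : Fin q → Fin n → ℝ
  hi : Fin q → Fin n → ℝ
  zero_le_lo : ∀ j i, 0 ≤ lo j i
  lo_lt_hi : ∀ j i, lo j i < hi j i
  hi_le_one : ∀ j i, hi j i ≤ 1
  existsUnique_mem : ∀ x : Cube n, ∃! j, x ∈ piece lo hi j

namespace RectPartition

variable {n : ℕ}

/-- The rectangle with index `j`. -/
def box (Q : RectPartition n) (j : Fin Q.q) : Set (Cube n) :=
  piece Q.lo Q.hi j

/-- The closed interval `[a_{ij}, b_{ij}]`, the `i`-th side of the `j`-th rectangle. -/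
def side (Q : RectPartition n) (j : Fin Q.q) (i : Fin n) : Set ℝ :=
  Set.Icc (Q.lo j i) (Q.hi j i)

/-- The interior (in `ℝ^n`) of the `j`-th rectangle. -/
def openBox (Q : RectPartition n) (j : Fin Q.q) : Set (Fin n → ℝ) :=
  {x | ∀ i, Q.lo j i < x i ∧ x i < Q.hi j i}

/-- The crossing points: vertices of the rectangles that lie in the interior of `I^n`. -/
def crossingPoints (Q : RectPartition n) : Set (Fin n → ℝ) :=
  {v | (∀ i, 0 < v i ∧ v i < 1) ∧ ∃ j, ∀ i, v i = Q.lo j i ∨ v i = Q.hi j i}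

/-- The number of crossing points. -/
noncomputable def numCrossing (Q : RectPartition n) : ℕ :=
  Q.crossingPoints.ncard

/-- The maximal number of rectangles whose interior meets a common hyperplane `x_d = z`. -/
noncomputable def complexity (Q : RectPartition n) : ℕ :=
  ⨆ (z : ℝ) (d : Fin n), {j | ({x : Fin n → ℝ | x d = z} ∩ Q.openBox j).Nonempty}.ncard

end RectPartition

/-! ### Jabłoński maps -/

/-- A representation of `f` on the rectangles of `Q` as
`f (x₁, …, xₙ) = (φ_{1,j} x₁, …, φ_{n,j} xₙ)`. -/
structure Rep {n : ℕ} (f : Cube n → Cube n) (Q : RectPartition n) where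
  comp : Fin Q.q → Fin n → ℝ → ℝ
  mapsTo : ∀ j i, Set.MapsTo (comp j i) (Q.side j i) (Set.Icc 0 1)
  apply_eq : ∀ j, ∀ x ∈ Q.box j, ∀ i, (f x i : ℝ) = comp j i (x i)

/-- All components are `C²` and monotonic on the closed sides of the rectangles. -/
def Rep.Regular {n : ℕ} {f : Cube n → Cube n} {Q : RectPartition n} (φ : Rep f Q) : Prop :=
  ∀ j i, ContDiffOn ℝ 2 (φ.comp j i) (Q.side j i) ∧
    (MonotoneOn (φ.comp j i) (Q.side j i) ∨ AntitoneOn (φ.comp j i) (Q.side j i))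

/-- `γ_i`, the infimum of `|φ_{i,j}'|` over all rectangles and all points of the closed sides. -/
noncomputable def Rep.expansion {n : ℕ} {f : Cube n → Cube n} {Q : RectPartition n} (φ : Rep f Q)
    (i : Fin n) : ℝ :=
  sInf {y | ∃ j, ∃ t ∈ Q.side j i, y = |derivWithin (φ.comp j i) (Q.side j i) t|}

/-- A Jabłoński map, together with its rectangular partition and its components. -/
structure JablonskiMap (n : ℕ) where
  toFun : Cube n → Cube n
  part : RectPartition n
  rep : Rep toFun part

section Random

variable {Ω : Type*} {n : ℕ}

/-- An admissible random Jabłoński map `ω ↦ F ω`: the components of `F ω` on its own partition are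
`C²` and monotonic, and so are its components `φ ω` on a partition `G` common to all `ω`; the maps
are expanding on average, and `ω ↦ L_ω` is `ℙ`-continuous. That the `γ_i ω` are a.e. positive is
what the integral of `min_i log γ_i ω` being larger than `-∞` says. -/
structure IsAdmissible [TopologicalSpace Ω] [MeasurableSpace Ω] (P : Measure Ω)
    (F : Ω → JablonskiMap n) (G : RectPartition n) (φ : ∀ ω, Rep (F ω).toFun G) : Prop where
  regular : ∀ ω, (F ω).rep.Regular
  common_regular : ∀ ω, (φ ω).Regular
  expansion_pos : ∀ᵐ ω ∂P, ∀ i, 0 < (φ ω).expansion i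
  expanding : ∃ γ > 0, γ < ∫ ω, ⨅ i, Real.log ((φ ω).expansion i) ∂P
  pContinuous : IsPContinuous fun ω => (F ω).toFun

/-- The standing integrability assumption `∫ log⁺ ‖L_ω‖_BV dℙ < ∞`
(`EReal.toENNReal` is the positive part). -/
def LogIntegrableTransfer [MeasurableSpace Ω] (P : Measure Ω) (F : Ω → JablonskiMap n) : Prop :=
  ∫⁻ ω, (ENNReal.log (bvOpNorm (transfer (F ω).toFun))).toENNReal ∂P < ⊤

/-- `M(ω)`, the complexity of the partition of `F (σ ω)`. -/
noncomputable def M (σ : Ω → Ω) (F : Ω → JablonskiMap n) (ω : Ω) : ℕ :=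
  (F (σ ω)).part.complexity

/-- `c_t(ω)`, the number of crossing points of the partition of `F (σ ω)`. -/
noncomputable def ct (σ : Ω → Ω) (F : Ω → JablonskiMap n) (ω : Ω) : ℕ :=
  (F (σ ω)).part.numCrossing

/-- `δ = ∫ log (γ(ω) / M(ω)) dℙ`, with `γ(ω) = ∏ᵢ γ_i(ω)`. -/
noncomputable def delta [MeasurableSpace Ω] (P : Measure Ω) (σ : Ω → Ω) (F : Ω → JablonskiMap n)
    {G : RectPartition n} (φ : ∀ ω, Rep (F ω).toFun G) : ℝ :=
  ∫ ω, Real.log ((∏ i, (φ ω).expansion i) / (M σ F ω : ℝ)) ∂P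

/-- The skew product `(ω, x) ↦ (σ ω, f_ω x)`. -/
def skew (σ : Ω → Ω) (F : Ω → JablonskiMap n) (p : Ω × Cube n) : Ω × Cube n :=
  (σ p.1, (F p.1).toFun p.2)

/-- `μ` is an ergodic absolutely continuous invariant probability measure of the skew product. -/
structure IsErgodicACIP [MeasurableSpace Ω] (P : Measure Ω) (σ : Ω → Ω) (F : Ω → JablonskiMap n)
    (μ : Measure (Ω × Cube n)) : Prop where
  prob : IsProbabilityMeasure μ
  ac : μ ≪ P.prod volume
  ergodic : Ergodic (skew σ F) μ

end Random

end Jablonski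

/-! Suppose the integral were smaller than δ. Disintegrate each of the r measures over `P`. Since
`σ` is invertible and ergodic, almost every fibre measure is a probability density; `f_ω` carries
its support over ω into its support over σω (`ae_fiberSupport_null`), and mutual singularity makes
the r supports over a common ω disjoint up to null sets (`ae_fiberSupport_inter_null`).

Growth of boxes. Cut a box J contained in a support along the partition of `f_ω`. A largest piece
has at least the average volume, and its image is a box in the next support whose volume is larger
by the factor γ(ω) at least (`Rep.Regular.exists_image_box`). A rectangle meeting J either crosses
one of the n middle hyperplanes of J or has a vertex in J, so at most M·2^(n-1)·(c+1) rectangles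
meet J, where M is the complexity of that partition and c the number of its crossing points in J
(`RectPartition.ncard_meeting_le`). Take one box in each of the r supports. The boxes are disjoint,
so the numbers c add up to at most the total number of crossing points, and concavity of the
logarithm bounds the total loss (`exists_image_boxes`). Volumes never exceed one, so the Birkhoff
sums of the resulting gain are bounded above almost surely (`sum_expansion_sub_cuttingCost_le`). But
if the mean gain were positive, then with positive probability these sums would grow linearly, by
the maximal ergodic theorem (`exists_birkhoffSum_le_sub_mul`).

Existence of boxes (`ae_hasBox_fiberSupport`). Finite sums of product measures with one-dimensional
BV densities are mapped to such sums, and their variation obeys a Lasota–Yorke inequality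
(`ProductBranches.hasVariation_map_of_lipschitz`). After N steps its multiplicative constant has
negative mean logarithm. Its additive constant is unbounded in ω; where it is large it is replaced
by a crude multiplicative bound with integrable logarithm (`BranchFamily.exists_block`). That bound
comes from log⁺‖L_ω‖: applied to the indicator of a box, the transfer operator exhibits the
variation of the reciprocal derivatives (`ProductBranches.volume_mul_lintegral_le`).

Hence, with positive probability, the constants along the backward orbit have exponentially decaying
products. Average the fibre density m steps in the past over a grid of mesh 1/m. Its variation, of
order m, is forgotten on the way to the present, so the images have variation bounded independently
of m, and each dominates half of Lebesgue measure on some cell of one fixed grid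
(`HasVariation.exists_gridCell`). Their mass off the support is at most the mass that averaging
moved off the past support, which tends to zero along a subsequence. Since there are finitely many
cells, one lies in the support (`exists_gridCell_subset_support`). Images of boxes contain boxes, so
ergodicity passes from positive probability to almost every fibre. -/

open scoped ENNReal NNReal

namespace Jablonski

/-! ### The maximal ergodic theorem and linear decay of Birkhoff sums. -/

section Ergodic

variable {Ω : Type*}

/-- The running maxima `max_{0 ≤ k ≤ m} S_k φ` of the Birkhoff sums, in recursive form. -/
noncomputable def birkhoffMax (T : Ω → Ω) (φ : Ω → ℝ) : ℕ → Ω → ℝ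
  | 0 => fun _ => 0
  | m + 1 => fun ω => max 0 (φ ω + birkhoffMax T φ m (T ω))

variable {T : Ω → Ω} {φ : Ω → ℝ}

lemma birkhoffMax_nonneg (m : ℕ) (ω : Ω) : 0 ≤ birkhoffMax T φ m ω := by
  cases m with
  | zero => exact le_rfl
  | succ m => exact le_max_left _ _

lemma birkhoffMax_le_succ (m : ℕ) : ∀ ω, birkhoffMax T φ m ω ≤ birkhoffMax T φ (m + 1) ω := by
  induction m with
  | zero => intro ω; exact birkhoffMax_nonneg _ _
  | succ m ih => intro ω; exact max_le_max le_rfl (add_le_add le_rfl (ih _))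

lemma birkhoffSum_le_birkhoffMax (m : ℕ) : ∀ ω, birkhoffSum T φ m ω ≤ birkhoffMax T φ m ω := by
  induction m with
  | zero => intro ω; simp [birkhoffMax]
  | succ m ih =>
    intro ω
    rw [birkhoffSum_succ']
    exact le_trans (add_le_add le_rfl (ih _)) (le_max_right _ _)

variable [MeasurableSpace Ω]

lemma integrable_birkhoffMax {P : Measure Ω} (hT : MeasurePreserving T P P)
    (hφ : Integrable φ P) (m : ℕ) : Integrable (birkhoffMax T φ m) P := by
  induction m with
  | zero => exact integrable_zero _ _ _
  | succ m ih =>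
    exact (integrable_zero _ _ _).sup (hφ.add (hT.integrable_comp_of_integrable ih))

/-- A consequence of the maximal ergodic theorem. -/
theorem integral_nonneg_of_birkhoffSum_pos {P : Measure Ω} (hT : MeasurePreserving T P P)
    (hφ : Integrable φ P) (h : ∀ᵐ ω ∂P, ∃ k, 0 < birkhoffSum T φ k ω) : 0 ≤ ∫ ω, φ ω ∂P := by
  set M := birkhoffMax T φ with hM
  have hint : ∀ m, Integrable (M m) P := integrable_birkhoffMax hT hφ
  have hcomp : ∀ m, Integrable (fun ω => M m (T ω)) P := fun m =>
    hT.integrable_comp_of_integrable (hint m)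
  have hmono : ∀ ω, Monotone fun m => M m ω := fun ω =>
    monotone_nat_of_le_succ fun m => birkhoffMax_le_succ m ω
  -- By hypothesis the sets `{0 < M (m + 1)}` exhaust the space up to a null set. It is therefore
  -- enough that `φ` has nonnegative integral over each of them.
  have hlim : Tendsto (fun m => ∫ ω, (if 0 < M (m + 1) ω then φ ω else 0) ∂P) atTop
      (𝓝 (∫ ω, φ ω ∂P)) := by
    refine tendsto_integral_of_dominated_convergence (fun ω => ‖φ ω‖) ?_ hφ.norm ?_ ?_
    · intro m
      have hs : NullMeasurableSet {ω | 0 < M (m + 1) ω} P :=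
        nullMeasurableSet_lt aemeasurable_const (hint _).aemeasurable
      have := hφ.aestronglyMeasurable.indicator₀ hs
      refine this.congr (Eventually.of_forall fun ω => ?_)
      simp [Set.indicator]
    · intro m
      refine Eventually.of_forall fun ω => ?_
      split_ifs <;> simp
    · filter_upwards [h] with ω ⟨k, hk⟩
      refine tendsto_const_nhds.congr' ?_
      filter_upwards [eventually_ge_atTop k] with m hm
      have : 0 < M (m + 1) ω :=
        (hk.trans_le (birkhoffSum_le_birkhoffMax k ω)).trans_le (hmono ω (by omega))
      simp [this]
  refine ge_of_tendsto' hlim fun m => ?_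
  -- Garsia's argument: this coboundary has integral zero, is at most `φ` on `{0 < M (m + 1)}`, and
  -- is nonpositive elsewhere.
  have h0 : ∫ ω, (M (m + 1) ω - M (m + 1) (T ω)) ∂P = 0 := by
    rw [integral_sub (hint _) (hcomp _), sub_eq_zero]
    have := integral_map (μ := P) (f := M (m + 1)) hT.measurable.aemeasurable
      (by rw [hT.map_eq]; exact (hint _).aestronglyMeasurable)
    rw [hT.map_eq] at this
    exact this
  refine h0.symm.le.trans ?_
  have hs : NullMeasurableSet {ω | 0 < M (m + 1) ω} P :=
    nullMeasurableSet_lt aemeasurable_const (hint _).aemeasurable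
  refine integral_mono ((hint _).sub (hcomp _)) ?_ fun ω => ?_
  · have := hφ.indicator₀ hs
    refine this.congr (Eventually.of_forall fun ω => ?_)
    simp [Set.indicator]
  · dsimp only
    split_ifs with hpos
    · have h1 : M (m + 1) ω = max 0 (φ ω + M m (T ω)) := rfl
      have h2 : M (m + 1) ω = φ ω + M m (T ω) := by
        rw [h1] at hpos ⊢
        rcases lt_max_iff.1 hpos with h | h
        · exact absurd h (lt_irrefl _)
        · exact max_eq_right h.le
      have h3 : M m (T ω) ≤ M (m + 1) (T ω) := birkhoffMax_le_succ m _
      linarith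
    · have h1 : M (m + 1) ω = 0 := le_antisymm (not_lt.1 hpos) (birkhoffMax_nonneg _ _)
      have h2 : 0 ≤ M (m + 1) (T ω) := birkhoffMax_nonneg _ _
      linarith

/-- If `∫ φ < 0`, then with positive probability the Birkhoff sums of `φ` go linearly to `-∞`. -/
theorem exists_birkhoffSum_le_sub_mul {P : Measure Ω} [IsProbabilityMeasure P]
    (hT : MeasurePreserving T P P)
    (hφ : Integrable φ P) (hneg : ∫ ω, φ ω ∂P < 0) :
    ∃ c > 0, ¬ ∀ᵐ ω ∂P, ¬ ∃ C : ℝ, ∀ k : ℕ, birkhoffSum T φ k ω ≤ C - c * k := by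
  -- Adding half of the drift leaves the integral negative, so the Birkhoff sums of `φ + c` cannot
  -- almost surely become positive. Where they never do, the bound holds with `C = 0`.
  refine ⟨-(∫ ω, φ ω ∂P) / 2, by linarith, fun hcon => ?_⟩
  set c := -(∫ ω, φ ω ∂P) / 2 with hc
  have hsum : ∀ k ω, birkhoffSum T (fun ω => φ ω + c) k ω = birkhoffSum T φ k ω + c * k := by
    intro k ω
    simp [birkhoffSum, Finset.sum_add_distrib, mul_comm]
  have := integral_nonneg_of_birkhoffSum_pos (φ := fun ω => φ ω + c) hT
    (hφ.add (integrable_const c)) ?_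
  · rw [integral_add hφ (integrable_const c)] at this
    simp at this
    linarith
  · filter_upwards [hcon] with ω hω
    by_contra! hno
    refine hω ⟨0, fun k => ?_⟩
    have := hno k
    rw [hsum] at this
    linarith

end Ergodic

/-! ### One-dimensional densities of bounded variation. -/

/-- A nonnegative function on the line, supported in `[0,1]`, together with a finite measure that
dominates its variation. -/
structure BVDensity where
  toFun : ℝ → ℝ
  varM : Measure ℝ
  nonneg : ∀ x, 0 ≤ toFun x
  supp : ∀ x, x ∉ Set.Icc (0 : ℝ) 1 → toFun x = 0
  finite_varM : IsFiniteMeasure varM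
  le_varM : ∀ x y, x ≤ y → ENNReal.ofReal |toFun y - toFun x| ≤ varM (Set.Icc x y)

namespace BVDensity

instance (ρ : BVDensity) : IsFiniteMeasure ρ.varM := ρ.finite_varM

/-- The measure with density `ρ`. -/
noncomputable def meas (ρ : BVDensity) : Measure ℝ :=
  volume.withDensity fun x => ENNReal.ofReal (ρ.toFun x)

lemma le_varM_uIcc (ρ : BVDensity) (x y : ℝ) :
    ENNReal.ofReal |ρ.toFun y - ρ.toFun x| ≤ ρ.varM (Set.uIcc x y) := by
  rcases le_total x y with h | h
  · rw [Set.uIcc_of_le h]; exact ρ.le_varM _ _ h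
  · rw [Set.uIcc_of_ge h, abs_sub_comm]; exact ρ.le_varM _ _ h

lemma le_add_of_mem (ρ : BVDensity) {C : Set ℝ} (hC : C.OrdConnected) {x y : ℝ} (hx : x ∈ C)
    (hy : y ∈ C) : ρ.toFun x ≤ ρ.toFun y + ρ.varM.real C := by
  have h1 := (ρ.le_varM_uIcc x y).trans (measure_mono (hC.uIcc_subset hx hy))
  have h2 : |ρ.toFun y - ρ.toFun x| ≤ ρ.varM.real C := by
    rw [Measure.real, ← ENNReal.ofReal_le_iff_le_toReal (measure_ne_top _ _)]
    exact h1
  have := neg_abs_le (ρ.toFun y - ρ.toFun x)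
  linarith

/-- The density vanishes at 2, outside the unit interval, so each of its values is a difference of
two values. -/
lemma le_varM_univ (ρ : BVDensity) (x : ℝ) : ENNReal.ofReal (ρ.toFun x) ≤ ρ.varM Set.univ := by
  have h := ρ.le_varM_uIcc x 2
  rw [ρ.supp 2 (by norm_num), zero_sub, abs_neg, abs_of_nonneg (ρ.nonneg x)] at h
  exact h.trans (measure_mono (Set.subset_univ _))

lemma meas_absolutelyContinuous (ρ : BVDensity) : ρ.meas ≪ volume :=
  withDensity_absolutelyContinuous _ _

lemma meas_univ_le (ρ : BVDensity) : ρ.meas Set.univ ≤ ρ.varM Set.univ := by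
  have : ρ.meas Set.univ = ∫⁻ x in Set.Icc (0 : ℝ) 1, ENNReal.ofReal (ρ.toFun x) := by
    rw [meas, withDensity_apply _ MeasurableSet.univ, Measure.restrict_univ,
      ← lintegral_indicator measurableSet_Icc]
    refine lintegral_congr fun x => ?_
    by_cases hx : x ∈ Set.Icc (0 : ℝ) 1
    · rw [Set.indicator_of_mem hx]
    · rw [Set.indicator_of_notMem hx, ρ.supp x hx, ENNReal.ofReal_zero]
  rw [this]
  calc _ ≤ ∫⁻ x in Set.Icc (0 : ℝ) 1, ρ.varM Set.univ := lintegral_mono fun x => ρ.le_varM_univ x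
    _ = ρ.varM Set.univ := by simp

instance (ρ : BVDensity) : IsFiniteMeasure ρ.meas :=
  ⟨ρ.meas_univ_le.trans_lt (measure_lt_top _ _)⟩

/-- The zero density. -/
noncomputable def zero : BVDensity where
  toFun _ := 0
  varM := 0
  nonneg _ := le_rfl
  supp _ _ := rfl
  finite_varM := inferInstance
  le_varM _ _ _ := by simp

lemma meas_zero : zero.meas = 0 := by simp [meas, zero]

/-- On `C` the density is at least `ρ x` minus the variation over `C`; integrate. Divided by the
length of `C`, this bounds the supremum by the mean plus the variation, which is how jumps at the
ends of a branch are estimated. -/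
lemma mul_le_meas (ρ : BVDensity) {C : Set ℝ} (hC : C.OrdConnected) {x : ℝ} (hx : x ∈ C) :
    ENNReal.ofReal (ρ.toFun x) * volume C ≤ ρ.meas C + ρ.varM C * volume C := by
  have h : ∫⁻ _ in C, ENNReal.ofReal (ρ.toFun x - ρ.varM.real C) ≤ ρ.meas C := by
    rw [meas, withDensity_apply _ hC.measurableSet]
    refine setLIntegral_mono' hC.measurableSet fun t ht => ENNReal.ofReal_le_ofReal ?_
    have := ρ.le_add_of_mem hC hx ht
    linarith
  rw [setLIntegral_const] at h
  have h2 : ENNReal.ofReal (ρ.toFun x) ≤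
      ENNReal.ofReal (ρ.toFun x - ρ.varM.real C) + ρ.varM C := by
    rw [← ENNReal.ofReal_toReal (measure_ne_top ρ.varM C)]
    refine (ENNReal.ofReal_le_ofReal ?_).trans ENNReal.ofReal_add_le
    simp [Measure.real]
  calc _ ≤ (ENNReal.ofReal (ρ.toFun x - ρ.varM.real C) + ρ.varM C) * volume C := by gcongr
    _ ≤ _ := by rw [add_mul]; gcongr

/-! ### Images of densities under one monotone branch. -/

section Push

variable (ρ : BVDensity) {C : Set ℝ} {ψ ψ' : ℝ → ℝ}

/-- The image has density `ρ / |ψ'|`, transported to the interval `T = ψ '' C` and extended by zero.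
The measure `E` accounts for the variation inside `T`; an atom of mass `M` at each end of `T`
accounts for the jump to zero there. -/
theorem exists_push (hC : C.OrdConnected) (hψ : Measurable ψ)
    (hderiv : ∀ x ∈ C, HasDerivWithinAt ψ (ψ' x) C x)
    (hmono : MonotoneOn ψ C ∨ AntitoneOn ψ C) (hinj : Set.InjOn ψ C)
    (hne : ∀ x ∈ C, ψ' x ≠ 0) (hmaps : Set.MapsTo ψ C (Set.Icc 0 1))
    (E : Measure ℝ) [IsFiniteMeasure E]
    (hE : ∀ x ∈ C, ∀ y ∈ C,
      ENNReal.ofReal |ρ.toFun y * |ψ' y|⁻¹ - ρ.toFun x * |ψ' x|⁻¹| ≤ E (Set.uIcc x y))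
    (M : ℝ≥0∞) (hMtop : M ≠ ∞) (hM : ∀ x ∈ C, ENNReal.ofReal (ρ.toFun x * |ψ' x|⁻¹) ≤ M) :
    ∃ ρ' : BVDensity, ρ'.meas = (ρ.meas.restrict C).map ψ ∧ ρ'.varM Set.univ ≤ E C + 2 * M := by
  classical
  set T := ψ '' C with hT
  have hcont : ContinuousOn ψ C := fun x hx => (hderiv x hx).continuousWithinAt
  have hTo : T.OrdConnected := (hC.isPreconnected.image ψ hcont).ordConnected
  have hT1 : T ⊆ Set.Icc 0 1 := hmaps.image_subset
  have hTa : BddAbove T := ⟨1, fun x hx => (hT1 hx).2⟩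
  have hTb : BddBelow T := ⟨0, fun x hx => (hT1 hx).1⟩
  set r : ℝ → ℝ := fun y => if y ∈ T then
    ρ.toFun (Function.invFunOn ψ C y) * |ψ' (Function.invFunOn ψ C y)|⁻¹ else 0 with hr
  have hrψ : ∀ x ∈ C, r (ψ x) = ρ.toFun x * |ψ' x|⁻¹ := by
    intro x hx
    have : Function.invFunOn ψ C (ψ x) = x := hinj.leftInvOn_invFunOn hx
    simp only [hr, this]
    exact if_pos (Set.mem_image_of_mem ψ hx)
  have hr0 : ∀ y, y ∉ T → r y = 0 := fun y hy => if_neg hy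
  have hrn : ∀ y, 0 ≤ r y := by
    intro y
    by_cases hy : y ∈ T
    · obtain ⟨x, hx, rfl⟩ := hy
      rw [hrψ x hx]
      exact mul_nonneg (ρ.nonneg _) (inv_nonneg.2 (abs_nonneg _))
    · rw [hr0 y hy]
  have hrM : ∀ y, ENNReal.ofReal (r y) ≤ M := by
    intro y
    by_cases hy : y ∈ T
    · obtain ⟨x, hx, rfl⟩ := hy
      rw [hrψ x hx]; exact hM x hx
    · rw [hr0 y hy]; simp
  set D : Measure ℝ := (E.restrict C).map ψ +
    (M • Measure.dirac (sInf T) + M • Measure.dirac (sSup T)) with hD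
  have hDfin : IsFiniteMeasure D := by
    have : IsFiniteMeasure (M • Measure.dirac (sInf T)) := Measure.smul_finite _ hMtop
    have : IsFiniteMeasure (M • Measure.dirac (sSup T)) := Measure.smul_finite _ hMtop
    have : IsFiniteMeasure ((E.restrict C).map ψ) := inferInstance
    infer_instance
  have hvar : ∀ x y, x ≤ y → ENNReal.ofReal |r y - r x| ≤ D (Set.Icc x y) := by
    intro x y hxy
    have hDI : D (Set.Icc x y) = (E.restrict C).map ψ (Set.Icc x y) +
        (M * (Set.Icc x y).indicator 1 (sInf T) + M * (Set.Icc x y).indicator 1 (sSup T)) := by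
      simp [hD, Measure.dirac_apply' _ measurableSet_Icc]
    rw [hDI]
    by_cases hx : x ∈ T <;> by_cases hy : y ∈ T
    · refine le_trans ?_ le_self_add
      obtain ⟨a, ha, rfl⟩ := hx
      obtain ⟨b, hb, rfl⟩ := hy
      rw [hrψ a ha, hrψ b hb, Measure.map_apply hψ measurableSet_Icc,
        Measure.restrict_apply (hψ measurableSet_Icc)]
      refine (hE a ha b hb).trans (measure_mono fun t ht => ?_)
      have htC : t ∈ C := hC.uIcc_subset ha hb ht
      refine ⟨?_, htC⟩
      have hgoal : ψ t ∈ Set.uIcc (ψ a) (ψ b) := by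
        rcases hmono with h | h
        · exact (h.mono (hC.uIcc_subset ha hb)).mapsTo_uIcc ht
        · exact (h.mono (hC.uIcc_subset ha hb)).mapsTo_uIcc ht
      rwa [Set.uIcc_of_le hxy] at hgoal
    · rw [hr0 y hy, zero_sub, abs_neg, abs_of_nonneg (hrn x)]
      have hs : sSup T ∈ Set.Icc x y := by
        refine ⟨le_csSup hTa hx, csSup_le ⟨x, hx⟩ fun t ht => ?_⟩
        by_contra! hlt
        exact hy (hTo.out hx ht ⟨hxy, hlt.le⟩)
      rw [Set.indicator_of_mem hs]
      refine (hrM x).trans ?_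
      simp only [Pi.one_apply, mul_one]
      exact le_trans le_add_self le_add_self
    · rw [hr0 x hx, sub_zero, abs_of_nonneg (hrn y)]
      have hs : sInf T ∈ Set.Icc x y := by
        refine ⟨le_csInf ⟨y, hy⟩ fun t ht => ?_, csInf_le hTb hy⟩
        by_contra! hlt
        exact hx (hTo.out ht hy ⟨hlt.le, hxy⟩)
      rw [Set.indicator_of_mem hs]
      refine (hrM y).trans ?_
      simp only [Pi.one_apply, mul_one]
      exact le_trans le_self_add le_add_self
    · simp [hr0 x hx, hr0 y hy]
  refine ⟨⟨r, D, hrn, fun x hx => hr0 x fun h => hx (hT1 h), hDfin, hvar⟩, ?_, ?_⟩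
  · ext A hA
    rw [Measure.map_apply hψ hA, Measure.restrict_apply (hψ hA), meas, meas,
      withDensity_apply _ hA, withDensity_apply _ ((hψ hA).inter hC.measurableSet)]
    have hset : A ∩ T = ψ '' (ψ ⁻¹' A ∩ C) := by
      rw [hT, Set.inter_comm (ψ ⁻¹' A), Set.image_inter_preimage, Set.inter_comm]
    have h1 : ∫⁻ y in A, ENNReal.ofReal (r y) = ∫⁻ y in A ∩ T, ENNReal.ofReal (r y) := by
      rw [Set.inter_comm, ← setLIntegral_indicator hTo.measurableSet]
      refine lintegral_congr fun y => ?_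
      by_cases hy : y ∈ T
      · rw [Set.indicator_of_mem hy]
      · rw [Set.indicator_of_notMem hy, hr0 y hy, ENNReal.ofReal_zero]
    rw [h1, hset, lintegral_image_eq_lintegral_abs_deriv_mul
      ((hψ hA).inter hC.measurableSet)
      (fun x hx => (hderiv x hx.2).mono Set.inter_subset_right)
      (hinj.mono Set.inter_subset_right)]
    refine setLIntegral_congr_fun ((hψ hA).inter hC.measurableSet) fun x hx => ?_
    rw [hrψ x hx.2, ← ENNReal.ofReal_mul (abs_nonneg _)]
    congr 1
    have : |ψ' x| ≠ 0 := abs_ne_zero.2 (hne x hx.2)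
    field_simp
  · have h1 : (E.restrict C).map ψ Set.univ = E C := by
      rw [Measure.map_apply hψ MeasurableSet.univ]; simp
    simp [hD, h1, two_mul]

end Push

lemma exists_measure_singleton_eq_zero (D : Measure ℝ) [IsFiniteMeasure D] {a b : ℝ} (hab : a < b) :
    ∃ t ∈ Set.Icc a b, D {t} = 0 := by
  by_contra! h
  have hc : {t : ℝ | 0 < D {t}}.Countable := by
    refine Measure.countable_meas_pos_of_disjoint_iUnion (fun t => measurableSet_singleton t) ?_
    intro s t hst
    simpa using hst
  have : (Set.Icc a b).Countable := hc.mono fun t ht => pos_iff_ne_zero.2 (h t ht)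
  exact (Cardinal.Real.Icc_countable_iff.1 this).not_gt hab

/-- Without subdivision, the product rule needs the value of `ρ` at an end point; comparing it with
its mean costs `L * (y - x)` times the variation. Subdividing multiplies this error by at most 2/3
each time. The cut is taken in the middle third, at a point that is not an atom of `varM`, so that
the two closed halves do not count any variation twice. -/
lemma abs_mul_sub_mul_le (ρ : BVDensity) {w : ℝ → ℝ} {c L : ℝ} (hL : 0 ≤ L) (k : ℕ) :
    ∀ x y : ℝ, x ≤ y → (∀ t ∈ Set.Icc x y, 0 ≤ w t ∧ w t ≤ c) →
      (∀ s ∈ Set.Icc x y, ∀ t ∈ Set.Icc x y, |w t - w s| ≤ L * |t - s|) →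
      |ρ.toFun y * w y - ρ.toFun x * w x| ≤
        (c + L * (y - x) * (2 / 3) ^ k) * ρ.varM.real (Set.Icc x y) +
          L * ρ.meas.real (Set.Icc x y) := by
  induction k with
  | zero =>
    intro x y hxy hw hLip
    have hx : x ∈ Set.Icc x y := Set.left_mem_Icc.2 hxy
    have hy : y ∈ Set.Icc x y := Set.right_mem_Icc.2 hxy
    have h1 : |ρ.toFun y - ρ.toFun x| ≤ ρ.varM.real (Set.Icc x y) := by
      rw [Measure.real, ← ENNReal.ofReal_le_iff_le_toReal (measure_ne_top _ _)]
      exact ρ.le_varM x y hxy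
    have h2 : ρ.toFun x * (y - x) ≤
        ρ.meas.real (Set.Icc x y) + ρ.varM.real (Set.Icc x y) * (y - x) := by
      have := ρ.mul_le_meas Set.ordConnected_Icc hx
      rw [Real.volume_Icc] at this
      have := ENNReal.toReal_mono (by finiteness) this
      rw [ENNReal.toReal_add (by finiteness) (by finiteness), ENNReal.toReal_mul,
        ENNReal.toReal_mul, ENNReal.toReal_ofReal (ρ.nonneg x),
        ENNReal.toReal_ofReal (sub_nonneg.2 hxy)] at this
      exact this
    have h3 := hLip x hx y hy
    rw [abs_of_nonneg (sub_nonneg.2 hxy)] at h3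
    have e : ρ.toFun y * w y - ρ.toFun x * w x =
        w y * (ρ.toFun y - ρ.toFun x) + ρ.toFun x * (w y - w x) := by ring
    rw [e]
    refine (abs_add_le _ _).trans ?_
    rw [abs_mul, abs_mul, abs_of_nonneg (hw y hy).1, abs_of_nonneg (ρ.nonneg x)]
    have h4 : w y * |ρ.toFun y - ρ.toFun x| ≤ c * ρ.varM.real (Set.Icc x y) :=
      mul_le_mul (hw y hy).2 h1 (abs_nonneg _) ((hw y hy).1.trans (hw y hy).2)
    have h5 : ρ.toFun x * |w y - w x| ≤ ρ.toFun x * (L * (y - x)) :=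
      mul_le_mul_of_nonneg_left h3 (ρ.nonneg x)
    have h6 := mul_le_mul_of_nonneg_left h2 hL
    nlinarith
  | succ k ih =>
    intro x y hxy hw hLip
    rcases hxy.eq_or_lt with rfl | hlt
    · simp only [sub_self, abs_zero]
      have := (hw x (by simp)).1.trans (hw x (by simp)).2
      positivity
    obtain ⟨t, ht, ht0⟩ := exists_measure_singleton_eq_zero ρ.varM
      (show x + (y - x) / 3 < y - (y - x) / 3 by linarith)
    have hxt : x ≤ t := by linarith [ht.1]
    have hty : t ≤ y := by linarith [ht.2]
    have hs1 : Set.Icc x t ⊆ Set.Icc x y := Set.Icc_subset_Icc_right hty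
    have hs2 : Set.Icc t y ⊆ Set.Icc x y := Set.Icc_subset_Icc_left hxt
    have i1 := ih x t hxt (fun s hs => hw s (hs1 hs))
      (fun s hs u hu => hLip s (hs1 hs) u (hs1 hu))
    have i2 := ih t y hty (fun s hs => hw s (hs2 hs))
      (fun s hs u hu => hLip s (hs2 hs) u (hs2 hu))
    have key : ∀ (D : Measure ℝ) [IsFiniteMeasure D], D {t} = 0 →
        D.real (Set.Icc x t) + D.real (Set.Icc t y) = D.real (Set.Icc x y) := by
      intro D _ hDt
      have := measureReal_union_add_inter (μ := D) (s := Set.Icc x t)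
        (measurableSet_Icc (a := t) (b := y))
      rw [Set.Icc_union_Icc_eq_Icc hxt hty, Set.Icc_inter_Icc_eq_singleton hxt hty] at this
      rw [← this, Measure.real, Measure.real, hDt]
      simp
    have k1 := key ρ.varM ht0
    have k2 := key ρ.meas (ρ.meas_absolutelyContinuous (by simp))
    have hd1 : 0 ≤ ρ.varM.real (Set.Icc x t) := measureReal_nonneg
    have hd2 : 0 ≤ ρ.varM.real (Set.Icc t y) := measureReal_nonneg
    have hp : (0 : ℝ) ≤ (2 / 3) ^ k := by positivity
    have l1 : L * (t - x) * (2 / 3) ^ k ≤ L * (y - x) * (2 / 3) ^ (k + 1) := by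
      rw [pow_succ]
      have : t - x ≤ (y - x) * (2 / 3) := by linarith [ht.2]
      have := mul_le_mul_of_nonneg_right (mul_le_mul_of_nonneg_left this hL) hp
      linarith
    have l2 : L * (y - t) * (2 / 3) ^ k ≤ L * (y - x) * (2 / 3) ^ (k + 1) := by
      rw [pow_succ]
      have : y - t ≤ (y - x) * (2 / 3) := by linarith [ht.1]
      have := mul_le_mul_of_nonneg_right (mul_le_mul_of_nonneg_left this hL) hp
      linarith
    have m1 := mul_le_mul_of_nonneg_right l1 hd1
    have m2 := mul_le_mul_of_nonneg_right l2 hd2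
    have tri : |ρ.toFun y * w y - ρ.toFun x * w x| ≤
        |ρ.toFun y * w y - ρ.toFun t * w t| + |ρ.toFun t * w t - ρ.toFun x * w x| :=
      abs_sub_le _ _ _
    rw [← k1, ← k2]
    nlinarith

/-- Let the depth of the subdivision tend to infinity. -/
lemma abs_mul_sub_mul_le_of_lipschitz (ρ : BVDensity) {w : ℝ → ℝ} {c L x y : ℝ} (hL : 0 ≤ L)
    (hxy : x ≤ y) (hw : ∀ t ∈ Set.Icc x y, 0 ≤ w t ∧ w t ≤ c)
    (hLip : ∀ s ∈ Set.Icc x y, ∀ t ∈ Set.Icc x y, |w t - w s| ≤ L * |t - s|) :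
    |ρ.toFun y * w y - ρ.toFun x * w x| ≤
      c * ρ.varM.real (Set.Icc x y) + L * ρ.meas.real (Set.Icc x y) := by
  have hlim : Tendsto (fun k : ℕ => (c + L * (y - x) * (2 / 3) ^ k) * ρ.varM.real (Set.Icc x y) +
      L * ρ.meas.real (Set.Icc x y)) atTop (𝓝 ((c + L * (y - x) * 0) * ρ.varM.real (Set.Icc x y) +
      L * ρ.meas.real (Set.Icc x y))) := by
    have := tendsto_pow_atTop_nhds_zero_of_lt_one (r := (2 / 3 : ℝ)) (by norm_num) (by norm_num)
    exact (((this.const_mul _).const_add _).mul_const _).add_const _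
  have := ge_of_tendsto' hlim fun k => ρ.abs_mul_sub_mul_le hL k x y hxy hw hLip
  simpa using this

section Push

variable (ρ : BVDensity) {C : Set ℝ} {ψ ψ' : ℝ → ℝ} {c : ℝ≥0}

lemma inv_abs_le_of_one_le_mul {c a : ℝ} (h : 1 ≤ c * |a|) : |a|⁻¹ ≤ c := by
  have ha : 0 < |a| := by
    rcases (abs_nonneg a).eq_or_lt with h0 | h0
    · rw [← h0] at h; norm_num at h
    · exact h0
  rw [inv_le_iff_one_le_mul₀ ha]
  exact h

/-- The Lasota–Yorke inequality on the line. The variation inside costs `c`, and the two end jumps,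
each at most `c` times variation plus mean, cost `2 * c` more; hence the factor 3. The lower bound
`ℓ` for the length turns means into masses. Null intervals must be admitted because the domain of a
composed branch may be empty or a point. -/
theorem exists_push_of_lipschitz (hC : C.OrdConnected) (hψ : Measurable ψ)
    (hderiv : ∀ x ∈ C, HasDerivWithinAt ψ (ψ' x) C x)
    (hmono : MonotoneOn ψ C ∨ AntitoneOn ψ C) (hinj : Set.InjOn ψ C)
    (hc : ∀ x ∈ C, 1 ≤ c * |ψ' x|) (hmaps : Set.MapsTo ψ C (Set.Icc 0 1))
    (hC1 : C ⊆ Set.Icc 0 1) {L ℓ : ℝ≥0}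
    (hL : ∀ x ∈ C, ∀ y ∈ C, |(|ψ' y|⁻¹ - |ψ' x|⁻¹)| ≤ L * |y - x|)
    (hℓ0 : 0 < ℓ) (hℓ : volume C = 0 ∨ ℓ ≤ volume C) :
    ∃ ρ' : BVDensity, ρ'.meas = (ρ.meas.restrict C).map ψ ∧
      ρ'.varM Set.univ ≤ 3 * c * ρ.varM C + (L + 2 * c / ℓ) * ρ.meas C := by
  rcases hℓ with h0 | hℓ
  · refine ⟨zero, ?_, by simp [zero]⟩
    rw [meas_zero, Measure.restrict_eq_zero.2 (ρ.meas_absolutelyContinuous h0), Measure.map_zero]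
  have hne : ∀ x ∈ C, ψ' x ≠ 0 := by
    intro x hx h
    have := hc x hx
    rw [h] at this; norm_num at this
  have hw : ∀ x ∈ C, |ψ' x|⁻¹ ≤ c := fun x hx => inv_abs_le_of_one_le_mul (hc x hx)
  have hCfin : volume C ≠ ∞ := ((measure_mono hC1).trans_lt (by simp)).ne
  set M : ℝ≥0∞ := c * (ρ.varM C + ρ.meas C / ℓ) with hMdef
  have hℓ' : (ℓ : ℝ≥0∞) ≠ 0 := by exact_mod_cast hℓ0.ne'
  have hMtop : M ≠ ∞ := by
    refine ENNReal.mul_ne_top ENNReal.coe_ne_top (ENNReal.add_ne_top.2 ⟨measure_ne_top _ _, ?_⟩)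
    exact ENNReal.div_ne_top (measure_ne_top _ _) hℓ'
  have hE : IsFiniteMeasure (c • ρ.varM + L • ρ.meas) := inferInstance
  refine (ρ.exists_push hC hψ hderiv hmono hinj hne hmaps
    (c • ρ.varM + L • ρ.meas) ?_ M hMtop ?_).imp fun ρ' h => ⟨h.1, h.2.trans_eq ?_⟩
  rotate_left 2
  · simp only [Measure.coe_add, Measure.coe_nnreal_smul_apply, Pi.add_apply, hMdef,
      ENNReal.div_eq_inv_mul]
    ring
  · have key : ∀ x ∈ C, ∀ y ∈ C, x ≤ y →
        ENNReal.ofReal |ρ.toFun y * |ψ' y|⁻¹ - ρ.toFun x * |ψ' x|⁻¹| ≤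
          (c • ρ.varM + L • ρ.meas) (Set.Icc x y) := by
      intro x hx y hy hxy
      have hs : Set.Icc x y ⊆ C := hC.out hx hy
      have := ρ.abs_mul_sub_mul_le_of_lipschitz (w := fun t => |ψ' t|⁻¹) (c := c) L.coe_nonneg hxy
        (fun t ht => ⟨inv_nonneg.2 (abs_nonneg _), hw t (hs ht)⟩)
        (fun s hs' t ht => hL s (hs hs') t (hs ht))
      refine (ENNReal.ofReal_le_ofReal this).trans_eq ?_
      rw [ENNReal.ofReal_add (by positivity) (by positivity), ENNReal.ofReal_mul (by positivity),
        ENNReal.ofReal_mul (by positivity), ofReal_measureReal, ofReal_measureReal]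
      simp
    intro x hx y hy
    rcases le_total x y with h | h
    · rw [Set.uIcc_of_le h]; exact key x hx y hy h
    · rw [Set.uIcc_of_ge h, abs_sub_comm]; exact key y hy x hx h
  · intro x hx
    rw [ENNReal.ofReal_mul (ρ.nonneg x), mul_comm]
    refine mul_le_mul' ?_ ?_
    · rw [← ENNReal.ofReal_coe_nnreal]; exact ENNReal.ofReal_le_ofReal (hw x hx)
    · have h := ρ.mul_le_meas hC hx
      have hV0 : volume C ≠ 0 := fun h0 => by
        rw [h0] at hℓ; exact hℓ' (le_antisymm hℓ bot_le)
      have h3 : ENNReal.ofReal (ρ.toFun x) ≤ (ρ.meas C + ρ.varM C * volume C) / volume C :=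
        (ENNReal.le_div_iff_mul_le (Or.inl hV0) (Or.inl hCfin)).2 h
      refine h3.trans ?_
      rw [ENNReal.add_div, ENNReal.mul_div_cancel_right hV0 hCfin, add_comm]
      gcongr

/-- A cruder bound with no mass term. The supremum of `ρ` is estimated by its total variation, so
that only the variation of `1 / |ψ'|` enters, and neither a Lipschitz constant nor the length of
`C`. This variation is what the norm of the transfer operator controls. -/
theorem exists_push_of_variation (hC : C.OrdConnected) (hψ : Measurable ψ)
    (hderiv : ∀ x ∈ C, HasDerivWithinAt ψ (ψ' x) C x)
    (hmono : MonotoneOn ψ C ∨ AntitoneOn ψ C) (hinj : Set.InjOn ψ C)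
    (hc : ∀ x ∈ C, 1 ≤ c * |ψ' x|) (hmaps : Set.MapsTo ψ C (Set.Icc 0 1))
    (W : Measure ℝ) [IsFiniteMeasure W]
    (hW : ∀ x ∈ C, ∀ y ∈ C, ENNReal.ofReal |(|ψ' y|⁻¹ - |ψ' x|⁻¹)| ≤ W (Set.uIcc x y)) :
    ∃ ρ' : BVDensity, ρ'.meas = (ρ.meas.restrict C).map ψ ∧
      ρ'.varM Set.univ ≤ (3 * c + W Set.univ) * ρ.varM Set.univ := by
  have hne : ∀ x ∈ C, ψ' x ≠ 0 := by
    intro x hx h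
    have := hc x hx
    rw [h] at this; norm_num at this
  have hw : ∀ x ∈ C, ENNReal.ofReal |ψ' x|⁻¹ ≤ c := fun x hx => by
    rw [← ENNReal.ofReal_coe_nnreal]
    exact ENNReal.ofReal_le_ofReal (inv_abs_le_of_one_le_mul (hc x hx))
  have hfin : IsFiniteMeasure (c • ρ.varM + ρ.varM Set.univ • W) := by
    have : IsFiniteMeasure (ρ.varM Set.univ • W) := Measure.smul_finite _ (measure_ne_top _ _)
    infer_instance
  refine (ρ.exists_push hC hψ hderiv hmono hinj hne hmaps
    (c • ρ.varM + ρ.varM Set.univ • W) ?_ (c * ρ.varM Set.univ) (by finiteness) ?_).imp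
    fun ρ' h => ⟨h.1, h.2.trans ?_⟩
  rotate_left 2
  · calc _ ≤ (c • ρ.varM + ρ.varM Set.univ • W) Set.univ + 2 * (c * ρ.varM Set.univ) := by
          gcongr; exact Set.subset_univ _
      _ = _ := by
          simp only [Measure.coe_add, Pi.add_apply, Measure.smul_apply, smul_eq_mul,
            ENNReal.smul_def]
          ring
  · intro x hx y hy
    have e : ρ.toFun y * |ψ' y|⁻¹ - ρ.toFun x * |ψ' x|⁻¹ =
        |ψ' y|⁻¹ * (ρ.toFun y - ρ.toFun x) + ρ.toFun x * (|ψ' y|⁻¹ - |ψ' x|⁻¹) := by ring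
    rw [e]
    refine (ENNReal.ofReal_le_ofReal (abs_add_le _ _)).trans ?_
    rw [abs_mul, abs_mul, abs_of_nonneg (inv_nonneg.2 (abs_nonneg (ψ' y))),
      abs_of_nonneg (ρ.nonneg x)]
    refine ENNReal.ofReal_add_le.trans ?_
    rw [ENNReal.ofReal_mul (inv_nonneg.2 (abs_nonneg (ψ' y))), ENNReal.ofReal_mul (ρ.nonneg x)]
    simp only [Measure.coe_add, Pi.add_apply, Measure.smul_apply, smul_eq_mul, ENNReal.smul_def]
    exact add_le_add (mul_le_mul' (hw y hy) (ρ.le_varM_uIcc x y))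
      (mul_le_mul' (ρ.le_varM_univ x) (hW x hx y hy))
  · intro x hx
    rw [ENNReal.ofReal_mul (ρ.nonneg x), mul_comm]
    exact mul_le_mul' (hw x hx) (ρ.le_varM_univ x)

end Push

end BVDensity

end Jablonski

namespace Jablonski

variable {n : ℕ}

/-! ### Sums of product measures with controlled variation -/

/-- `ν` is a finite sum of products of one-dimensional measures with densities of bounded
variation, of total (non-mixed) variation at most `v`. -/
def HasVariation (ν : Measure (Fin n → ℝ)) (v : ℝ≥0∞) : Prop :=
  ∃ (K : Type) (_ : Fintype K) (a : K → ℝ≥0∞) (ρ : K → Fin n → BVDensity),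
    (∀ k, a k ≠ ∞) ∧ ν = ∑ k, a k • Measure.pi (fun i => (ρ k i).meas) ∧
    ∑ k, a k * ∑ i, (ρ k i).varM Set.univ * ∏ j ∈ Finset.univ.erase i, (ρ k j).meas Set.univ ≤ v

lemma HasVariation.mono {ν : Measure (Fin n → ℝ)} {v w : ℝ≥0∞} (h : HasVariation ν v)
    (hvw : v ≤ w) : HasVariation ν w := by
  obtain ⟨K, hK, a, ρ, h0, h1, h2⟩ := h
  exact ⟨K, hK, a, ρ, h0, h1, h2.trans hvw⟩

/-- A map of `ℝ^n` that on each of finitely many boxes is a product of monotone differentiable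
maps of the line with derivative at least `1 / c`. -/
structure ProductBranches {S : Type} (f : (Fin n → ℝ) → Fin n → ℝ)
    (C : S → Fin n → Set ℝ) (ψ ψ' : S → Fin n → ℝ → ℝ) (c : ℝ≥0) : Prop where
  measurable_map : Measurable f
  ordConnected : ∀ s i, (C s i).OrdConnected
  subset : ∀ s i, C s i ⊆ Set.Icc 0 1
  mapsTo : ∀ s i, Set.MapsTo (ψ s i) (C s i) (Set.Icc 0 1)
  measurable : ∀ s i, Measurable (ψ s i)
  mono : ∀ s i, MonotoneOn (ψ s i) (C s i) ∨ AntitoneOn (ψ s i) (C s i)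
  injOn : ∀ s i, Set.InjOn (ψ s i) (C s i)
  deriv : ∀ s i, ∀ x ∈ C s i, HasDerivWithinAt (ψ s i) (ψ' s i x) (C s i) x
  expand : ∀ s i, ∀ x ∈ C s i, 1 ≤ c * |ψ' s i x|
  cover : ∀ x : Fin n → ℝ, (∀ i, x i ∈ Set.Icc (0 : ℝ) 1) → ∃ s, ∀ i, x i ∈ C s i
  disj : ∀ s t (x : Fin n → ℝ), (∀ i, x i ∈ C s i) → (∀ i, x i ∈ C t i) → s = t
  apply_eq : ∀ s (x : Fin n → ℝ), (∀ i, x i ∈ C s i) → f x = fun i => ψ s i (x i)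

/-! ### Images of sums of products under a map with product branches. -/

section Step

variable {S : Type} [Fintype S] {f : (Fin n → ℝ) → Fin n → ℝ} {C : S → Fin n → Set ℝ}
  {ψ ψ' : S → Fin n → ℝ → ℝ} {c : ℝ≥0}

lemma BVDensity.meas_compl_Icc (ρ : BVDensity) : ρ.meas (Set.Icc 0 1)ᶜ = 0 := by
  rw [BVDensity.meas, withDensity_apply _ measurableSet_Icc.compl]
  rw [setLIntegral_congr_fun (g := fun _ => 0) measurableSet_Icc.compl]
  · simp
  · intro x hx
    simp [ρ.supp x hx]

/-- The product measure lives on the unit cube, which the boxes partition. On each box the map is a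
product map, and it sends a product measure to a product measure. -/
lemma ProductBranches.map_pi (h : ProductBranches f C ψ ψ' c) (ρ : Fin n → BVDensity) :
    (Measure.pi fun i => (ρ i).meas).map f =
      ∑ s, Measure.pi fun i => ((ρ i).meas.restrict (C s i)).map (ψ s i) := by
  have hms : ∀ s, MeasurableSet (Set.univ.pi (C s)) := fun s =>
    MeasurableSet.univ_pi fun i => (h.ordConnected s i).measurableSet
  have hdec : (Measure.pi fun i => (ρ i).meas) =
      ∑ s, (Measure.pi fun i => (ρ i).meas).restrict (Set.univ.pi (C s)) := by
    have hd : Pairwise (Function.onFun Disjoint fun s => Set.univ.pi (C s)) := by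
      intro s t hst
      rw [Function.onFun, Set.disjoint_left]
      intro x hx hy
      exact hst (h.disj s t x (fun i => hx i trivial) fun i => hy i trivial)
    rw [← Measure.sum_fintype, ← Measure.restrict_iUnion hd hms]
    symm
    refine Measure.restrict_eq_self_of_ae_mem ?_
    have : ∀ᵐ x ∂(Measure.pi fun i => (ρ i).meas), ∀ i, x i ∈ Set.Icc (0 : ℝ) 1 := by
      rw [ae_all_iff]
      intro i
      refine (Measure.quasiMeasurePreserving_eval _ i).ae ?_
      exact measure_eq_zero_iff_ae_notMem.1 (ρ i).meas_compl_Icc |>.mono fun x hx => by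
        simpa using hx
    filter_upwards [this] with x hx
    obtain ⟨s, hs⟩ := h.cover x hx
    exact Set.mem_iUnion.2 ⟨s, fun i _ => hs i⟩
  conv_lhs => rw [hdec]
  rw [Measure.map_finset_sum h.measurable_map.aemeasurable]
  refine Finset.sum_congr rfl fun s _ => ?_
  have hae : f =ᵐ[(Measure.pi fun i => (ρ i).meas).restrict (Set.univ.pi (C s))]
      fun x i => ψ s i (x i) := by
    rw [EventuallyEq, ae_restrict_iff' (hms s)]
    exact Eventually.of_forall fun x hx => h.apply_eq s x fun i => hx i trivial
  rw [Measure.map_congr hae, Measure.restrict_pi_pi,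
    Measure.pi_map_pi fun i => (h.measurable s i).aemeasurable]

lemma ProductBranches.sum_prod_le (h : ProductBranches f C ψ ψ' c) (μ : Fin n → Measure ℝ)
    [∀ i, IsFiniteMeasure (μ i)] : ∑ s, ∏ i, μ i (C s i) ≤ ∏ i, μ i Set.univ := by
  have hd : Pairwise (Function.onFun Disjoint fun s => Set.univ.pi (C s)) := by
    intro s t hst
    rw [Function.onFun, Set.disjoint_left]
    intro x hx hy
    exact hst (h.disj s t x (fun i => hx i trivial) fun i => hy i trivial)
  have := measure_iUnion (μ := Measure.pi μ) hd fun s =>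
    MeasurableSet.univ_pi fun i => (h.ordConnected s i).measurableSet
  simp only [Measure.pi_pi, tsum_fintype] at this
  rw [← this, ← Measure.pi_univ]
  exact measure_mono (Set.subset_univ _)

/-- The bound by disjointness of the boxes, with one factor replaced by the measure `D`. It lets the
variations on the separate boxes be summed without a factor for their number. -/
lemma ProductBranches.sum_mul_prod_le (h : ProductBranches f C ψ ψ' c) (D : Measure ℝ)
    [IsFiniteMeasure D] (μ : Fin n → Measure ℝ) [hμ : ∀ i, IsFiniteMeasure (μ i)] (i : Fin n) :
    ∑ s, D (C s i) * ∏ j ∈ Finset.univ.erase i, μ j (C s j) ≤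
      D Set.univ * ∏ j ∈ Finset.univ.erase i, μ j Set.univ := by
  have hfin : ∀ j, IsFiniteMeasure (Function.update μ i D j) := by
    intro j
    by_cases hj : j = i
    · subst hj; simpa
    · rw [Function.update_of_ne hj]; infer_instance
  have key : ∀ A : Fin n → Set ℝ, ∏ j, (Function.update μ i D j) (A j) =
      D (A i) * ∏ j ∈ Finset.univ.erase i, μ j (A j) := by
    intro A
    rw [← Finset.mul_prod_erase _ _ (Finset.mem_univ i), Function.update_self]
    congr 1
    refine Finset.prod_congr rfl fun j hj => ?_
    rw [Function.update_of_ne (Finset.ne_of_mem_erase hj)]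
  have := h.sum_prod_le (Function.update μ i D)
  simpa only [key] using this

lemma map_meas_univ {ρ' ρ : BVDensity} {A : Set ℝ} {g : ℝ → ℝ} (hg : Measurable g)
    (h : ρ'.meas = (ρ.meas.restrict A).map g) : ρ'.meas Set.univ = ρ.meas A := by
  rw [h, Measure.map_apply hg MeasurableSet.univ]; simp

/-- The general form of a step: the branches are pushed one by one. -/
lemma ProductBranches.hasVariation_map (h : ProductBranches f C ψ ψ' c)
    {K : Type} [Fintype K] {a : K → ℝ≥0∞} (ρ : K → Fin n → BVDensity) (ha : ∀ k, a k ≠ ∞)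
    (ρ' : K → S → Fin n → BVDensity)
    (hρ' : ∀ k s i, (ρ' k s i).meas = ((ρ k i).meas.restrict (C s i)).map (ψ s i)) :
    HasVariation ((∑ k, a k • Measure.pi (fun i => (ρ k i).meas)).map f)
      (∑ k, a k * ∑ i, ∑ s, (ρ' k s i).varM Set.univ *
        ∏ j ∈ Finset.univ.erase i, (ρ k j).meas (C s j)) := by
  refine ⟨K × S, inferInstance, fun p => a p.1, fun p => ρ' p.1 p.2, fun p => ha p.1, ?_, ?_⟩
  · rw [Measure.map_finset_sum h.measurable_map.aemeasurable, Fintype.sum_prod_type]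
    refine Finset.sum_congr rfl fun k _ => ?_
    rw [Measure.map_smul, h.map_pi, Finset.smul_sum]
    simp only [hρ']
  · rw [Fintype.sum_prod_type]
    refine Finset.sum_le_sum fun k _ => ?_
    dsimp only
    rw [← Finset.mul_sum, Finset.sum_comm]
    have e : ∀ s j, (ρ' k s j).meas Set.univ = (ρ k j).meas (C s j) := fun s j =>
      map_meas_univ (h.measurable s j) (hρ' k s j)
    simp only [e, le_refl]

/-- For each direction, one factor contributes its variation and the others their masses. By
disjointness, summation over the boxes keeps the constant `3 * c` of a single branch; the mass term
appears once for each of the `n` directions. -/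
theorem ProductBranches.hasVariation_map_of_lipschitz (h : ProductBranches f C ψ ψ' c) {L ℓ : ℝ≥0}
    (hL : ∀ s i, ∀ x ∈ C s i, ∀ y ∈ C s i, |(|ψ' s i y|⁻¹ - |ψ' s i x|⁻¹)| ≤ L * |y - x|)
    (hℓ0 : 0 < ℓ) (hℓ : ∀ s i, volume (C s i) = 0 ∨ ℓ ≤ volume (C s i))
    {ν : Measure (Fin n → ℝ)} {v : ℝ≥0∞} (hν : HasVariation ν v) :
    HasVariation (ν.map f) (3 * c * v + n * (L + 2 * c / ℓ) * ν Set.univ) := by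
  obtain ⟨K, hK, a, ρ, ha, rfl, hv⟩ := hν
  have hex : ∀ k s i, ∃ ρ' : BVDensity,
      ρ'.meas = ((ρ k i).meas.restrict (C s i)).map (ψ s i) ∧
      ρ'.varM Set.univ ≤ 3 * c * (ρ k i).varM (C s i) + (L + 2 * c / ℓ) * (ρ k i).meas (C s i) :=
    fun k s i => (ρ k i).exists_push_of_lipschitz (h.ordConnected s i) (h.measurable s i)
      (h.deriv s i) (h.mono s i) (h.injOn s i) (h.expand s i) (h.mapsTo s i) (h.subset s i)
      (hL s i) hℓ0 (hℓ s i)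
  choose ρ' hρ' hvar using hex
  refine (h.hasVariation_map ρ ha ρ' hρ').mono ?_
  have hmass : (∑ k, a k • Measure.pi (fun i => (ρ k i).meas)) Set.univ =
      ∑ k, a k * ∏ i, (ρ k i).meas Set.univ := by
    simp [Measure.pi_univ]
  rw [hmass]
  calc _ ≤ ∑ k, a k * ∑ i, (3 * c * ((ρ k i).varM Set.univ *
            ∏ j ∈ Finset.univ.erase i, (ρ k j).meas Set.univ) +
            (L + 2 * c / ℓ) * ∏ j, (ρ k j).meas Set.univ) := by
        gcongr with k _ i _
        calc _ ≤ ∑ s, (3 * c * ((ρ k i).varM (C s i) *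
                  ∏ j ∈ Finset.univ.erase i, (ρ k j).meas (C s j)) +
                  (L + 2 * c / ℓ) * ∏ j, (ρ k j).meas (C s j)) := by
              refine Finset.sum_le_sum fun s _ => ?_
              rw [← Finset.mul_prod_erase Finset.univ (fun j => (ρ k j).meas (C s j))
                (Finset.mem_univ i)]
              calc _ ≤ (3 * c * (ρ k i).varM (C s i) + (L + 2 * c / ℓ) * (ρ k i).meas (C s i)) *
                    ∏ j ∈ Finset.univ.erase i, (ρ k j).meas (C s j) := by
                    gcongr; exact hvar k s i
                _ = _ := by ring
          _ ≤ _ := by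
              rw [Finset.sum_add_distrib, ← Finset.mul_sum, ← Finset.mul_sum]
              gcongr
              · exact h.sum_mul_prod_le _ _ i
              · exact h.sum_prod_le _
    _ = 3 * c * (∑ k, a k * ∑ i, (ρ k i).varM Set.univ *
            ∏ j ∈ Finset.univ.erase i, (ρ k j).meas Set.univ) +
          n * (L + 2 * c / ℓ) * ∑ k, a k * ∏ i, (ρ k i).meas Set.univ := by
        rw [Finset.mul_sum, Finset.mul_sum, ← Finset.sum_add_distrib]
        refine Finset.sum_congr rfl fun k _ => ?_
        rw [Finset.sum_add_distrib, ← Finset.mul_sum, Finset.sum_const, Finset.card_univ,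
          Fintype.card_fin, nsmul_eq_mul]
        ring
    _ ≤ _ := by gcongr

/-- This bound need not contract, so the branches are estimated separately and their number is
allowed to enter. -/
theorem ProductBranches.hasVariation_map_of_variation (h : ProductBranches f C ψ ψ' c) {X : ℝ≥0∞}
    (hW : ∀ s i, ∃ W : Measure ℝ, IsFiniteMeasure W ∧ W Set.univ ≤ X ∧
      ∀ x ∈ C s i, ∀ y ∈ C s i,
        ENNReal.ofReal |(|ψ' s i y|⁻¹ - |ψ' s i x|⁻¹)| ≤ W (Set.uIcc x y))
    {ν : Measure (Fin n → ℝ)} {v : ℝ≥0∞} (hν : HasVariation ν v) :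
    HasVariation (ν.map f) (Fintype.card S * (3 * c + X) * v) := by
  obtain ⟨K, hK, a, ρ, ha, rfl, hv⟩ := hν
  have hex : ∀ k s i, ∃ ρ' : BVDensity,
      ρ'.meas = ((ρ k i).meas.restrict (C s i)).map (ψ s i) ∧
      ρ'.varM Set.univ ≤ (3 * c + X) * (ρ k i).varM Set.univ := by
    intro k s i
    obtain ⟨W, hWf, hWX, hW⟩ := hW s i
    obtain ⟨ρ', h1, h2⟩ := (ρ k i).exists_push_of_variation (h.ordConnected s i) (h.measurable s i)
      (h.deriv s i) (h.mono s i) (h.injOn s i) (h.expand s i) (h.mapsTo s i) W hW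
    exact ⟨ρ', h1, h2.trans (by gcongr)⟩
  choose ρ' hρ' hvar using hex
  refine (h.hasVariation_map ρ ha ρ' hρ').mono ?_
  calc _ ≤ ∑ k, a k * ∑ i, ∑ _s : S, (3 * c + X) * (ρ k i).varM Set.univ *
            ∏ j ∈ Finset.univ.erase i, (ρ k j).meas Set.univ := by
        gcongr with k _ i _ s _ j _
        · exact hvar k s i
        · exact Set.subset_univ _
    _ = Fintype.card S * (3 * c + X) * (∑ k, a k * ∑ i, (ρ k i).varM Set.univ *
            ∏ j ∈ Finset.univ.erase i, (ρ k j).meas Set.univ) := by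
        rw [Finset.mul_sum]
        refine Finset.sum_congr rfl fun k _ => ?_
        simp only [Finset.sum_const, Finset.card_univ, nsmul_eq_mul, mul_assoc, Finset.mul_sum]
        refine Finset.sum_congr rfl fun i _ => ?_
        ring
    _ ≤ _ := by gcongr

end Step

/-! ### Grids -/

/-- The `j`-th interval of length `1 / m`. -/
def gridIco (m j : ℕ) : Set ℝ := Set.Ico ((j : ℝ) / m) ((j + 1 : ℝ) / m)

/-- The cell with index `q` of the grid of mesh `1 / m`. -/
def gridCell (m : ℕ) (q : Fin n → Fin m) : Set (Fin n → ℝ) :=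
  Set.univ.pi fun i => gridIco m (q i)

lemma measurableSet_gridIco (m j : ℕ) : MeasurableSet (gridIco m j) := measurableSet_Ico

lemma measurableSet_gridCell (m : ℕ) (q : Fin n → Fin m) : MeasurableSet (gridCell m q) :=
  MeasurableSet.univ_pi fun _ => measurableSet_gridIco m _

lemma volume_gridIco {m : ℕ} (hm : 0 < m) (j : ℕ) : volume (gridIco m j) = (m : ℝ≥0∞)⁻¹ := by
  have hm' : (0 : ℝ) < m := by exact_mod_cast hm
  rw [gridIco, Real.volume_Ico, ← ENNReal.ofReal_natCast, ← ENNReal.ofReal_inv_of_pos hm']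
  congr 1
  field_simp
  ring

lemma mem_gridIco_iff {m : ℕ} (hm : 0 < m) {j : ℕ} {x : ℝ} (hx : 0 ≤ x) :
    x ∈ gridIco m j ↔ ⌊x * m⌋₊ = j := by
  have hm' : (0 : ℝ) < m := by exact_mod_cast hm
  rw [gridIco, Set.mem_Ico, Nat.floor_eq_iff (by positivity), div_le_iff₀ hm', lt_div_iff₀ hm']

lemma pairwise_disjoint_gridIco {m : ℕ} (hm : 0 < m) :
    Pairwise (Function.onFun Disjoint fun j : Fin m => gridIco m j) := by
  have hm' : (0 : ℝ) < m := by exact_mod_cast hm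
  intro i j hij
  rw [Function.onFun, Set.disjoint_left]
  intro x hx hy
  have h0 : 0 ≤ x := le_trans (by positivity) hx.1
  rw [mem_gridIco_iff hm h0] at hx hy
  exact hij (Fin.ext (hx.symm.trans hy))

lemma iUnion_gridIco {m : ℕ} (hm : 0 < m) : ⋃ j : Fin m, gridIco m j = Set.Ico (0 : ℝ) 1 := by
  have hm' : (0 : ℝ) < m := by exact_mod_cast hm
  ext x
  simp only [Set.mem_iUnion, Set.mem_Ico]
  constructor
  · rintro ⟨j, hj⟩
    refine ⟨le_trans (by positivity) hj.1, hj.2.trans_le ?_⟩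
    rw [div_le_one hm']
    exact_mod_cast j.2
  · rintro ⟨h0, h1⟩
    have : ⌊x * m⌋₊ < m := by
      rw [Nat.floor_lt (by positivity)]
      nlinarith
    exact ⟨⟨_, this⟩, (mem_gridIco_iff hm h0).2 rfl⟩

lemma sum_measure_gridIco {m : ℕ} (hm : 0 < m) (D : Measure ℝ) :
    ∑ j : Fin m, D (gridIco m j) ≤ D Set.univ := by
  have := measure_iUnion (μ := D) (pairwise_disjoint_gridIco hm) fun j => measurableSet_gridIco m j
  rw [tsum_fintype] at this
  rw [← this]
  exact measure_mono (Set.subset_univ _)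

lemma BVDensity.sum_meas_gridIco {m : ℕ} (hm : 0 < m) (ρ : BVDensity) :
    ∑ j : Fin m, ρ.meas (gridIco m j) = ρ.meas Set.univ := by
  have := measure_iUnion (μ := ρ.meas) (pairwise_disjoint_gridIco hm)
    fun j => measurableSet_gridIco m j
  rw [tsum_fintype, iUnion_gridIco hm] at this
  rw [← this]
  have h1 : ρ.meas (Set.Ico 0 1)ᶜ = 0 := by
    refine measure_mono_null (t := (Set.Icc 0 1)ᶜ ∪ {1}) ?_ (measure_union_null ρ.meas_compl_Icc
      (ρ.meas_absolutelyContinuous (by simp)))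
    intro x hx
    by_cases h : x = 1
    · exact Or.inr h
    · refine Or.inl fun h' => hx ⟨h'.1, lt_of_le_of_ne h'.2 h⟩
  rw [← measure_add_measure_compl (μ := ρ.meas) (measurableSet_Ico (a := (0 : ℝ)) (b := 1)), h1,
    add_zero]

lemma pairwise_disjoint_gridCell {m : ℕ} (hm : 0 < m) :
    Pairwise (Function.onFun Disjoint fun q : Fin n → Fin m => gridCell m q) := by
  intro q q' hq
  obtain ⟨i, hi⟩ := Function.ne_iff.1 hq
  rw [Function.onFun, Set.disjoint_left]
  intro x hx hy
  exact (Set.disjoint_left.1 (pairwise_disjoint_gridIco hm hi)) (hx i trivial) (hy i trivial)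

lemma volume_gridCell {m : ℕ} (hm : 0 < m) (q : Fin n → Fin m) :
    volume (gridCell m q) = ((m : ℝ≥0∞) ^ n)⁻¹ := by
  rw [gridCell, volume_pi_pi]
  simp [volume_gridIco hm, ENNReal.inv_pow]

/-- The indicator function of an interval of a grid. -/
noncomputable def gridDensity (m : ℕ) (hm : 0 < m) (j : Fin m) : BVDensity where
  toFun := (gridIco m j).indicator 1
  varM := Measure.dirac ((j : ℝ) / m) + Measure.dirac ((j + 1 : ℝ) / m)
  nonneg x := Set.indicator_nonneg (fun _ _ => zero_le_one) x
  supp x hx := by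
    refine Set.indicator_of_notMem (fun h => hx ?_) _
    have : x ∈ Set.Ico (0 : ℝ) 1 := iUnion_gridIco hm ▸ Set.mem_iUnion.2 ⟨j, h⟩
    exact ⟨this.1, this.2.le⟩
  finite_varM := inferInstance
  le_varM x y hxy := by
    by_cases hx : x ∈ gridIco m j <;> by_cases hy : y ∈ gridIco m j
    · simp [hx, hy]
    · have : (j + 1 : ℝ) / m ∈ Set.Icc x y := by
        refine ⟨hx.2.le, ?_⟩
        by_contra! h
        exact hy ⟨hx.1.trans hxy, h⟩
      rw [Measure.add_apply, Measure.dirac_apply' _ measurableSet_Icc,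
        Measure.dirac_apply' _ measurableSet_Icc, Set.indicator_of_mem this]
      simp [hx, hy]
    · have : (j : ℝ) / m ∈ Set.Icc x y := by
        refine ⟨?_, hy.1⟩
        by_contra! h
        exact hx ⟨h.le, hxy.trans_lt hy.2⟩
      rw [Measure.add_apply, Measure.dirac_apply' _ measurableSet_Icc,
        Measure.dirac_apply' _ measurableSet_Icc, Set.indicator_of_mem this]
      simp [hx, hy]
    · simp [hx, hy]

lemma gridDensity_meas {m : ℕ} (hm : 0 < m) (j : Fin m) :
    (gridDensity m hm j).meas = volume.restrict (gridIco m j) := by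
  rw [BVDensity.meas, ← withDensity_indicator_one (measurableSet_gridIco m j)]
  congr 1
  ext x
  by_cases hx : x ∈ gridIco m j <;> simp [gridDensity, hx]

/-- The average of a measure over the cells of a grid. -/
noncomputable def gridAverage (m : ℕ) (ν : Measure (Fin n → ℝ)) : Measure (Fin n → ℝ) :=
  ∑ q : Fin n → Fin m, ((m : ℝ≥0∞) ^ n * ν (gridCell m q)) • volume.restrict (gridCell m q)

lemma gridAverage_apply (m : ℕ) (ν : Measure (Fin n → ℝ)) (A : Set (Fin n → ℝ)) :
    gridAverage m ν A =
      ∑ q : Fin n → Fin m, (m : ℝ≥0∞) ^ n * ν (gridCell m q) * volume (A ∩ gridCell m q) := by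
  simp only [gridAverage, Measure.coe_finsetSum, Finset.sum_apply, Measure.smul_apply,
    smul_eq_mul, Measure.restrict_apply' (measurableSet_gridCell m _)]

lemma sum_measure_gridCell_le {m : ℕ} (hm : 0 < m) (ν : Measure (Fin n → ℝ)) :
    ∑ q : Fin n → Fin m, ν (gridCell m q) ≤ ν Set.univ := by
  have := measure_iUnion (μ := ν) (pairwise_disjoint_gridCell hm)
    fun q : Fin n → Fin m => measurableSet_gridCell m q
  rw [tsum_fintype] at this
  rw [← this]
  exact measure_mono (Set.subset_univ _)

lemma iUnion_gridCell {m : ℕ} (hm : 0 < m) :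
    ⋃ q : Fin n → Fin m, gridCell m q = Set.univ.pi fun _ => Set.Ico (0 : ℝ) 1 := by
  ext x
  simp only [Set.mem_iUnion, gridCell, Set.mem_pi, Set.mem_univ, forall_true_left,
    ← iUnion_gridIco hm]
  exact ⟨fun ⟨q, hq⟩ i => ⟨q i, hq i⟩, fun h => ⟨fun i => (h i).choose, fun i => (h i).choose_spec⟩⟩

lemma gridAverage_univ {m : ℕ} (hm : 0 < m) (ν : Measure (Fin n → ℝ))
    (hν : ν (Set.univ.pi fun _ => Set.Ico (0 : ℝ) 1)ᶜ = 0) :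
    gridAverage m ν Set.univ = ν Set.univ := by
  rw [gridAverage_apply]
  have hm' : (m : ℝ≥0∞) ^ n ≠ 0 := by positivity
  have hm'' : (m : ℝ≥0∞) ^ n ≠ ∞ := by finiteness
  have : ∀ q : Fin n → Fin m, (m : ℝ≥0∞) ^ n * ν (gridCell m q) *
      volume (Set.univ ∩ gridCell m q) = ν (gridCell m q) := by
    intro q
    rw [Set.univ_inter, volume_gridCell hm, mul_comm ((m : ℝ≥0∞) ^ n), mul_assoc,
      ENNReal.mul_inv_cancel hm' hm'', mul_one]
  simp only [this]
  have h := measure_iUnion (μ := ν) (pairwise_disjoint_gridCell hm)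
    fun q : Fin n → Fin m => measurableSet_gridCell m q
  rw [tsum_fintype, iUnion_gridCell hm] at h
  rw [← h, ← measure_add_measure_compl (μ := ν)
    (MeasurableSet.univ_pi fun _ : Fin n => measurableSet_Ico (a := (0 : ℝ)) (b := 1)), hν, add_zero]

lemma gridAverage_absolutelyContinuous (m : ℕ) (ν : Measure (Fin n → ℝ)) :
    gridAverage m ν ≪ volume := by
  intro A hA
  rw [gridAverage_apply]
  refine Finset.sum_eq_zero fun q _ => ?_
  rw [measure_mono_null Set.inter_subset_left hA, mul_zero]

/-- A cell has weight `m ^ n` times its mass, and in each of the `n` directions two unit jumps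
across faces of area `m ^ (-(n - 1))`. -/
lemma hasVariation_gridAverage {m : ℕ} (hm : 0 < m) (ν : Measure (Fin n → ℝ)) [IsFiniteMeasure ν] :
    HasVariation (gridAverage m ν) (2 * n * m * ν Set.univ) := by
  refine ⟨Fin n → Fin m, inferInstance, fun q => (m : ℝ≥0∞) ^ n * ν (gridCell m q),
    fun q i => gridDensity m hm (q i), fun q => by finiteness, ?_, ?_⟩
  · simp only [gridAverage, gridDensity_meas, gridCell, volume_pi, Measure.restrict_pi_pi]
  · have hm0 : (m : ℝ≥0∞) ≠ 0 := by positivity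
    have hvar : ∀ j, (gridDensity m hm j).varM Set.univ = 2 := by
      intro j
      simp only [gridDensity, Measure.add_apply, measure_univ]
      norm_num
    simp only [hvar, gridDensity_meas, Measure.restrict_apply_univ, volume_gridIco hm,
      Finset.prod_const, Finset.sum_const, Finset.card_univ, Fintype.card_fin,
      Finset.card_erase_of_mem (Finset.mem_univ _), nsmul_eq_mul]
    rw [← Finset.sum_mul, ← Finset.mul_sum]
    rcases Nat.eq_zero_or_pos n with rfl | hn
    · simp
    · obtain ⟨k, rfl⟩ : ∃ k, n = k + 1 := ⟨n - 1, by omega⟩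
      have e : (m : ℝ≥0∞) ^ k * ((m : ℝ≥0∞)⁻¹) ^ k = 1 := by
        rw [← mul_pow, ENNReal.mul_inv_cancel hm0 (by simp), one_pow]
      simp only [Nat.add_sub_cancel]
      calc _ = (∑ q : Fin (k + 1) → Fin m, ν (gridCell m q)) * m * ((k + 1 : ℕ) : ℝ≥0∞) * 2 *
            ((m : ℝ≥0∞) ^ k * ((m : ℝ≥0∞)⁻¹) ^ k) := by ring
        _ ≤ ν Set.univ * m * ((k + 1 : ℕ) : ℝ≥0∞) * 2 * 1 := by
            rw [e]
            gcongr
            exact sum_measure_gridCell_le hm ν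
        _ = _ := by ring

/-- Subtract `d i` from one factor at a time. Each replacement costs `d i` times the other factors,
which are at most their original values. Truncation of the subtraction only helps. -/
lemma prod_le_prod_tsub_add {ι : Type*} [DecidableEq ι] (s : Finset ι) (a d : ι → ℝ≥0∞) :
    ∏ i ∈ s, a i ≤ ∏ i ∈ s, (a i - d i) + ∑ i ∈ s, d i * ∏ j ∈ s.erase i, a j := by
  induction s using Finset.induction_on with
  | empty => simp
  | insert b s hb ih =>
    rw [Finset.prod_insert hb, Finset.prod_insert hb, Finset.sum_insert hb,
      Finset.erase_insert hb]
    have h1 : ∑ i ∈ s, d i * ∏ j ∈ (insert b s).erase i, a j =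
        a b * ∑ i ∈ s, d i * ∏ j ∈ s.erase i, a j := by
      rw [Finset.mul_sum]
      refine Finset.sum_congr rfl fun i hi => ?_
      have hbi : b ≠ i := fun h => hb (h ▸ hi)
      rw [Finset.erase_insert_of_ne hbi, Finset.prod_insert (fun h => hb (Finset.mem_of_mem_erase h))]
      ring
    rw [h1]
    set X := ∑ i ∈ s, d i * ∏ j ∈ s.erase i, a j
    calc a b * ∏ i ∈ s, a i ≤ ((a b - d b) + d b) * ∏ i ∈ s, a i := by
          gcongr; exact le_tsub_add
      _ = (a b - d b) * ∏ i ∈ s, a i + d b * ∏ i ∈ s, a i := by ring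
      _ ≤ (a b - d b) * (∏ i ∈ s, (a i - d i) + X) + d b * ∏ i ∈ s, a i := by gcongr
      _ = (a b - d b) * ∏ i ∈ s, (a i - d i) + ((a b - d b) * X + d b * ∏ i ∈ s, a i) := by ring
      _ ≤ _ := by
          rw [add_comm (d b * _)]
          gcongr
          exact tsub_le_self

/-- On an interval of length `1 / m` the density is at least its mean minus its variation there. -/
lemma BVDensity.smul_volume_le_meas {m : ℕ} (hm : 0 < m) (ρ : BVDensity) (j : Fin m) :
    ((m : ℝ≥0∞) * ρ.meas (gridIco m j) - ρ.varM (gridIco m j)) • volume.restrict (gridIco m j) ≤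
      ρ.meas := by
  set I := gridIco m j with hI
  have hIo : I.OrdConnected := Set.ordConnected_Ico
  have hm0 : (m : ℝ≥0∞) ≠ 0 := by positivity
  have hpt : ∀ x ∈ I, (m : ℝ≥0∞) * ρ.meas I - ρ.varM I ≤ ENNReal.ofReal (ρ.toFun x) := by
    intro x hx
    rw [tsub_le_iff_right]
    have h1 : ρ.meas I ≤ (ENNReal.ofReal (ρ.toFun x) + ρ.varM I) * volume I := by
      rw [BVDensity.meas, withDensity_apply _ hIo.measurableSet, ← setLIntegral_const]
      refine setLIntegral_mono' hIo.measurableSet fun t ht => ?_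
      rw [← ENNReal.ofReal_toReal (measure_ne_top ρ.varM I)]
      exact (ENNReal.ofReal_le_ofReal (ρ.le_add_of_mem hIo ht hx)).trans ENNReal.ofReal_add_le
    rw [volume_gridIco hm] at h1
    calc (m : ℝ≥0∞) * ρ.meas I ≤ m * ((ENNReal.ofReal (ρ.toFun x) + ρ.varM I) * (m : ℝ≥0∞)⁻¹) := by
          gcongr
      _ = (ENNReal.ofReal (ρ.toFun x) + ρ.varM I) * (m * (m : ℝ≥0∞)⁻¹) := by ring
      _ = _ := by rw [ENNReal.mul_inv_cancel hm0 (by simp), mul_one]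
  refine Measure.le_iff.2 fun A hA => ?_
  rw [Measure.smul_apply, smul_eq_mul, Measure.restrict_apply hA]
  calc _ = ∫⁻ _ in A ∩ I, ((m : ℝ≥0∞) * ρ.meas I - ρ.varM I) := (setLIntegral_const _ _).symm
    _ ≤ ∫⁻ x in A ∩ I, ENNReal.ofReal (ρ.toFun x) :=
        setLIntegral_mono' (hA.inter hIo.measurableSet) fun x hx => hpt x hx.2
    _ ≤ ∫⁻ x in A, ENNReal.ofReal (ρ.toFun x) := lintegral_mono_set Set.inter_subset_left
    _ = ρ.meas A := by rw [BVDensity.meas, withDensity_apply _ hA]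

/-- The product measure comes from the largest outer measure that is bounded on boxes by the product
of the sides, so the domination has to be checked on boxes only. -/
lemma prod_mul_volume_le_pi (μ : Fin n → Measure ℝ) [∀ i, IsFiniteMeasure (μ i)] (b : Fin n → ℝ≥0∞)
    (I : Fin n → Set ℝ) (hI : ∀ i, MeasurableSet (I i))
    (h : ∀ i, b i • volume.restrict (I i) ≤ μ i) {A : Set (Fin n → ℝ)} (hA : MeasurableSet A) :
    (∏ i, b i) * volume (A ∩ Set.univ.pi I) ≤ Measure.pi μ A := by
  have key : ((∏ i, b i) • (volume : Measure (Fin n → ℝ)).restrict (Set.univ.pi I)).toOuterMeasure ≤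
      OuterMeasure.pi fun i => (μ i).toOuterMeasure := by
    rw [OuterMeasure.le_pi]
    intro s _
    have hm : MeasurableSet (Set.univ.pi I) := MeasurableSet.univ_pi hI
    simp only [Measure.coe_toOuterMeasure, Measure.smul_apply, smul_eq_mul]
    rw [Measure.restrict_apply' hm, ← Set.pi_inter_distrib, volume_pi_pi, ← Finset.prod_mul_distrib]
    refine Finset.prod_le_prod' fun i _ => ?_
    have := Measure.le_iff'.1 (h i) (s i)
    rwa [Measure.smul_apply, smul_eq_mul, Measure.restrict_apply' (hI i)] at this
  have h2 := key A
  rw [Measure.pi, toMeasure_apply _ _ hA]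
  refine le_trans (le_of_eq ?_) h2
  simp only [Measure.coe_toOuterMeasure, Measure.smul_apply, smul_eq_mul]
  rw [Measure.restrict_apply hA]

/-- A measure of mass one and of controlled variation is at least `1/2` times Lebesgue measure
on some cell of a grid whose mesh depends only on the variation. -/
theorem HasVariation.exists_gridCell {ν : Measure (Fin n → ℝ)} {v : ℝ≥0∞} (hν : HasVariation ν v)
    (hmass : ν Set.univ = 1) (hn : 1 ≤ n) {m : ℕ} (hm : 0 < m) (hv : 2 * v ≤ m) :
    ∃ q : Fin n → Fin m, ∀ A, MeasurableSet A → 2⁻¹ * volume (A ∩ gridCell m q) ≤ ν A := by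
  classical
  obtain ⟨K, hK, a, ρ, ha, rfl, hvar⟩ := hν
  -- A lower bound for the density of the measure on the cell `q`: in every factor, mean minus
  -- variation.
  set X : (Fin n → Fin m) → ℝ≥0∞ := fun q => ∑ k, a k *
    ∏ i, ((m : ℝ≥0∞) * (ρ k i).meas (gridIco m (q i)) - (ρ k i).varM (gridIco m (q i))) with hX
  have hm0 : (m : ℝ≥0∞) ≠ 0 := by positivity
  have hlow : ∀ q A, MeasurableSet A → X q * volume (A ∩ gridCell m q) ≤
      (∑ k, a k • Measure.pi (fun i => (ρ k i).meas)) A := by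
    intro q A hA
    simp only [hX, Measure.coe_finsetSum, Finset.sum_apply, Measure.smul_apply, smul_eq_mul,
      Finset.sum_mul, mul_assoc]
    gcongr with k _
    exact prod_mul_volume_le_pi _ _ _
      (fun i => measurableSet_gridIco m _) (fun i => (ρ k i).smul_volume_le_meas hm (q i)) hA
  -- Summed over all cells, the products of the means alone give `m ^ n`, the total mass being one;
  -- subtracting the variations loses at most `m ^ (n - 1) * v`.
  have hsum : (m : ℝ≥0∞) ^ n ≤ ∑ q, X q + (m : ℝ≥0∞) ^ (n - 1) * v := by
    have hmass' : ∑ k, a k * ∏ i, (ρ k i).meas Set.univ = 1 := by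
      rw [← hmass]
      simp [Measure.pi_univ]
    have hL : (m : ℝ≥0∞) ^ n = ∑ k, a k *
        ∑ q : Fin n → Fin m, ∏ i, ((m : ℝ≥0∞) * (ρ k i).meas (gridIco m (q i))) := by
      rw [← mul_one ((m : ℝ≥0∞) ^ n), ← hmass', Finset.mul_sum]
      refine Finset.sum_congr rfl fun k _ => ?_
      simp only [Finset.prod_mul_distrib, Finset.prod_const, Finset.card_univ, Fintype.card_fin]
      rw [← Finset.mul_sum]
      have := Finset.prod_univ_sum (fun _ : Fin n => (Finset.univ : Finset (Fin m)))
        (fun i j => (ρ k i).meas (gridIco m j))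
      rw [Fintype.piFinset_univ] at this
      rw [← this]
      simp only [(ρ k _).sum_meas_gridIco hm]
      ring
    rw [hL]
    have hstep : ∀ k, ∑ q : Fin n → Fin m, ∏ i, ((m : ℝ≥0∞) * (ρ k i).meas (gridIco m (q i))) ≤
        ∑ q : Fin n → Fin m, ∏ i, ((m : ℝ≥0∞) * (ρ k i).meas (gridIco m (q i)) -
          (ρ k i).varM (gridIco m (q i))) + (m : ℝ≥0∞) ^ (n - 1) *
          ∑ i, (ρ k i).varM Set.univ * ∏ j ∈ Finset.univ.erase i, (ρ k j).meas Set.univ := by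
      intro k
      refine (Finset.sum_le_sum fun q _ => prod_le_prod_tsub_add Finset.univ _
        (fun i => (ρ k i).varM (gridIco m (q i)))).trans ?_
      rw [Finset.sum_add_distrib]
      gcongr
      rw [Finset.sum_comm, Finset.mul_sum]
      gcongr with i _
      simp only [Finset.prod_mul_distrib, Finset.prod_const,
        Finset.card_erase_of_mem (Finset.mem_univ _), Finset.card_univ, Fintype.card_fin]
      have key : ∑ q : Fin n → Fin m, (ρ k i).varM (gridIco m (q i)) *
          ∏ j ∈ Finset.univ.erase i, (ρ k j).meas (gridIco m (q j)) ≤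
          (ρ k i).varM Set.univ * ∏ j ∈ Finset.univ.erase i, (ρ k j).meas Set.univ := by
        set μ : Fin n → Measure ℝ := Function.update (fun j => (ρ k j).meas) i (ρ k i).varM with hμ
        have e : ∀ A : Fin n → Set ℝ, (ρ k i).varM (A i) *
            ∏ j ∈ Finset.univ.erase i, (ρ k j).meas (A j) = ∏ j, μ j (A j) := by
          intro A
          rw [← Finset.mul_prod_erase _ _ (Finset.mem_univ i), hμ, Function.update_self]
          congr 1
          refine Finset.prod_congr rfl fun j hj => ?_
          rw [Function.update_of_ne (Finset.ne_of_mem_erase hj)]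
        rw [e fun _ => Set.univ]
        simp only [fun q : Fin n → Fin m => e fun j => gridIco m (q j)]
        have := Finset.prod_univ_sum (fun _ : Fin n => (Finset.univ : Finset (Fin m)))
          (fun i j => μ i (gridIco m j))
        rw [Fintype.piFinset_univ] at this
        rw [← this]
        exact Finset.prod_le_prod' fun j _ => sum_measure_gridIco hm (μ j)
      calc _ = (m : ℝ≥0∞) ^ (n - 1) * ∑ q : Fin n → Fin m, (ρ k i).varM (gridIco m (q i)) *
          ∏ j ∈ Finset.univ.erase i, (ρ k j).meas (gridIco m (q j)) := by
            rw [Finset.mul_sum]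
            refine Finset.sum_congr rfl fun q _ => ?_
            ring
        _ ≤ _ := by gcongr
    calc _ ≤ ∑ k, a k * (∑ q : Fin n → Fin m,
            ∏ i, ((m : ℝ≥0∞) * (ρ k i).meas (gridIco m (q i)) -
            (ρ k i).varM (gridIco m (q i))) + (m : ℝ≥0∞) ^ (n - 1) *
            ∑ i, (ρ k i).varM Set.univ * ∏ j ∈ Finset.univ.erase i, (ρ k j).meas Set.univ) := by
          gcongr with k _
          exact hstep k
      _ = ∑ q, X q + (m : ℝ≥0∞) ^ (n - 1) * ∑ k, a k * ∑ i, (ρ k i).varM Set.univ *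
            ∏ j ∈ Finset.univ.erase i, (ρ k j).meas Set.univ := by
          simp only [mul_add, Finset.sum_add_distrib, hX]
          congr 1
          · rw [Finset.sum_comm]
            simp only [Finset.mul_sum]
          · rw [Finset.mul_sum]
            refine Finset.sum_congr rfl fun k _ => ?_
            ring
      _ ≤ _ := by gcongr
  -- There are `m ^ n` cells, and `2 * v ≤ m` makes the loss at most half of `m ^ n`, so the average
  -- of `X` is at least 1/2.
  have : ∃ q, 2⁻¹ ≤ X q := by
    by_contra! hlt
    have hne : (Finset.univ : Finset (Fin n → Fin m)).Nonempty := ⟨fun _ => ⟨0, hm⟩, Finset.mem_univ _⟩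
    have h1 : ∑ q, X q < ∑ _q : Fin n → Fin m, (2⁻¹ : ℝ≥0∞) :=
      ENNReal.sum_lt_sum_of_nonempty hne fun q _ => hlt q
    rw [Finset.sum_const, Finset.card_univ, Fintype.card_fun, Fintype.card_fin, Fintype.card_fin,
      nsmul_eq_mul, Nat.cast_pow] at h1
    have h2 : (m : ℝ≥0∞) ^ (n - 1) * v ≤ (m : ℝ≥0∞) ^ n * 2⁻¹ := by
      obtain ⟨k, rfl⟩ : ∃ k, n = k + 1 := ⟨n - 1, by omega⟩
      rw [Nat.add_sub_cancel, pow_succ, mul_assoc]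
      gcongr
      rw [← div_eq_mul_inv, ENNReal.le_div_iff_mul_le (by simp) (by simp), mul_comm]
      exact hv
    have h3 : ∑ q, X q + (m : ℝ≥0∞) ^ (n - 1) * v <
        (m : ℝ≥0∞) ^ n * 2⁻¹ + (m : ℝ≥0∞) ^ n * 2⁻¹ := by
      refine ENNReal.add_lt_add_of_lt_of_le ?_ h1 h2
      exact (h2.trans_lt (by finiteness)).ne
    rw [← mul_add, ENNReal.inv_two_add_inv_two, mul_one] at h3
    exact absurd hsum (not_le.2 h3)
  obtain ⟨q, hq⟩ := this
  exact ⟨q, fun A hA => (mul_le_mul_left hq _).trans (hlow q A hA)⟩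

end Jablonski

/-! ### Compositions of random maps with product branches. -/

namespace Jablonski

variable {n : ℕ} {Ω : Type*} [MeasurableSpace Ω]

/-- The fibre maps `f_{σ^{k-1} ω} ∘ ⋯ ∘ f_ω` of the iterates of a skew product. -/
def fiberIter {X : Type*} (σ : Ω → Ω) (f : Ω → X → X) : ℕ → Ω → X → X
  | 0 => fun _ => id
  | k + 1 => fun ω => fiberIter σ f k (σ ω) ∘ f ω

/-- A measurable family of maps of `ℝ^n` with product branches, with `C^{1,1}` bounds depending
measurably on the parameter. -/
structure BranchFamily (P : Measure Ω) (f : Ω → (Fin n → ℝ) → Fin n → ℝ) where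
  S : Type
  [fintypeS : Fintype S]
  C : Ω → S → Fin n → Set ℝ
  ψ : Ω → S → Fin n → ℝ → ℝ
  ψ' : Ω → S → Fin n → ℝ → ℝ
  c : Ω → ℝ≥0
  L : Ω → ℝ≥0
  Γ : Ω → ℝ≥0
  branches : ∀ᵐ ω ∂P, ProductBranches (f ω) (C ω) (ψ ω) (ψ' ω) (c ω)
  lip_inv_deriv : ∀ᵐ ω ∂P, ∀ s i, ∀ x ∈ C ω s i, ∀ y ∈ C ω s i,
    |(|ψ' ω s i y|⁻¹ - |ψ' ω s i x|⁻¹)| ≤ L ω * |y - x|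
  lip : ∀ᵐ ω ∂P, ∀ s i, ∀ x ∈ C ω s i, ∀ y ∈ C ω s i, |ψ ω s i y - ψ ω s i x| ≤ Γ ω * |y - x|
  measurable_C : ∀ s i, MeasurableSet {p : Ω × ℝ | p.2 ∈ C p.1 s i}
  measurable_ψ : ∀ s i, Measurable fun p : Ω × ℝ => ψ p.1 s i p.2
  aemeasurable_c : AEMeasurable c P
  aemeasurable_L : AEMeasurable L P
  aemeasurable_Γ : AEMeasurable Γ P

attribute [instance] BranchFamily.fintypeS

/-- The domains `C ∩ ψ ⁻¹' C₂` are again intervals because `ψ` is monotone on `C`; the expansion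
constants multiply by the chain rule. -/
lemma ProductBranches.comp {S T : Type} {f g : (Fin n → ℝ) → Fin n → ℝ}
    {C : S → Fin n → Set ℝ} {ψ ψ' : S → Fin n → ℝ → ℝ} {c : ℝ≥0}
    {C₂ : T → Fin n → Set ℝ} {ψ₂ ψ₂' : T → Fin n → ℝ → ℝ} {c₂ : ℝ≥0}
    (hf : ProductBranches f C ψ ψ' c) (hg : ProductBranches g C₂ ψ₂ ψ₂' c₂) :
    ProductBranches (S := S × T) (g ∘ f) (fun p i => C p.1 i ∩ ψ p.1 i ⁻¹' C₂ p.2 i)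
      (fun p i => ψ₂ p.2 i ∘ ψ p.1 i) (fun p i x => ψ₂' p.2 i (ψ p.1 i x) * ψ' p.1 i x)
      (c₂ * c) where
  measurable_map := hg.measurable_map.comp hf.measurable_map
  ordConnected p i := by
    refine ⟨fun x hx y hy t ht => ?_⟩
    have hs := (hf.ordConnected p.1 i).out hx.1 hy.1
    refine ⟨hs ht, ?_⟩
    have hxy : x ≤ y := ht.1.trans ht.2
    have hu : t ∈ Set.uIcc x y := by rwa [Set.uIcc_of_le hxy]
    have h : ψ p.1 i t ∈ Set.uIcc (ψ p.1 i x) (ψ p.1 i y) := by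
      have hsu : Set.uIcc x y ⊆ C p.1 i := by rwa [Set.uIcc_of_le hxy]
      rcases hf.mono p.1 i with h | h
      · exact (h.mono hsu).mapsTo_uIcc hu
      · exact (h.mono hsu).mapsTo_uIcc hu
    exact (hg.ordConnected p.2 i).uIcc_subset hx.2 hy.2 h
  subset p i := Set.inter_subset_left.trans (hf.subset p.1 i)
  mapsTo p i x hx := hg.mapsTo p.2 i hx.2
  measurable p i := (hg.measurable p.2 i).comp (hf.measurable p.1 i)
  mono p i := by
    have hm : Set.MapsTo (ψ p.1 i) (C p.1 i ∩ ψ p.1 i ⁻¹' C₂ p.2 i) (C₂ p.2 i) := fun x hx => hx.2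
    rcases hf.mono p.1 i with h | h <;> rcases hg.mono p.2 i with h' | h'
    · exact Or.inl (h'.comp (h.mono Set.inter_subset_left) hm)
    · exact Or.inr (h'.comp_MonotoneOn (h.mono Set.inter_subset_left) hm)
    · exact Or.inr (h'.comp_AntitoneOn (h.mono Set.inter_subset_left) hm)
    · exact Or.inl (h'.comp (h.mono Set.inter_subset_left) hm)
  injOn p i := (hg.injOn p.2 i).comp ((hf.injOn p.1 i).mono Set.inter_subset_left) fun x hx => hx.2
  deriv p i x hx := (hg.deriv p.2 i _ hx.2).comp x
    ((hf.deriv p.1 i x hx.1).mono Set.inter_subset_left) fun y hy => hy.2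
  expand p i x hx := by
    have h1 := hf.expand p.1 i x hx.1
    have h2 := hg.expand p.2 i _ hx.2
    rw [abs_mul, NNReal.coe_mul]
    calc (1 : ℝ) = 1 * 1 := by ring
      _ ≤ (c₂ * |ψ₂' p.2 i (ψ p.1 i x)|) * (c * |ψ' p.1 i x|) := by gcongr
      _ = _ := by ring
  cover x hx := by
    obtain ⟨s, hs⟩ := hf.cover x hx
    obtain ⟨t, ht⟩ := hg.cover (fun i => ψ s i (x i)) fun i => hf.mapsTo s i (hs i)
    exact ⟨(s, t), fun i => ⟨hs i, ht i⟩⟩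
  disj p p' x hx hx' := by
    have h1 : p.1 = p'.1 := hf.disj _ _ x (fun i => (hx i).1) fun i => (hx' i).1
    refine Prod.ext h1 (hg.disj _ _ (fun i => ψ p.1 i (x i)) (fun i => (hx i).2) fun i => ?_)
    rw [h1]
    exact (hx' i).2
  apply_eq p x hx := by
    rw [Function.comp_apply, hf.apply_eq p.1 x fun i => (hx i).1,
      hg.apply_eq p.2 _ fun i => (hx i).2]
    rfl

namespace BranchFamily

variable {P : Measure Ω} {f g : Ω → (Fin n → ℝ) → Fin n → ℝ} {σ : Ω → Ω}

/-- The composition of two families over a measure preserving base transformation. -/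
def comp (hσ : MeasurePreserving σ P P) (F : BranchFamily P f) (G : BranchFamily P g) :
    BranchFamily P (fun ω => g (σ ω) ∘ f ω) where
  S := F.S × G.S
  C ω p i := F.C ω p.1 i ∩ F.ψ ω p.1 i ⁻¹' G.C (σ ω) p.2 i
  ψ ω p i := G.ψ (σ ω) p.2 i ∘ F.ψ ω p.1 i
  ψ' ω p i x := G.ψ' (σ ω) p.2 i (F.ψ ω p.1 i x) * F.ψ' ω p.1 i x
  c ω := G.c (σ ω) * F.c ω
  -- The product rule for reciprocal derivatives: the outer one has Lipschitz constant `G.L * F.Γ`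
  -- along the inner branch and is weighted by `F.c`; the inner one has constant `F.L` and is
  -- weighted by `G.c`.
  L ω := F.c ω * (G.L (σ ω) * F.Γ ω) + G.c (σ ω) * F.L ω
  Γ ω := G.Γ (σ ω) * F.Γ ω
  branches := by
    filter_upwards [F.branches, hσ.quasiMeasurePreserving.ae G.branches] with ω h1 h2
    exact h1.comp h2
  lip_inv_deriv := by
    filter_upwards [F.branches, hσ.quasiMeasurePreserving.ae G.branches, F.lip_inv_deriv, F.lip,
      hσ.quasiMeasurePreserving.ae G.lip_inv_deriv] with ω hF hG h1 h2 h3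
    rintro ⟨s, t⟩ i x hx y hy
    have a1 := h1 s i x hx.1 y hy.1
    have a2 := h2 s i x hx.1 y hy.1
    have a3 := h3 t i _ hx.2 _ hy.2
    have e1 : |F.ψ' ω s i y|⁻¹ ≤ F.c ω :=
      BVDensity.inv_abs_le_of_one_le_mul (hF.expand s i y hy.1)
    have e2 : |G.ψ' (σ ω) t i (F.ψ ω s i x)|⁻¹ ≤ G.c (σ ω) :=
      BVDensity.inv_abs_le_of_one_le_mul (hG.expand t i _ hx.2)
    dsimp only
    rw [abs_mul, abs_mul, mul_inv, mul_inv]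
    set p := |F.ψ' ω s i y|⁻¹
    set q := |F.ψ' ω s i x|⁻¹
    set u := |G.ψ' (σ ω) t i (F.ψ ω s i y)|⁻¹
    set w := |G.ψ' (σ ω) t i (F.ψ ω s i x)|⁻¹
    have hp : 0 ≤ p := inv_nonneg.2 (abs_nonneg _)
    have hw : 0 ≤ w := inv_nonneg.2 (abs_nonneg _)
    have e : u * p - w * q = p * (u - w) + w * (p - q) := by ring
    rw [e]
    refine (abs_add_le _ _).trans ?_
    rw [abs_mul, abs_mul, abs_of_nonneg hp, abs_of_nonneg hw]
    push_cast
    calc p * |u - w| + w * |p - q|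
        ≤ F.c ω * (G.L (σ ω) * (F.Γ ω * |y - x|)) + G.c (σ ω) * (F.L ω * |y - x|) := by
          gcongr
          exact a3.trans (by gcongr)
      _ = _ := by ring
  lip := by
    filter_upwards [F.lip, hσ.quasiMeasurePreserving.ae G.lip] with ω h2 h3
    rintro ⟨s, t⟩ i x hx y hy
    have a2 := h2 s i x hx.1 y hy.1
    have a3 := h3 t i _ hx.2 _ hy.2
    refine a3.trans ?_
    push_cast
    rw [mul_assoc]
    gcongr
  measurable_C p i := by
    have h : Measurable fun q : Ω × ℝ => (σ q.1, F.ψ q.1 p.1 i q.2) :=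
      (hσ.measurable.comp measurable_fst).prodMk (F.measurable_ψ p.1 i)
    exact (F.measurable_C p.1 i).inter (h (G.measurable_C p.2 i))
  measurable_ψ p i := by
    have h : Measurable fun q : Ω × ℝ => (σ q.1, F.ψ q.1 p.1 i q.2) :=
      (hσ.measurable.comp measurable_fst).prodMk (F.measurable_ψ p.1 i)
    exact (G.measurable_ψ p.2 i).comp h
  aemeasurable_c :=
    (G.aemeasurable_c.comp_quasiMeasurePreserving hσ.quasiMeasurePreserving).mul F.aemeasurable_c
  aemeasurable_L :=
    (F.aemeasurable_c.mul ((G.aemeasurable_L.comp_quasiMeasurePreserving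
      hσ.quasiMeasurePreserving).mul F.aemeasurable_Γ)).add
    ((G.aemeasurable_c.comp_quasiMeasurePreserving hσ.quasiMeasurePreserving).mul F.aemeasurable_L)
  aemeasurable_Γ :=
    (G.aemeasurable_Γ.comp_quasiMeasurePreserving hσ.quasiMeasurePreserving).mul F.aemeasurable_Γ

/-- The family with one branch, consisting of the identity. -/
def idFamily (P : Measure Ω) : BranchFamily P (fun _ => (id : (Fin n → ℝ) → Fin n → ℝ)) where
  S := Unit
  C _ _ _ := Set.Icc 0 1
  ψ _ _ _ := id
  ψ' _ _ _ _ := 1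
  c _ := 1
  L _ := 0
  Γ _ := 1
  branches := Eventually.of_forall fun _ =>
    { measurable_map := measurable_id
      ordConnected := fun _ _ => Set.ordConnected_Icc
      subset := fun _ _ => subset_rfl
      mapsTo := fun _ _ x hx => hx
      measurable := fun _ _ => measurable_id
      mono := fun _ _ => Or.inl monotoneOn_id
      injOn := fun _ _ => Function.injective_id.injOn
      deriv := fun _ _ x _ => hasDerivWithinAt_id x _
      expand := fun _ _ x _ => by simp
      cover := fun x hx => ⟨(), hx⟩
      disj := fun _ _ _ _ _ => rfl
      apply_eq := fun _ _ _ => rfl }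
  lip_inv_deriv := by simp
  lip := by simp
  measurable_C _ _ := measurable_snd measurableSet_Icc
  measurable_ψ _ _ := measurable_snd
  aemeasurable_c := aemeasurable_const
  aemeasurable_L := aemeasurable_const
  aemeasurable_Γ := aemeasurable_const

/-- The exact product formula for `c` makes the logarithm of the constant of an iterate a Birkhoff
sum. -/
lemma exists_fiberIter (hσ : MeasurePreserving σ P P) (F : BranchFamily P f) (N : ℕ) :
    ∃ G : BranchFamily P (fiberIter σ f N),
      ∀ ω, G.c ω = ∏ j ∈ Finset.range N, F.c (σ^[j] ω) := by
  induction N with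
  | zero => exact ⟨idFamily P, fun ω => by simp [idFamily]⟩
  | succ N ih =>
    obtain ⟨G, hG⟩ := ih
    refine ⟨comp hσ F G, fun ω => ?_⟩
    rw [Finset.prod_range_succ']
    simp only [comp, hG, Function.iterate_zero, id_eq, Function.iterate_succ_apply]

/-- The additive constant `κ` is finite and measurable, but nothing is known about its
integrability, since domains of composed branches may be arbitrarily short. Measurability is enough
for the later truncation. -/
theorem exists_hasVariation_map_le (F : BranchFamily P f) :
    ∃ κ : Ω → ℝ≥0, AEMeasurable κ P ∧ ∀ᵐ ω ∂P, ∀ (ν : Measure (Fin n → ℝ)) (v : ℝ≥0∞),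
      HasVariation ν v → HasVariation (ν.map (f ω)) (3 * F.c ω * v + κ ω * ν Set.univ) := by
  have hvol : ∀ s i, Measurable fun ω => volume (F.C ω s i) := fun s i =>
    measurable_measure_prodMk_left (ν := (volume : Measure ℝ)) (F.measurable_C s i)
  -- `X` dominates the reciprocal of every nonzero length, so `1 / (X + 1)` is a positive lower
  -- bound for these lengths; the added 1 covers `X = 0`.
  set X : Ω → ℝ≥0∞ := fun ω => ∑ s, ∑ i, if volume (F.C ω s i) = 0 then 0 else
    (volume (F.C ω s i))⁻¹ with hX
  have hXm : Measurable X := by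
    refine Finset.measurable_sum _ fun s _ => Finset.measurable_sum _ fun i _ => ?_
    exact Measurable.ite ((hvol s i) (measurableSet_singleton 0)) measurable_const (hvol s i).inv
  have hXfin : ∀ ω, X ω ≠ ∞ := by
    intro ω
    simp only [hX]
    refine ENNReal.sum_ne_top.2 fun s _ => ENNReal.sum_ne_top.2 fun i _ => ?_
    split_ifs with h
    · simp
    · exact ENNReal.inv_ne_top.2 h
  refine ⟨fun ω => n * (F.L ω + 2 * F.c ω * ((X ω).toNNReal + 1)), ?_, ?_⟩
  · exact (F.aemeasurable_L.add ((F.aemeasurable_c.const_mul 2).mul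
      (hXm.ennreal_toNNReal.add_const 1).aemeasurable)).const_mul (n : ℝ≥0)
  filter_upwards [F.branches, F.lip_inv_deriv] with ω hb hl ν v hν
  have hpos : 0 < ((X ω).toNNReal + 1)⁻¹ := by positivity
  refine (hb.hasVariation_map_of_lipschitz (ℓ := ((X ω).toNNReal + 1)⁻¹) hl hpos ?_ hν).mono ?_
  · intro s i
    by_cases h0 : volume (F.C ω s i) = 0
    · exact Or.inl h0
    · right
      have h1 : (volume (F.C ω s i))⁻¹ ≤ X ω := by
        have := (Finset.single_le_sum (f := fun i => if volume (F.C ω s i) = 0 then 0 else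
          (volume (F.C ω s i))⁻¹) (fun _ _ => zero_le) (Finset.mem_univ i)).trans
          (Finset.single_le_sum (f := fun s => ∑ i, if volume (F.C ω s i) = 0 then 0 else
          (volume (F.C ω s i))⁻¹) (fun _ _ => zero_le) (Finset.mem_univ s))
        simpa only [if_neg h0] using this
      rw [ENNReal.coe_inv (by positivity), ENNReal.inv_le_iff_inv_le]
      refine h1.trans ?_
      rw [ENNReal.coe_add, ENNReal.coe_toNNReal (hXfin ω)]
      exact le_self_add
  · gcongr
    rw [ENNReal.coe_inv (by positivity), ENNReal.div_eq_inv_mul, inv_inv]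
    push_cast
    rw [mul_comm (2 * (F.c ω : ℝ≥0∞))]

end BranchFamily

end Jablonski

/-! ### Contraction of the variation on average, and its backward iteration. -/

namespace Jablonski

variable {n : ℕ} {Ω : Type*} [MeasurableSpace Ω] {P : Measure Ω}
  {f : Ω → (Fin n → ℝ) → Fin n → ℝ} {σ : Ω → Ω}

lemma BranchFamily.ae_measurable (F : BranchFamily P f) : ∀ᵐ ω ∂P, Measurable (f ω) := by
  filter_upwards [F.branches] with ω h using h.measurable_map

lemma ae_measurable_fiberIter (hσ : MeasurePreserving σ P P) (hf : ∀ᵐ ω ∂P, Measurable (f ω))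
    (k : ℕ) : ∀ᵐ ω ∂P, Measurable (fiberIter σ f k ω) := by
  induction k with
  | zero => exact Eventually.of_forall fun ω => measurable_id
  | succ k ih =>
    filter_upwards [hf, hσ.quasiMeasurePreserving.ae ih] with ω h1 h2 using h2.comp h1

lemma hasVariation_map_fiberIter (hσ : MeasurePreserving σ P P) (hf : ∀ᵐ ω ∂P, Measurable (f ω))
    {A : Ω → ℝ≥0} (hA : ∀ᵐ ω ∂P, ∀ (ν : Measure (Fin n → ℝ)) (v : ℝ≥0∞),
      HasVariation ν v → HasVariation (ν.map (f ω)) (A ω * v)) (k : ℕ) :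
    ∀ᵐ ω ∂P, ∀ (ν : Measure (Fin n → ℝ)) (v : ℝ≥0∞), HasVariation ν v →
      HasVariation (ν.map (fiberIter σ f k ω)) ((∏ j ∈ Finset.range k, A (σ^[j] ω) : ℝ≥0) * v) := by
  induction k with
  | zero =>
    refine Eventually.of_forall fun ω ν v hν => ?_
    simpa [fiberIter] using hν
  | succ k ih =>
    filter_upwards [hA, hσ.quasiMeasurePreserving.ae ih, hf,
      hσ.quasiMeasurePreserving.ae (ae_measurable_fiberIter hσ hf k)] with ω h1 h2 h3 h4 ν v hν
    have := h2 _ _ (h1 ν v hν)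
    rw [Measure.map_map h4 h3] at this
    refine this.mono (le_of_eq ?_)
    rw [Finset.prod_range_succ', ENNReal.coe_mul, mul_assoc]
    simp only [Function.iterate_succ_apply, Function.iterate_zero, id_eq]

lemma birkhoffSum_log {X : Type*} (τ : X → X) (a : X → ℝ≥0) (ha : ∀ ω, 0 < a ω) (k : ℕ) (ω : X) :
    Real.log (∏ j ∈ Finset.range k, a (τ^[j] ω) : ℝ≥0) =
      birkhoffSum τ (fun ω => Real.log (a ω)) k ω := by
  push_cast
  rw [Real.log_prod fun j _ => (NNReal.coe_pos.2 (ha _)).ne']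
  rfl

lemma integrable_birkhoffSum (hσ : MeasurePreserving σ P P) {φ : Ω → ℝ} (hφ : Integrable φ P)
    (k : ℕ) : Integrable (birkhoffSum σ φ k) P :=
  integrable_finsetSum _ fun j _ => (hσ.iterate j).integrable_comp_of_integrable hφ

lemma integral_birkhoffSum (hσ : MeasurePreserving σ P P) {φ : Ω → ℝ} (hφ : Integrable φ P)
    (k : ℕ) : ∫ ω, birkhoffSum σ φ k ω ∂P = k * ∫ ω, φ ω ∂P := by
  unfold birkhoffSum
  have hi : ∀ j, Integrable (fun ω => φ (σ^[j] ω)) P := fun j =>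
    (hσ.iterate j).integrable_comp_of_integrable hφ
  rw [integral_finsetSum _ fun j _ => hi j]
  have : ∀ j, ∫ ω, φ (σ^[j] ω) ∂P = ∫ ω, φ ω ∂P := by
    intro j
    have := integral_map (μ := P) (f := φ) (hσ.iterate j).measurable.aemeasurable
      (by rw [(hσ.iterate j).map_eq]; exact hφ.aestronglyMeasurable)
    rw [(hσ.iterate j).map_eq] at this
    exact this.symm
  simp [this]

/-- Long blocks of maps that are expanding on average contract the variation on average. -/
theorem BranchFamily.exists_block [IsProbabilityMeasure P] (hσ : MeasurePreserving σ P P)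
    (F : BranchFamily P f) (hcpos : ∀ ω, 0 < F.c ω)
    (hcint : Integrable (fun ω => Real.log (F.c ω)) P) (hcneg : ∫ ω, Real.log (F.c ω) ∂P < 0)
    {A : Ω → ℝ≥0} (hA1 : ∀ ω, 0 < A ω) (hAint : Integrable (fun ω => Real.log (A ω)) P)
    (hA : ∀ᵐ ω ∂P, ∀ (ν : Measure (Fin n → ℝ)) (v : ℝ≥0∞),
      HasVariation ν v → HasVariation (ν.map (f ω)) (A ω * v)) :
    ∃ (N : ℕ) (B : ℝ≥0) (a : Ω → ℝ≥0), (∀ ω, 0 < a ω) ∧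
      Integrable (fun ω => Real.log (a ω)) P ∧ ∫ ω, Real.log (a ω) ∂P < 0 ∧
      ∀ᵐ ω ∂P, ∀ (ν : Measure (Fin n → ℝ)) (v : ℝ≥0∞), HasVariation ν v →
        HasVariation (ν.map (fiberIter σ f N ω)) (a ω * v + B * ν Set.univ) := by
  -- The factor 3 of the Lasota–Yorke inequality is paid once per block, whereas the expansion
  -- accumulates over all `N` steps.
  obtain ⟨N, hN⟩ : ∃ N : ℕ, Real.log 3 + N * ∫ ω, Real.log (F.c ω) ∂P < 0 := by
    obtain ⟨N, hN⟩ := exists_nat_gt (Real.log 3 / -(∫ ω, Real.log (F.c ω) ∂P))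
    refine ⟨N, ?_⟩
    rw [div_lt_iff₀ (by linarith)] at hN
    linarith
  obtain ⟨G, hG⟩ := F.exists_fiberIter hσ N
  obtain ⟨κ, hκm, hκ⟩ := G.exists_hasVariation_map_le
  set AN : Ω → ℝ≥0 := fun ω => ∏ j ∈ Finset.range N, A (σ^[j] ω) with hAN
  have hANpos : ∀ ω, 0 < AN ω := fun ω => Finset.prod_pos fun j _ => hA1 _
  have hGpos : ∀ ω, 0 < 3 * G.c ω := fun ω => by
    rw [hG]
    have : 0 < ∏ j ∈ Finset.range N, F.c (σ^[j] ω) := Finset.prod_pos fun j _ => hcpos _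
    positivity
  have hlogAN : ∀ ω, Real.log (AN ω) = birkhoffSum σ (fun ω => Real.log (A ω)) N ω :=
    birkhoffSum_log σ A hA1 N
  have hlogG : ∀ ω, Real.log ((3 * G.c ω : ℝ≥0) : ℝ) =
      Real.log 3 + birkhoffSum σ (fun ω => Real.log (F.c ω)) N ω := by
    intro ω
    have h0 : (G.c ω : ℝ) ≠ 0 := by
      have := hGpos ω
      intro h
      rw [NNReal.coe_eq_zero] at h
      simp [h] at this
    push_cast
    rw [Real.log_mul (by norm_num) h0, ← birkhoffSum_log σ F.c hcpos, hG]
  have hiA : Integrable (fun ω => Real.log (AN ω)) P := by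
    simp only [hlogAN]; exact integrable_birkhoffSum hσ hAint N
  have hiG : Integrable (fun ω => Real.log ((3 * G.c ω : ℝ≥0) : ℝ)) P := by
    simp only [hlogG]; exact (integrable_const _).add (integrable_birkhoffSum hσ hcint N)
  have hnegG : ∫ ω, Real.log ((3 * G.c ω : ℝ≥0) : ℝ) ∂P < 0 := by
    simp only [hlogG]
    rw [integral_add (integrable_const _) (integrable_birkhoffSum hσ hcint N),
      integral_birkhoffSum hσ hcint]
    simpa using hN
  -- Truncation: the Lasota–Yorke inequality where its additive constant is at most `B`, and
  -- elsewhere the crude bound, which has none. As `B` grows, the mean of `log a` tends to the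
  -- negative mean of `log (3 * c)`, dominated by the two integrable logarithms.
  set a : ℕ → Ω → ℝ≥0 := fun B ω => if κ ω ≤ B then 3 * G.c ω else AN ω with ha
  have hlog : ∀ B ω, Real.log (a B ω) =
      if κ ω ≤ B then Real.log ((3 * G.c ω : ℝ≥0) : ℝ) else Real.log (AN ω) := by
    intro B ω
    simp only [ha]
    split_ifs <;> rfl
  have hmeas : ∀ B : ℕ, AEStronglyMeasurable (fun ω => Real.log (a B ω)) P := by
    intro B
    have hs : NullMeasurableSet {ω | κ ω ≤ (B : ℝ≥0)} P :=
      nullMeasurableSet_le hκm aemeasurable_const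
    have := (hiG.aestronglyMeasurable.indicator₀ hs).add
      (hiA.aestronglyMeasurable.indicator₀ hs.compl)
    refine this.congr (Eventually.of_forall fun ω => ?_)
    dsimp only
    rw [hlog]
    by_cases h : κ ω ≤ B <;> simp [Set.indicator, h]
  have hbound : ∀ B ω, ‖Real.log (a B ω)‖ ≤
      ‖Real.log ((3 * G.c ω : ℝ≥0) : ℝ)‖ + ‖Real.log (AN ω)‖ := by
    intro B ω
    rw [hlog]
    split_ifs
    · exact le_add_of_nonneg_right (norm_nonneg _)
    · exact le_add_of_nonneg_left (norm_nonneg _)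
  have hlim : Tendsto (fun B => ∫ ω, Real.log (a B ω) ∂P) atTop
      (𝓝 (∫ ω, Real.log ((3 * G.c ω : ℝ≥0) : ℝ) ∂P)) := by
    refine tendsto_integral_of_dominated_convergence _ hmeas (hiG.norm.add hiA.norm)
      (fun B => Eventually.of_forall fun ω => hbound B ω) (Eventually.of_forall fun ω => ?_)
    refine tendsto_const_nhds.congr' ?_
    obtain ⟨B₀, hB₀⟩ := exists_nat_ge (κ ω)
    filter_upwards [eventually_ge_atTop B₀] with B hB
    have : κ ω ≤ B := hB₀.trans (by exact_mod_cast hB)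
    rw [hlog, if_pos this]
  obtain ⟨B, hB⟩ := (hlim.eventually (gt_mem_nhds hnegG)).exists
  refine ⟨N, B, a B, fun ω => ?_, ?_, hB, ?_⟩
  · simp only [ha]
    split_ifs
    · exact hGpos ω
    · exact hANpos ω
  · exact (hiG.norm.add hiA.norm).mono' (hmeas B) (Eventually.of_forall (hbound B))
  · filter_upwards [hκ, hasVariation_map_fiberIter hσ F.ae_measurable hA N] with ω h1 h2 ν v hν
    simp only [ha]
    split_ifs with h
    · refine (h1 ν v hν).mono ?_
      push_cast
      gcongr
      exact_mod_cast h
    · exact (h2 ν v hν).mono le_self_add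

/-- Iteration of an affine bound on the variation along a backward orbit. -/
lemma hasVariation_map_fiberIter_backward {τ : Ω → Ω} (hσ : MeasurePreserving σ P P)
    (hτ : MeasurePreserving τ P P) (hστ : ∀ ω, σ (τ ω) = ω)
    (hf : ∀ᵐ ω ∂P, Measurable (f ω)) {a : Ω → ℝ≥0} {B : ℝ≥0}
    (ha : ∀ᵐ ω ∂P, ∀ (ν : Measure (Fin n → ℝ)) (v : ℝ≥0∞),
      HasVariation ν v → HasVariation (ν.map (f ω)) (a ω * v + B * ν Set.univ)) (k : ℕ) :
    ∀ᵐ ω ∂P, ∀ (ν : Measure (Fin n → ℝ)) (v : ℝ≥0∞), HasVariation ν v →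
      HasVariation (ν.map (fiberIter σ f k (τ^[k] ω)))
        ((∏ j ∈ Finset.range k, a (τ (τ^[j] ω)) : ℝ≥0) * v +
          B * (∑ l ∈ Finset.range k, (∏ j ∈ Finset.range l, a (τ (τ^[j] ω)) : ℝ≥0) : ℝ≥0) *
            ν Set.univ) := by
  induction k with
  | zero =>
    refine Eventually.of_forall fun ω ν v hν => ?_
    simpa [fiberIter] using hν
  | succ k ih =>
    have hm := ae_measurable_fiberIter hσ hf k
    filter_upwards [ih, (hτ.iterate (k + 1)).quasiMeasurePreserving.ae ha,
      (hτ.iterate (k + 1)).quasiMeasurePreserving.ae hf,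
      (hτ.iterate k).quasiMeasurePreserving.ae hm] with ω h1 h2 h3 h4 ν v hν
    -- The induction prepends the earliest map: it acts first, and the induction hypothesis takes
    -- over at `τ^[k] ω`. Thus the product gains its last factor and the sum its last term.
    have e : σ (τ^[k + 1] ω) = τ^[k] ω := by rw [Function.iterate_succ_apply', hστ]
    have h := h1 _ _ (h2 ν v hν)
    rw [Measure.map_map h4 h3] at h
    have e2 : fiberIter σ f (k + 1) (τ^[k + 1] ω) = fiberIter σ f k (τ^[k] ω) ∘ f (τ^[k + 1] ω) := by
      simp only [fiberIter, e]
    rw [e2]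
    refine h.mono (le_of_eq ?_)
    rw [Measure.map_apply h3 MeasurableSet.univ, Set.preimage_univ, Finset.prod_range_succ,
      Finset.sum_range_succ, Function.iterate_succ_apply']
    push_cast
    ring

end Jablonski

namespace Jablonski

variable {n : ℕ}

/-! ### Averages over grids converge -/

/-- The density of the average of a measure over the cells of a grid. -/
noncomputable def gridAverageDensity (m : ℕ) (ν : Measure (Fin n → ℝ)) (x : Fin n → ℝ) : ℝ≥0∞ :=
  ∑ q : Fin n → Fin m, (gridCell m q).indicator (fun _ => (m : ℝ≥0∞) ^ n * ν (gridCell m q)) x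

lemma measurable_gridAverageDensity (m : ℕ) (ν : Measure (Fin n → ℝ)) :
    Measurable (gridAverageDensity m ν) :=
  Finset.measurable_sum _ fun q _ => measurable_const.indicator (measurableSet_gridCell m q)

lemma setLIntegral_gridAverageDensity (m : ℕ) (ν : Measure (Fin n → ℝ))
    (A : Set (Fin n → ℝ)) : ∫⁻ x in A, gridAverageDensity m ν x = gridAverage m ν A := by
  unfold gridAverageDensity
  rw [lintegral_finsetSum _ fun q _ => measurable_const.indicator (measurableSet_gridCell m q),
    gridAverage_apply]
  refine Finset.sum_congr rfl fun q _ => ?_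
  rw [lintegral_indicator (measurableSet_gridCell m q), setLIntegral_const,
    Measure.restrict_apply (measurableSet_gridCell m q), Set.inter_comm]

/-- In the supremum norm a cell is, up to a null set, the closed ball of radius `1 / (2 * m)` about
its midpoint. The averages are therefore over balls that contain `x` without being centred at it,
for which Lebesgue differentiation holds. -/
lemma gridAverageDensity_eq {m : ℕ} (hm : 0 < m) (ν : Measure (Fin n → ℝ)) (hν : ν ≪ volume)
    {x : Fin n → ℝ} (hx : x ∈ Set.univ.pi fun _ => Set.Ico (0 : ℝ) 1) :
    x ∈ Metric.closedBall (fun i => ((⌊x i * m⌋₊ : ℝ) + 2⁻¹) / m) ((2 * m : ℝ)⁻¹) ∧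
    gridAverageDensity m ν x =
      ν (Metric.closedBall (fun i => ((⌊x i * m⌋₊ : ℝ) + 2⁻¹) / m) ((2 * m : ℝ)⁻¹)) /
        volume (Metric.closedBall (fun i => ((⌊x i * m⌋₊ : ℝ) + 2⁻¹) / m) ((2 * m : ℝ)⁻¹)) := by
  have hm' : (0 : ℝ) < m := by exact_mod_cast hm
  have hx' := hx
  rw [← iUnion_gridCell hm, Set.mem_iUnion] at hx'
  obtain ⟨q, hq⟩ := hx'
  have hfl : ∀ i, ⌊x i * m⌋₊ = q i := fun i =>
    (mem_gridIco_iff hm (hx i trivial).1).1 (hq i trivial)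
  have hball : Metric.closedBall (fun i => ((⌊x i * m⌋₊ : ℝ) + 2⁻¹) / m) ((2 * m : ℝ)⁻¹) =
      Set.univ.pi fun i => Set.Icc ((q i : ℝ) / m) ((q i + 1 : ℝ) / m) := by
    rw [closedBall_pi _ (by positivity)]
    congr 1
    ext1 i
    rw [Real.closedBall_eq_Icc, hfl]
    congr 1 <;> (field_simp; ring)
  have hae : gridCell m q =ᵐ[volume]
      Metric.closedBall (fun i => ((⌊x i * m⌋₊ : ℝ) + 2⁻¹) / m) ((2 * m : ℝ)⁻¹) := by
    rw [hball, Set.pi_univ_Icc, volume_pi]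
    exact Measure.univ_pi_Ico_ae_eq_Icc
  constructor
  · rw [hball]
    exact fun i _ => Set.Ico_subset_Icc_self (hq i trivial)
  · rw [← measure_congr (hν.ae_le hae), ← measure_congr hae, volume_gridCell hm,
      ENNReal.div_eq_inv_mul, inv_inv, gridAverageDensity, Finset.sum_eq_single q]
    · rw [Set.indicator_of_mem hq]
    · intro q' _ hne
      refine Set.indicator_of_notMem (fun h => ?_) _
      exact Set.disjoint_left.1 (pairwise_disjoint_gridCell hm hne) h hq
    · simp

lemma ae_tendsto_gridAverageDensity {h : (Fin n → ℝ) → ℝ≥0∞} (hh : Measurable h)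
    [IsFiniteMeasure (volume.withDensity h)] :
    ∀ᵐ x, x ∈ Set.univ.pi (fun _ => Set.Ico (0 : ℝ) 1) →
      Tendsto (fun m => gridAverageDensity m (volume.withDensity h) x) atTop (𝓝 (h x)) := by
  set ν := (volume : Measure (Fin n → ℝ)).withDensity h with hν
  have hac : ν ≪ volume := withDensity_absolutelyContinuous _ _
  filter_upwards [(IsUnifLocDoublingMeasure.vitaliFamily (volume : Measure (Fin n → ℝ))
    1).ae_tendsto_rnDeriv ν, Measure.rnDeriv_withDensity volume hh] with x hx1 hx2 hxU
  rw [hx2] at hx1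
  have hδ : Tendsto (fun m : ℕ => (2 * m : ℝ)⁻¹) atTop (𝓝[>] 0) := by
    refine tendsto_nhdsWithin_iff.2 ⟨?_, ?_⟩
    · exact tendsto_inv_atTop_zero.comp
        (tendsto_natCast_atTop_atTop.const_mul_atTop (by norm_num))
    · filter_upwards [eventually_gt_atTop 0] with m hm
      have : (0 : ℝ) < m := by exact_mod_cast hm
      exact Set.mem_Ioi.2 (by positivity)
  have := hx1.comp (IsUnifLocDoublingMeasure.tendsto_closedBall_filterAt volume (x := x) (K := 1)
    (fun (m : ℕ) i => ((⌊x i * m⌋₊ : ℝ) + 2⁻¹) / m) (fun m : ℕ => (2 * m : ℝ)⁻¹) hδ ?_)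
  · refine this.congr' ?_
    filter_upwards [eventually_gt_atTop 0] with m hm
    exact (gridAverageDensity_eq hm ν hac hxU).2.symm
  · filter_upwards [eventually_gt_atTop 0] with m hm
    rw [one_mul]
    exact (gridAverageDensity_eq hm ν hac hxU).1

/-- The densities of the averages converge almost everywhere to `h`, so by Fatou's lemma the support
carries mass at least 1 in the limit. The total mass is 1, and nothing is left for the complement.
-/
theorem tendsto_gridAverage_compl_support {h : (Fin n → ℝ) → ℝ≥0∞} (hh : Measurable h)
    (hmass : volume.withDensity h Set.univ = 1)
    (hsupp : volume.withDensity h (Set.univ.pi fun _ => Set.Ico (0 : ℝ) 1)ᶜ = 0) :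
    Tendsto (fun m => gridAverage m (volume.withDensity h) {x | h x ≠ 0}ᶜ) atTop (𝓝 0) := by
  set ν := (volume : Measure (Fin n → ℝ)).withDensity h with hν
  set S := {x | h x ≠ 0} with hS
  set U : Set (Fin n → ℝ) := Set.univ.pi fun _ => Set.Ico (0 : ℝ) 1 with hU
  have hSm : MeasurableSet S := hh (measurableSet_singleton 0).compl
  have hUm : MeasurableSet U := MeasurableSet.univ_pi fun _ => measurableSet_Ico
  have hfin : IsFiniteMeasure ν := ⟨by rw [hmass]; simp⟩
  have havg : ∀ᶠ m in atTop, gridAverage m ν Set.univ = 1 := by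
    filter_upwards [eventually_gt_atTop 0] with m hm
    rw [gridAverage_univ hm ν hsupp, hmass]
  have hone : ν (S ∩ U) = 1 := by
    rw [← hmass]
    refine measure_congr ?_
    have h1 : ν Sᶜ = 0 := by
      rw [hν, withDensity_apply _ hSm.compl]
      rw [setLIntegral_congr_fun (g := fun _ => 0) hSm.compl]
      · simp
      · intro x hx
        simpa [hS] using hx
    refine (eventuallyEq_univ.2 ?_)
    have : (S ∩ U)ᶜ = Sᶜ ∪ Uᶜ := Set.compl_inter _ _
    rw [mem_ae_iff, this]
    exact measure_union_null h1 hsupp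
  have hlow : 1 ≤ liminf (fun m => gridAverage m ν S) atTop := by
    calc 1 = ∫⁻ x in S ∩ U, h x := by rw [← hone, hν, withDensity_apply _ (hSm.inter hUm)]
      _ = ∫⁻ x in S ∩ U, liminf (fun m => gridAverageDensity m ν x) atTop := by
          refine setLIntegral_congr_fun_ae (hSm.inter hUm) ?_
          filter_upwards [ae_tendsto_gridAverageDensity hh] with x hx hxm
          exact (hx hxm.2).liminf_eq.symm
      _ ≤ liminf (fun m => ∫⁻ x in S ∩ U, gridAverageDensity m ν x) atTop :=
          lintegral_liminf_le fun m => measurable_gridAverageDensity m ν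
      _ ≤ liminf (fun m => gridAverage m ν S) atTop := by
          refine liminf_le_liminf (Eventually.of_forall fun m => ?_)
          rw [setLIntegral_gridAverageDensity]
          exact measure_mono Set.inter_subset_left
  have hup : limsup (fun m => gridAverage m ν S) atTop ≤ 1 := by
    refine limsup_le_of_le (h := ?_)
    filter_upwards [havg] with m hm
    exact (measure_mono (Set.subset_univ _)).trans_eq hm
  have hlim : Tendsto (fun m => gridAverage m ν S) atTop (𝓝 1) :=
    tendsto_of_le_liminf_of_limsup_le hlow hup
  have h2 : Tendsto (fun m => 1 - gridAverage m ν S) atTop (𝓝 (1 - 1)) :=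
    ENNReal.Tendsto.sub tendsto_const_nhds hlim (Or.inl ENNReal.one_ne_top)
  rw [tsub_self] at h2
  refine h2.congr' ?_
  filter_upwards [havg] with m hm
  have : IsFiniteMeasure (gridAverage m ν) := ⟨by rw [hm]; simp⟩
  rw [measure_compl hSm (measure_ne_top _ _), hm]

/-! ### Supports of invariant densities contain boxes -/

section Support

variable {Ω : Type*} [MeasurableSpace Ω] {P : Measure Ω}
  {f : Ω → (Fin n → ℝ) → Fin n → ℝ} {σ τ : Ω → Ω}

lemma ae_map_fiberIter_backward (hσ : MeasurePreserving σ P P) (hτ : MeasurePreserving τ P P)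
    (hστ : ∀ ω, σ (τ ω) = ω) (hf : ∀ᵐ ω ∂P, Measurable (f ω))
    {ν : Ω → Measure (Fin n → ℝ)} (hν : ∀ᵐ ω ∂P, (ν ω).map (f ω) = ν (σ ω)) (k : ℕ) :
    ∀ᵐ ω ∂P, (ν (τ^[k] ω)).map (fiberIter σ f k (τ^[k] ω)) = ν ω := by
  induction k with
  | zero => exact Eventually.of_forall fun ω => by simp [fiberIter]
  | succ k ih =>
    have hm := ae_measurable_fiberIter hσ hf k
    filter_upwards [ih, (hτ.iterate (k + 1)).quasiMeasurePreserving.ae hν,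
      (hτ.iterate (k + 1)).quasiMeasurePreserving.ae hf,
      (hτ.iterate k).quasiMeasurePreserving.ae hm] with ω h1 h2 h3 h4
    have e : σ (τ^[k + 1] ω) = τ^[k] ω := by rw [Function.iterate_succ_apply', hστ]
    have e2 : fiberIter σ f (k + 1) (τ^[k + 1] ω) = fiberIter σ f k (τ^[k] ω) ∘ f (τ^[k + 1] ω) := by
      simp only [fiberIter, e]
    rw [e2, ← Measure.map_map h4 h3, h2, e, h1]

lemma measurable_gridAverage_compl {h : Ω × (Fin n → ℝ) → ℝ≥0∞} (hh : Measurable h) (m : ℕ) :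
    Measurable fun ω => gridAverage m (volume.withDensity fun x => h (ω, x))
      {x | h (ω, x) ≠ 0}ᶜ := by
  simp only [gridAverage_apply]
  refine Finset.measurable_sum _ fun q _ => ?_
  refine Measurable.mul (Measurable.const_mul ?_ _) ?_
  · simp only [withDensity_apply _ (measurableSet_gridCell m q)]
    exact hh.lintegral_prod_right'
  · have hs : MeasurableSet ({p : Ω × (Fin n → ℝ) | h p ≠ 0}ᶜ ∩ Prod.snd ⁻¹' gridCell m q) :=
      (hh (measurableSet_singleton 0).compl).compl.inter
        (measurable_snd (measurableSet_gridCell m q))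
    exact measurable_measure_prodMk_left (ν := (volume : Measure (Fin n → ℝ))) hs

variable [IsProbabilityMeasure P]

/-- If the variation is contracted on average then, with positive probability, the support of an
invariant density contains a box. -/
theorem exists_gridCell_subset_support (hn : 1 ≤ n) (hσ : MeasurePreserving σ P P)
    (hτ : MeasurePreserving τ P P) (hστ : ∀ ω, σ (τ ω) = ω) (hf : ∀ᵐ ω ∂P, Measurable (f ω))
    {a : Ω → ℝ≥0} {B : ℝ≥0} (ha0 : ∀ ω, 0 < a ω)
    (haint : Integrable (fun ω => Real.log (a ω)) P) (haneg : ∫ ω, Real.log (a ω) ∂P < 0)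
    (ha : ∀ᵐ ω ∂P, ∀ (ν : Measure (Fin n → ℝ)) (v : ℝ≥0∞),
      HasVariation ν v → HasVariation (ν.map (f ω)) (a ω * v + B * ν Set.univ))
    {h : Ω × (Fin n → ℝ) → ℝ≥0∞} (hh : Measurable h)
    (hmass : ∀ᵐ ω ∂P, volume.withDensity (fun x => h (ω, x)) Set.univ = 1)
    (hsupp : ∀ᵐ ω ∂P, volume.withDensity (fun x => h (ω, x))
      (Set.univ.pi fun _ => Set.Ico (0 : ℝ) 1)ᶜ = 0)
    (hinv : ∀ᵐ ω ∂P, (volume.withDensity fun x => h (ω, x)).map (f ω) =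
      volume.withDensity fun x => h (σ ω, x)) :
    ¬ ∀ᵐ ω ∂P, ¬ ∃ m > 0, ∃ q : Fin n → Fin m,
      volume ({x | h (ω, x) ≠ 0}ᶜ ∩ gridCell m q) = 0 := by
  set ν : Ω → Measure (Fin n → ℝ) := fun ω => volume.withDensity fun x => h (ω, x) with hν
  set S : Ω → Set (Fin n → ℝ) := fun ω => {x | h (ω, x) ≠ 0} with hS
  set e : ℕ → Ω → ℝ≥0∞ := fun m ω => gridAverage m (ν ω) (S ω)ᶜ with he
  have hhm : ∀ ω, Measurable fun x => h (ω, x) := fun ω => hh.comp measurable_prodMk_left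
  have hSm : ∀ ω, MeasurableSet (S ω) := fun ω => hhm ω (measurableSet_singleton 0).compl
  have hem : ∀ m, Measurable (e m) := fun m => measurable_gridAverage_compl hh m
  have hlogint : Integrable (fun ω => Real.log (a (τ ω))) P := hτ.integrable_comp_of_integrable haint
  have hlogneg : ∫ ω, Real.log (a (τ ω)) ∂P < 0 := by
    have := integral_map (μ := P) (f := fun ω => Real.log (a ω)) hτ.measurable.aemeasurable
      (by rw [hτ.map_eq]; exact haint.aestronglyMeasurable)
    rw [hτ.map_eq] at this
    rwa [← this]
  obtain ⟨c, hc, hgood⟩ := exists_birkhoffSum_le_sub_mul hτ hlogint hlogneg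
  intro hcon
  refine hgood ?_
  -- The mass `e m` moved off the support tends to zero in mean. As `τ` preserves `P`, the same is
  -- true when it is evaluated `m` steps in the past, and Fatou's lemma gives the lower limit along
  -- backward orbits.
  have hliminf : ∀ᵐ ω ∂P, liminf (fun m => e m (τ^[m] ω)) atTop = 0 := by
    have h0 : ∫⁻ ω, liminf (fun m => e m (τ^[m] ω)) atTop ∂P = 0 := by
      refine le_antisymm ?_ bot_le
      refine (lintegral_liminf_le fun m => (hem m).comp (hτ.iterate m).measurable).trans ?_
      have h1 : (fun m => ∫⁻ ω, e m (τ^[m] ω) ∂P) = fun m => ∫⁻ ω, e m ω ∂P :=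
        funext fun m => (hτ.iterate m).lintegral_comp (hem m)
      change liminf (fun m => ∫⁻ ω, e m (τ^[m] ω) ∂P) atTop ≤ 0
      rw [h1]
      have h2 : Tendsto (fun m => ∫⁻ ω, e m ω ∂P) atTop (𝓝 (∫⁻ _, 0 ∂P)) := by
        refine tendsto_lintegral_filter_of_dominated_convergence (fun _ => 1)
          (Eventually.of_forall hem) ?_ (by simp) ?_
        · filter_upwards [eventually_gt_atTop 0] with m hm
          filter_upwards [hmass, hsupp] with ω hω1 hω2
          calc e m ω ≤ gridAverage m (ν ω) Set.univ := measure_mono (Set.subset_univ _)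
            _ = 1 := by rw [gridAverage_univ hm _ hω2, hω1]
        · filter_upwards [hmass, hsupp] with ω hω1 hω2
          exact tendsto_gridAverage_compl_support (hhm ω) hω1 hω2
      rw [lintegral_zero] at h2
      exact h2.liminf_eq.le
    exact (lintegral_eq_zero_iff (Measurable.liminf fun m =>
      (hem m).comp (hτ.iterate m).measurable)).1 h0
  have hall : ∀ᵐ ω ∂P, ∀ k, (∀ (ν : Measure (Fin n → ℝ)) (v : ℝ≥0∞), HasVariation ν v →
      HasVariation (ν.map (fiberIter σ f k (τ^[k] ω)))
        ((∏ j ∈ Finset.range k, a (τ (τ^[j] ω)) : ℝ≥0) * v +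
          B * (∑ l ∈ Finset.range k, (∏ j ∈ Finset.range l, a (τ (τ^[j] ω)) : ℝ≥0) : ℝ≥0) *
            ν Set.univ)) ∧
      (ν (τ^[k] ω)).map (fiberIter σ f k (τ^[k] ω)) = ν ω ∧ ν (τ^[k] ω) Set.univ = 1 ∧
      ν (τ^[k] ω) (Set.univ.pi fun _ => Set.Ico (0 : ℝ) 1)ᶜ = 0 ∧
      Measurable (fiberIter σ f k (τ^[k] ω)) := by
    rw [ae_all_iff]
    intro k
    filter_upwards [hasVariation_map_fiberIter_backward hσ hτ hστ hf ha k,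
      ae_map_fiberIter_backward hσ hτ hστ hf hinv k,
      (hτ.iterate k).quasiMeasurePreserving.ae hmass,
      (hτ.iterate k).quasiMeasurePreserving.ae hsupp,
      (hτ.iterate k).quasiMeasurePreserving.ae (ae_measurable_fiberIter hσ hf k)]
      with ω h1 h2 h3 h4 h5 using ⟨h1, h2, h3, h4, h5⟩
  filter_upwards [hcon, hliminf, hall] with ω hno hlim hω
  rintro ⟨Cω, hCω⟩
  set Q : ℕ → ℝ≥0 := fun k => ∏ j ∈ Finset.range k, a (τ (τ^[j] ω)) with hQ
  have hQpos : ∀ k, 0 < Q k := fun k => Finset.prod_pos fun j _ => ha0 _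
  have hQle : ∀ k : ℕ, (Q k : ℝ) ≤ Real.exp Cω * Real.exp (-c) ^ k := by
    intro k
    have h1 : Real.log (Q k) = birkhoffSum τ (fun ω => Real.log (a (τ ω))) k ω := by
      have := birkhoffSum_log τ (fun ω => a (τ ω)) (fun ω => ha0 _) k ω
      exact this
    have h2 := hCω k
    rw [← h1] at h2
    rw [← Real.exp_nat_mul, ← Real.exp_add, ← Real.log_le_iff_le_exp (NNReal.coe_pos.2 (hQpos k))]
    linarith
  have hr1 : Real.exp (-c) < 1 := by rw [Real.exp_lt_one_iff]; linarith
  have hr0 : 0 < Real.exp (-c) := Real.exp_pos _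
  -- uniform bound on the variations
  obtain ⟨V, hV⟩ : ∃ V : ℝ, ∀ k : ℕ, Q k * (2 * n * k) + B * ∑ l ∈ Finset.range k, (Q l : ℝ) ≤ V := by
    have hs1 : Summable fun k : ℕ => Real.exp (-c) ^ k :=
      summable_geometric_of_lt_one hr0.le hr1
    have ht := tendsto_self_mul_const_pow_of_lt_one hr0.le hr1
    obtain ⟨V₁, hV₁⟩ := ht.bddAbove_range
    refine ⟨Real.exp Cω * (2 * n) * V₁ + B * (Real.exp Cω * ∑' k : ℕ, Real.exp (-c) ^ k),
      fun k => add_le_add ?_ ?_⟩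
    · have h1 : (k : ℝ) * Real.exp (-c) ^ k ≤ V₁ := hV₁ ⟨k, rfl⟩
      calc (Q k : ℝ) * (2 * n * k) ≤ (Real.exp Cω * Real.exp (-c) ^ k) * (2 * n * k) := by
            gcongr; exact hQle k
        _ = Real.exp Cω * (2 * n) * (k * Real.exp (-c) ^ k) := by ring
        _ ≤ _ := by gcongr
    · gcongr
      calc ∑ l ∈ Finset.range k, (Q l : ℝ)
          ≤ ∑ l ∈ Finset.range k, Real.exp Cω * Real.exp (-c) ^ l :=
            Finset.sum_le_sum fun l _ => hQle l
        _ = Real.exp Cω * ∑ l ∈ Finset.range k, Real.exp (-c) ^ l := by rw [Finset.mul_sum]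
        _ ≤ _ := by
            gcongr
            exact hs1.sum_le_tsum _ fun l _ => by positivity
  obtain ⟨M, hM⟩ := exists_nat_gt (2 * V)
  have hV0 : 0 ≤ V := le_trans (by simp) (hV 0)
  have hM0 : 0 < M := by
    have : (0 : ℝ) < M := by linarith
    exact_mod_cast this
  -- The scale of the grid is tied to the time: `m` steps back the mesh is `1 / m`, so the initial
  -- variation of order `m` meets the exponentially small factor `Q m`. The mesh `1 / M` at the
  -- present does not depend on `m`.
  have hexq : ∀ m > 0, ∃ q : Fin n → Fin M,
      2⁻¹ * volume ((S ω)ᶜ ∩ gridCell M q) ≤ e m (τ^[m] ω) := by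
    intro m hm
    obtain ⟨h1, h2, h3, h4, h5⟩ := hω m
    have hfin : IsFiniteMeasure (ν (τ^[m] ω)) := ⟨by rw [h3]; simp⟩
    have hv := h1 _ _ (hasVariation_gridAverage hm (ν (τ^[m] ω)))
    have hu : gridAverage m (ν (τ^[m] ω)) Set.univ = 1 := by rw [gridAverage_univ hm _ h4, h3]
    obtain ⟨q, hq⟩ := hv.exists_gridCell (by
      rw [Measure.map_apply h5 MeasurableSet.univ, Set.preimage_univ, hu]) hn hM0 (by
      rw [hu, h3, mul_one, mul_one]
      have := hV m
      have hreal : 2 * (Q m * (2 * n * m) + B * ∑ l ∈ Finset.range m, (Q l : ℝ)) ≤ M := by linarith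
      have hnn : 2 * (Q m * (2 * n * m) + B * ∑ l ∈ Finset.range m, Q l) ≤ (M : ℝ≥0) := by
        rw [← NNReal.coe_le_coe]; push_cast; exact hreal
      have := ENNReal.coe_le_coe.2 hnn
      simpa only [hQ, ENNReal.coe_mul, ENNReal.coe_add, ENNReal.coe_natCast, ENNReal.coe_ofNat]
        using this)
    refine ⟨q, (hq _ (hSm ω).compl).trans ?_⟩
    rw [Measure.map_apply h5 (hSm ω).compl]
    have h6 : ν (τ^[m] ω) (fiberIter σ f m (τ^[m] ω) ⁻¹' (S ω)ᶜ) = 0 := by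
      rw [← Measure.map_apply h5 (hSm ω).compl, h2]
      simp only [hν]
      rw [withDensity_apply _ (hSm ω).compl, setLIntegral_congr_fun (g := fun _ => 0) (hSm ω).compl]
      · simp
      · intro x hx
        simpa [hS] using hx
    -- The invariant density puts no mass on points sent off the present support, so almost none of
    -- these points lie in the past support. Only the part of the average off the past support
    -- contributes.
    have h7 : volume (fiberIter σ f m (τ^[m] ω) ⁻¹' (S ω)ᶜ ∩ S (τ^[m] ω)) = 0 := by
      simp only [hν] at h6
      rw [withDensity_apply_eq_zero (hhm _)] at h6
      rwa [Set.inter_comm] at h6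
    calc gridAverage m (ν (τ^[m] ω)) (fiberIter σ f m (τ^[m] ω) ⁻¹' (S ω)ᶜ)
        ≤ gridAverage m (ν (τ^[m] ω)) ((fiberIter σ f m (τ^[m] ω) ⁻¹' (S ω)ᶜ ∩ S (τ^[m] ω)) ∪
            (S (τ^[m] ω))ᶜ) := by
          refine measure_mono fun x hx => ?_
          by_cases hxS : x ∈ S (τ^[m] ω)
          · exact Or.inl ⟨hx, hxS⟩
          · exact Or.inr hxS
      _ ≤ 0 + e m (τ^[m] ω) := by
          refine (measure_union_le _ _).trans (add_le_add (le_of_eq ?_) le_rfl)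
          exact gridAverage_absolutelyContinuous m _ h7
      _ = _ := zero_add _
  have hqpos : ∀ q : Fin n → Fin M, 0 < volume ((S ω)ᶜ ∩ gridCell M q) := by
    intro q
    rw [pos_iff_ne_zero]
    intro h0
    exact hno ⟨M, hM0, q, h0⟩
  have : Nonempty (Fin n → Fin M) := ⟨fun _ => ⟨0, hM0⟩⟩
  -- The cell found above may vary with `m`, but there are finitely many; if each missed a positive
  -- volume, the smallest such volume would keep the lower limit positive.
  obtain ⟨q₀, hq₀⟩ := Finite.exists_min fun q : Fin n → Fin M => volume ((S ω)ᶜ ∩ gridCell M q)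
  have hle : 2⁻¹ * volume ((S ω)ᶜ ∩ gridCell M q₀) ≤ liminf (fun m => e m (τ^[m] ω)) atTop := by
    refine le_liminf_of_le (h := ?_)
    filter_upwards [eventually_gt_atTop 0] with m hm
    obtain ⟨q, hq⟩ := hexq m hm
    exact le_trans (mul_le_mul' le_rfl (hq₀ q)) hq
  rw [hlim] at hle
  have h8 := hqpos q₀
  have : (0 : ℝ≥0∞) < 2⁻¹ * volume ((S ω)ᶜ ∩ gridCell M q₀) :=
    ENNReal.mul_pos (by simp) h8.ne'
  exact absurd hle (not_le.2 this)

end Support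

/-! ### Derivatives as measurable limits, and the variation of a function of class `C¹` -/

/-- The upper limit of the difference quotients along a fixed sequence of steps. -/
noncomputable def seqDeriv (u : ℝ → ℝ) (t : ℝ) : ℝ :=
  limsup (fun k : ℕ => ((k : ℝ) + 1) * (u (t + ((k : ℝ) + 1)⁻¹) - u t)) atTop

lemma HasDerivAt.tendsto_slope_seq {u : ℝ → ℝ} {d t : ℝ} (h : HasDerivAt u d t) {s : ℕ → ℝ}
    (hs : Tendsto s atTop (𝓝 0)) (hs0 : ∀ k, s k ≠ 0) :
    Tendsto (fun k => (s k)⁻¹ * (u (t + s k) - u t)) atTop (𝓝 d) := by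
  have h1 := (hasDerivAt_iff_tendsto_slope_zero.1 h).comp
    (tendsto_nhdsWithin_of_tendsto_nhds_of_eventually_within s hs (Eventually.of_forall hs0))
  simpa [Function.comp_def, smul_eq_mul] using h1

lemma seqDeriv_eq {u : ℝ → ℝ} {d t : ℝ} (h : HasDerivAt u d t) : seqDeriv u t = d := by
  have h1 := HasDerivAt.tendsto_slope_seq h (s := fun k : ℕ => ((k : ℝ) + 1)⁻¹)
    (by simpa using tendsto_one_div_add_atTop_nhds_zero_nat (𝕜 := ℝ)) (fun k => by positivity)
  simp only [inv_inv] at h1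
  exact h1.limsup_eq

lemma measurable_seqDeriv {Ω : Type*} [MeasurableSpace Ω] {u : Ω × ℝ → ℝ} (hu : Measurable u) :
    Measurable fun p : Ω × ℝ => seqDeriv (fun t => u (p.1, t)) p.2 := by
  refine Measurable.limsup fun k => measurable_const.mul (Measurable.sub ?_ hu)
  exact hu.comp (measurable_fst.prodMk (measurable_snd.add_const _))

/-- The supremum of `|D|` over the rational points of an open interval. -/
noncomputable def ratSup (D : ℝ → ℝ) (a b : ℝ) : ℝ≥0∞ :=
  ⨆ q : ℚ, ⨆ _ : (q : ℝ) ∈ Set.Ioo a b, ‖D q‖ₑ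

lemma measurable_ratSup {Ω : Type*} [MeasurableSpace Ω] {D : Ω × ℝ → ℝ} (hD : Measurable D)
    (a b : ℝ) : Measurable fun ω => ratSup (fun t => D (ω, t)) a b :=
  Measurable.iSup fun _ => Measurable.iSup fun _ =>
    (hD.comp (measurable_id.prodMk measurable_const)).enorm

section C1

variable {u D : ℝ → ℝ} {a b : ℝ}

lemma ContDiffOn.hasDerivAt_Ioo (hu : ContDiffOn ℝ 1 u (Set.Icc a b)) {t : ℝ}
    (ht : t ∈ Set.Ioo a b) : HasDerivAt u (derivWithin u (Set.Icc a b) t) t :=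
  (((hu t (Set.Ioo_subset_Icc_self ht)).differentiableWithinAt one_ne_zero).hasDerivWithinAt).hasDerivAt
    (Icc_mem_nhds ht.1 ht.2)

lemma ratSup_ne_top (hab : a < b) (hu : ContDiffOn ℝ 1 u (Set.Icc a b))
    (hD : ∀ t ∈ Set.Ioo a b, D t = derivWithin u (Set.Icc a b) t) : ratSup D a b ≠ ∞ := by
  have hc := hu.continuousOn_derivWithin (uniqueDiffOn_Icc hab) le_rfl
  obtain ⟨K, hK⟩ := isCompact_Icc.exists_bound_of_continuousOn hc
  refine ne_top_of_le_ne_top (ENNReal.ofReal_ne_top (r := K)) (iSup₂_le fun q hq => ?_)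
  rw [hD q hq, ← ofReal_norm]
  exact ENNReal.ofReal_le_ofReal (hK _ (Set.Ioo_subset_Icc_self hq))

/-- The derivative is continuous up to the end points and the rationals are dense, so a countable
supremum, measurable in the parameter, sees its maximum. -/
lemma abs_derivWithin_le_ratSup (hab : a < b) (hu : ContDiffOn ℝ 1 u (Set.Icc a b))
    (hD : ∀ t ∈ Set.Ioo a b, D t = derivWithin u (Set.Icc a b) t) {t : ℝ}
    (ht : t ∈ Set.Icc a b) : ‖derivWithin u (Set.Icc a b) t‖ ≤ (ratSup D a b).toReal := by
  have hc := hu.continuousOn_derivWithin (uniqueDiffOn_Icc hab) le_rfl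
  have hfin := ratSup_ne_top hab hu hD
  set R := Set.Ioo a b ∩ Set.range ((↑) : ℚ → ℝ)
  have hcl : Set.Icc a b ⊆ closure R := by
    rw [← closure_Ioo hab.ne]
    exact closure_minimal (Rat.isDenseEmbedding_coe_real.dense.open_subset_closure_inter isOpen_Ioo)
      isClosed_closure
  have hmem := hcl ht
  rw [mem_closure_iff_nhdsWithin_neBot] at hmem
  have ht1 : Tendsto (fun x => ‖derivWithin u (Set.Icc a b) x‖) (𝓝[R] t)
      (𝓝 ‖derivWithin u (Set.Icc a b) t‖) :=
    ((hc t ht).mono fun x hx => Set.Ioo_subset_Icc_self hx.1).norm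
  refine le_of_tendsto ht1 ?_
  filter_upwards [self_mem_nhdsWithin] with x hx
  obtain ⟨hx1, q, rfl⟩ := hx
  rw [← hD _ hx1, ← ENNReal.ofReal_le_iff_le_toReal hfin, ofReal_norm]
  exact le_iSup₂_of_le (f := fun (q : ℚ) (_ : (q : ℝ) ∈ Set.Ioo a b) => ‖D q‖ₑ) q hx1 le_rfl

lemma abs_sub_le_ratSup (hab : a < b) (hu : ContDiffOn ℝ 1 u (Set.Icc a b))
    (hD : ∀ t ∈ Set.Ioo a b, D t = derivWithin u (Set.Icc a b) t) {x y : ℝ}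
    (hx : x ∈ Set.Icc a b) (hy : y ∈ Set.Icc a b) :
    |u y - u x| ≤ (ratSup D a b).toReal * |y - x| :=
  (convex_Icc a b).norm_image_sub_le_of_norm_derivWithin_le (hu.differentiableOn one_ne_zero)
    (fun _ ht => abs_derivWithin_le_ratSup hab hu hD ht) hx hy

lemma ofReal_abs_sub_le_lintegral (hu : ContDiffOn ℝ 1 u (Set.Icc a b))
    (hD : ∀ t ∈ Set.Ioo a b, D t = derivWithin u (Set.Icc a b) t) {x y : ℝ}
    (hx : x ∈ Set.Icc a b) (hy : y ∈ Set.Icc a b) :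
    ENNReal.ofReal |u y - u x| ≤
      (volume.restrict (Set.Ioo a b)).withDensity (fun t => ‖D t‖ₑ) (Set.uIcc x y) := by
  wlog hxy : x ≤ y generalizing x y
  · rw [abs_sub_comm, Set.uIcc_comm]
    exact this hy hx (le_of_not_ge hxy)
  have hsub : Set.Icc x y ⊆ Set.Icc a b := Set.Icc_subset_Icc hx.1 hy.2
  have h1 := intervalIntegral.integral_deriv_of_contDiffOn_Icc (hu.mono hsub) hxy
  rw [withDensity_apply _ measurableSet_uIcc, Set.uIcc_of_le hxy,
    Measure.restrict_restrict measurableSet_Icc, ← h1, intervalIntegral.integral_of_le hxy,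
    ← Real.norm_eq_abs, ofReal_norm]
  refine (enorm_integral_le_lintegral_enorm _).trans ?_
  rw [← restrict_Ioo_eq_restrict_Ioc]
  have hsub2 : Set.Ioo x y ⊆ Set.Icc x y ∩ Set.Ioo a b := fun t ht =>
    ⟨Set.Ioo_subset_Icc_self ht, hx.1.trans_lt ht.1, ht.2.trans_le hy.2⟩
  calc ∫⁻ t in Set.Ioo x y, ‖deriv u t‖ₑ = ∫⁻ t in Set.Ioo x y, ‖D t‖ₑ := by
        refine setLIntegral_congr_fun measurableSet_Ioo fun t ht => ?_
        have ht' := (hsub2 ht).2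
        simp only [hD t ht', (ContDiffOn.hasDerivAt_Ioo hu ht').deriv]
    _ ≤ _ := lintegral_mono_set hsub2

lemma lintegral_enorm_ne_top (hab : a < b) (hu : ContDiffOn ℝ 1 u (Set.Icc a b))
    (hD : ∀ t ∈ Set.Ioo a b, D t = derivWithin u (Set.Icc a b) t) :
    ∫⁻ t in Set.Ioo a b, ‖D t‖ₑ ≠ ∞ := by
  refine ne_top_of_le_ne_top ?_ (setLIntegral_mono' (g := fun _ => ratSup D a b)
    measurableSet_Ioo fun t ht => ?_)
  · rw [setLIntegral_const, Real.volume_Ioo]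
    exact ENNReal.mul_ne_top (ratSup_ne_top hab hu hD) ENNReal.ofReal_ne_top
  · rw [hD t ht, ← ofReal_norm, ENNReal.ofReal_le_iff_le_toReal (ratSup_ne_top hab hu hD)]
    exact abs_derivWithin_le_ratSup hab hu hD (Set.Ioo_subset_Icc_self ht)

end C1

/-- For almost every offset `t` in `(0, h)` the functions `G` and `u` agree along the whole
progression `a + j * h + t`, and the increments along it add up to at most the variation of `G`.
Integrating over the offset gives the factor `h`. -/
lemma lintegral_enorm_diff_le_eVariationOn {u G : ℝ → ℝ} {a h : ℝ} (hh : 0 < h) (N : ℕ)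
    (hu : Measurable u) (hG : ∀ᵐ t, t ∈ Set.Ioo a (a + (N + 1) * h) → G t = u t) :
    ∫⁻ t in Set.Ioo a (a + N * h), ‖u (t + h) - u t‖ₑ ≤
      ENNReal.ofReal h * eVariationOn G (Set.Ioo a (a + (N + 1) * h)) := by
  have hcov : Set.Ioo a (a + N * h) ⊆ ⋃ j : Fin N, Set.Ico (a + j * h) (a + (j + 1) * h) := by
    intro t ht
    have h0 : 0 ≤ (t - a) / h := div_nonneg (sub_nonneg.2 ht.1.le) hh.le
    have h1 : ⌊(t - a) / h⌋₊ < N := by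
      rw [Nat.floor_lt h0, div_lt_iff₀ hh]; linarith [ht.2]
    have h2 := Nat.floor_le h0
    have h3 := Nat.lt_floor_add_one ((t - a) / h)
    rw [le_div_iff₀ hh] at h2
    rw [div_lt_iff₀ hh] at h3
    exact Set.mem_iUnion.2 ⟨⟨_, h1⟩, by simp only; linarith, by simp only; linarith⟩
  have hshift : ∀ j : Fin N, ∫⁻ t in Set.Ico (a + j * h) (a + (j + 1) * h), ‖u (t + h) - u t‖ₑ =
      ∫⁻ t in Set.Ioo 0 h, ‖u (a + (j + 1 : ℕ) * h + t) - u (a + j * h + t)‖ₑ := by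
    intro j
    rw [← restrict_Ioo_eq_restrict_Ico, ← lintegral_indicator measurableSet_Ioo,
      ← lintegral_indicator measurableSet_Ioo,
      ← lintegral_add_left_eq_self _ (a + (j : ℝ) * h)]
    congr 1
    ext t
    simp only [Set.indicator_apply, Set.mem_Ioo]
    have e : (a + j * h < a + j * h + t ∧ a + j * h + t < a + (j + 1) * h) ↔ (0 < t ∧ t < h) := by
      constructor <;> rintro ⟨h1, h2⟩ <;> constructor <;> nlinarith
    simp only [e]
    have e2 : a + (j : ℝ) * h + t + h = a + ((j + 1 : ℕ) : ℝ) * h + t := by push_cast; ring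
    rw [e2]
  calc ∫⁻ t in Set.Ioo a (a + N * h), ‖u (t + h) - u t‖ₑ
      ≤ ∫⁻ t in ⋃ j : Fin N, Set.Ico (a + j * h) (a + (j + 1) * h), ‖u (t + h) - u t‖ₑ :=
        lintegral_mono_set hcov
    _ ≤ ∑' j : Fin N, ∫⁻ t in Set.Ico (a + j * h) (a + (j + 1) * h), ‖u (t + h) - u t‖ₑ :=
        lintegral_iUnion_le _ _
    _ = ∑ j : Fin N, ∫⁻ t in Set.Ioo 0 h, ‖u (a + (j + 1 : ℕ) * h + t) - u (a + j * h + t)‖ₑ := by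
        rw [tsum_fintype]; exact Finset.sum_congr rfl fun j _ => hshift j
    _ = ∫⁻ t in Set.Ioo 0 h, ∑ j : Fin N,
          ‖u (a + (j + 1 : ℕ) * h + t) - u (a + j * h + t)‖ₑ := by
        rw [lintegral_finsetSum]
        intro j _
        exact ((hu.comp (measurable_const.add measurable_id)).sub
          (hu.comp (measurable_const.add measurable_id))).enorm
    _ ≤ ∫⁻ t in Set.Ioo 0 h, eVariationOn G (Set.Ioo a (a + (N + 1) * h)) := by
        refine setLIntegral_mono_ae' measurableSet_Ioo ?_
        have hgood : ∀ᵐ t, ∀ j : ℕ, a + j * h + t ∈ Set.Ioo a (a + (N + 1) * h) →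
            G (a + j * h + t) = u (a + j * h + t) := by
          rw [ae_all_iff]
          exact fun j => (measurePreserving_add_left volume
            (a + (j : ℝ) * h)).quasiMeasurePreserving.ae hG
        filter_upwards [hgood] with t ht ht0
        have hmem : ∀ j ≤ N, a + (j : ℕ) * h + t ∈ Set.Ioo a (a + (N + 1) * h) := by
          intro j hj
          have hj' : (j : ℝ) * h ≤ N * h := by gcongr
          have hj0 : 0 ≤ (j : ℝ) * h := by positivity
          constructor <;> nlinarith [ht0.1, ht0.2]
        have hs := eVariationOn.sum_le_of_monotoneOn_Iic (f := G) (n := N)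
          (s := Set.Ioo a (a + (N + 1) * h)) (u := fun j : ℕ => a + j * h + t)
          (fun i _ j _ hij => by
            have : (i : ℝ) ≤ j := by exact_mod_cast hij
            simp only; gcongr)
          (fun i hi => hmem i hi)
        refine le_trans (le_of_eq ?_) hs
        rw [Finset.sum_range]
        refine Finset.sum_congr rfl fun j _ => ?_
        rw [ht _ (hmem _ j.2), ht _ (hmem _ j.2.le), edist_eq_enorm_sub]
    _ = _ := by rw [setLIntegral_const, Real.volume_Ioo, sub_zero, mul_comm]

/-- The variation of every version of a differentiable function is at least `∫ |u'|`. -/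
theorem lintegral_enorm_deriv_le_eVariationOn {u G D : ℝ → ℝ} {a b : ℝ}
    (hu : Measurable u) (hD : ∀ t ∈ Set.Ioo a b, HasDerivAt u (D t) t)
    (hG : ∀ᵐ t, t ∈ Set.Ioo a b → G t = u t) :
    ∫⁻ t in Set.Ioo a b, ‖D t‖ₑ ≤ eVariationOn G (Set.Ioo a b) := by
  rcases le_or_gt b a with hab | hab
  · simp [Set.Ioo_eq_empty (not_lt.2 hab)]
  set h : ℕ → ℝ := fun N => (b - a) / ((N : ℝ) + 1) with hh
  have hpos : ∀ N, 0 < h N := fun N => div_pos (sub_pos.2 hab) (by positivity)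
  have hb : ∀ N : ℕ, a + (N + 1) * h N = b := fun N => by
    simp only [hh]; field_simp; ring
  have htend : Tendsto h atTop (𝓝 0) := by
    have := (tendsto_one_div_add_atTop_nhds_zero_nat (𝕜 := ℝ)).const_mul (b - a)
    simpa [hh, div_eq_mul_inv] using this
  -- Difference quotients with step `h N`, cut off one step before `b` so that the shifted point
  -- stays in the interval. They converge to `|D|`, and Fatou's lemma applies.
  set Φ : ℕ → ℝ → ℝ≥0∞ := fun N => (Set.Ioo a (a + N * h N)).indicator
    fun t => ‖(h N)⁻¹ * (u (t + h N) - u t)‖ₑ with hΦ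
  have hΦm : ∀ N, Measurable (Φ N) := fun N =>
    (measurable_const.mul ((hu.comp (measurable_id.add_const _)).sub hu)).enorm.indicator
      measurableSet_Ioo
  have hΦle : ∀ N, ∫⁻ t in Set.Ioo a b, Φ N t ≤ eVariationOn G (Set.Ioo a b) := by
    intro N
    have h1 := lintegral_enorm_diff_le_eVariationOn (a := a) (hpos N) N hu (by rwa [hb N])
    rw [hb N] at h1
    calc ∫⁻ t in Set.Ioo a b, Φ N t ≤ ∫⁻ t, Φ N t := setLIntegral_le_lintegral _ _
      _ = ENNReal.ofReal (h N)⁻¹ * ∫⁻ t in Set.Ioo a (a + N * h N), ‖u (t + h N) - u t‖ₑ := by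
          rw [lintegral_indicator measurableSet_Ioo, ← lintegral_const_mul' _ _ ENNReal.ofReal_ne_top]
          congr 1
          ext t
          rw [enorm_mul, Real.enorm_of_nonneg (inv_nonneg.2 (hpos N).le)]
      _ ≤ ENNReal.ofReal (h N)⁻¹ * (ENNReal.ofReal (h N) * eVariationOn G (Set.Ioo a b)) := by
          gcongr
      _ = eVariationOn G (Set.Ioo a b) := by
          rw [← mul_assoc, ← ENNReal.ofReal_mul (inv_nonneg.2 (hpos N).le),
            inv_mul_cancel₀ (hpos N).ne', ENNReal.ofReal_one, one_mul]
  have hlim : ∀ t ∈ Set.Ioo a b, Tendsto (fun N => Φ N t) atTop (𝓝 ‖D t‖ₑ) := by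
    intro t ht
    have h1 := (continuous_enorm.tendsto (D t)).comp
      (HasDerivAt.tendsto_slope_seq (hD t ht) htend fun k => (hpos k).ne')
    refine h1.congr' ?_
    filter_upwards [htend.eventually (gt_mem_nhds (sub_pos.2 ht.2))] with N hN
    have : t ∈ Set.Ioo a (a + N * h N) := ⟨ht.1, by linarith [hb N]⟩
    simp [hΦ, this]
  calc ∫⁻ t in Set.Ioo a b, ‖D t‖ₑ = ∫⁻ t in Set.Ioo a b, liminf (fun N => Φ N t) atTop :=
        setLIntegral_congr_fun measurableSet_Ioo fun t ht => (hlim t ht).liminf_eq.symm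
    _ ≤ liminf (fun N => ∫⁻ t in Set.Ioo a b, Φ N t) atTop := lintegral_liminf_le hΦm
    _ ≤ eVariationOn G (Set.Ioo a b) :=
        liminf_le_of_le (h := fun c hc => by
          obtain ⟨N, hN⟩ := hc.exists
          exact hN.trans (hΦle N))

end Jablonski

namespace Jablonski

variable {n : ℕ}

/-! ### The cube as a subset of `ℝ^n` -/

/-- The inclusion of the cube in `ℝ^n`. -/
def embed (x : Cube n) : Fin n → ℝ := fun i => x i

/-- The coordinatewise projection of `ℝ^n` onto the cube. -/
noncomputable def proj (x : Fin n → ℝ) : Cube n := fun i => Set.projIcc 0 1 zero_le_one (x i)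

/-- The extension of a map of the cube to `ℝ^n`. -/
noncomputable def ambient (f : Cube n → Cube n) (x : Fin n → ℝ) : Fin n → ℝ := embed (f (proj x))

/-- The unit cube of `ℝ^n`. -/
def unitBox (n : ℕ) : Set (Fin n → ℝ) := Set.univ.pi fun _ => Set.Icc 0 1

lemma measurableSet_unitBox : MeasurableSet (unitBox n) :=
  MeasurableSet.univ_pi fun _ => measurableSet_Icc

@[simp] lemma proj_embed (x : Cube n) : proj (embed x) = x :=
  funext fun i => Set.projIcc_val _ (x i)

lemma embed_mem (x : Cube n) : embed x ∈ unitBox n := fun i _ => (x i).2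

lemma measurable_embed : Measurable (embed : Cube n → Fin n → ℝ) :=
  measurable_pi_lambda _ fun i => measurable_subtype_coe.comp (measurable_pi_apply i)

lemma measurable_proj : Measurable (proj : (Fin n → ℝ) → Cube n) :=
  measurable_pi_lambda _ fun i => continuous_projIcc.measurable.comp (measurable_pi_apply i)

lemma measurable_ambient {f : Cube n → Cube n} (hf : Measurable f) : Measurable (ambient f) :=
  measurable_embed.comp (hf.comp measurable_proj)

lemma measurePreserving_embed :
    MeasurePreserving (embed : Cube n → Fin n → ℝ) volume (volume.restrict (unitBox n)) := by
  have h1 : (volume : Measure (Fin n → ℝ)).restrict (unitBox n) =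
      Measure.pi fun _ => volume.restrict (Set.Icc 0 1) := by
    rw [unitBox, volume_pi, Measure.restrict_pi_pi]
  rw [h1]
  exact measurePreserving_pi (fun _ => volume) (fun _ => volume.restrict (Set.Icc 0 1))
    fun _ => measurePreserving_subtype_coe measurableSet_Icc

lemma measurePreserving_proj :
    MeasurePreserving (proj : (Fin n → ℝ) → Cube n) (volume.restrict (unitBox n)) volume := by
  refine ⟨measurable_proj, ?_⟩
  rw [← (measurePreserving_embed (n := n)).map_eq, Measure.map_map measurable_proj measurable_embed]
  convert! Measure.map_id
  exact funext proj_embed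

lemma ambient_mem (f : Cube n → Cube n) (x : Fin n → ℝ) : ambient f x ∈ unitBox n := embed_mem _

lemma proj_ambient (f : Cube n → Cube n) (x : Fin n → ℝ) : proj (ambient f x) = f (proj x) :=
  proj_embed _

/-! ### Changes of variables for products of maps of the line -/

/-- The derivative of a product map is diagonal, so the Jacobian is the product of the derivatives.
-/
lemma lintegral_image_prod {C : Fin n → Set ℝ} {ψ ψ' : Fin n → ℝ → ℝ}
    (hinj : ∀ i, Set.InjOn (ψ i) (C i))
    (hder : ∀ i, ∀ t ∈ C i, HasDerivWithinAt (ψ i) (ψ' i t) (C i) t)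
    {A : Set (Fin n → ℝ)} (hA : MeasurableSet A) (hAC : A ⊆ Set.univ.pi C)
    (g : (Fin n → ℝ) → ℝ≥0∞) :
    ∫⁻ y in (fun x i => ψ i (x i)) '' A, g y =
      ∫⁻ x in A, ENNReal.ofReal (∏ i, |ψ' i (x i)|) * g (fun i => ψ i (x i)) := by
  have h := lintegral_image_eq_lintegral_abs_det_fderiv_mul (volume : Measure (Fin n → ℝ)) hA
    (f := fun x i => ψ i (x i))
    (f' := fun x => ContinuousLinearMap.pi fun i =>
      (ContinuousLinearMap.toSpanSingleton ℝ (ψ' i (x i))) ∘SL ContinuousLinearMap.proj i)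
    (fun x hx => ?_) (fun x hx y hy hxy => ?_) g
  · rw [h]
    refine setLIntegral_congr_fun hA fun x _ => ?_
    simp only [ContinuousLinearMap.det_pi]
    congr 2
    rw [Finset.abs_prod]
    refine Finset.prod_congr rfl fun i _ => ?_
    rw [ContinuousLinearMap.det, LinearMap.det_ring]
    simp
  · rw [hasFDerivWithinAt_pi]
    intro i
    have h1 : HasFDerivWithinAt (fun x : Fin n → ℝ => x i) (ContinuousLinearMap.proj i) A x :=
      (ContinuousLinearMap.proj (R := ℝ) (φ := fun _ : Fin n => ℝ) i).hasFDerivWithinAt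
    exact (hder i _ (hAC hx i trivial)).hasFDerivWithinAt.comp x h1 fun y hy => hAC hy i trivial
  · funext i
    exact hinj i (hAC hx i trivial) (hAC hy i trivial) (congrFun hxy i)

/-- Expansion bounds the Jacobian below by `c ^ (-n)`, so the part of the box that is mapped into a
null set is null. -/
lemma ae_comp_of_ae_prod {C : Fin n → Set ℝ} {ψ ψ' : Fin n → ℝ → ℝ} (hC : ∀ i, MeasurableSet (C i))
    (hm : ∀ i, Measurable (ψ i)) (hinj : ∀ i, Set.InjOn (ψ i) (C i))
    (hder : ∀ i, ∀ t ∈ C i, HasDerivWithinAt (ψ i) (ψ' i t) (C i) t)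
    {c : ℝ≥0} (hexp : ∀ i, ∀ t ∈ C i, 1 ≤ c * |ψ' i t|) {p : (Fin n → ℝ) → Prop} (hp : ∀ᵐ y, p y) :
    ∀ᵐ x : Fin n → ℝ, x ∈ Set.univ.pi C → p fun i => ψ i (x i) := by
  obtain ⟨N, hNs, hNm, hN0⟩ := exists_measurable_superset_of_null (ae_iff.1 hp)
  have hΨ : Measurable fun (x : Fin n → ℝ) i => ψ i (x i) :=
    measurable_pi_lambda _ fun i => (hm i).comp (measurable_pi_apply i)
  set A := Set.univ.pi C ∩ (fun (x : Fin n → ℝ) i => ψ i (x i)) ⁻¹' N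
  have hA : MeasurableSet A := (MeasurableSet.univ_pi hC).inter (hΨ hNm)
  have h1 := lintegral_image_prod hinj hder hA Set.inter_subset_left fun _ => 1
  have h2 : ∫⁻ _ in (fun (x : Fin n → ℝ) i => ψ i (x i)) '' A, (1 : ℝ≥0∞) = 0 := by
    rw [setLIntegral_const, one_mul]
    exact measure_mono_null (by rintro _ ⟨x, hx, rfl⟩; exact hx.2) hN0
  rw [h2] at h1
  have hlow : ∀ x ∈ A, (1 : ℝ≥0∞) ≤ (c : ℝ≥0∞) ^ n * (ENNReal.ofReal (∏ i, |ψ' i (x i)|) * 1) := by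
    intro x hx
    have h4 : (1 : ℝ) ≤ ∏ i, (c * |ψ' i (x i)|) :=
      Finset.prod_const_one.symm.trans_le
        (Finset.prod_le_prod (fun _ _ => zero_le_one) fun i _ => hexp i _ (hx.1 i trivial))
    rw [Finset.prod_mul_distrib, Finset.prod_const, Finset.card_univ, Fintype.card_fin] at h4
    have h5 := ENNReal.ofReal_le_ofReal h4
    rwa [ENNReal.ofReal_one, ENNReal.ofReal_mul (by positivity), ENNReal.ofReal_pow c.coe_nonneg,
      ENNReal.ofReal_coe_nnreal, ← mul_one (ENNReal.ofReal (∏ i, |ψ' i (x i)|))] at h5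
  have h3 : volume A = 0 := by
    refine le_antisymm ?_ bot_le
    calc volume A = ∫⁻ _ in A, 1 := by simp
      _ ≤ ∫⁻ x in A, (c : ℝ≥0∞) ^ n * (ENNReal.ofReal (∏ i, |ψ' i (x i)|) * 1) :=
          setLIntegral_mono' hA hlow
      _ = 0 := by
          rw [lintegral_const_mul' _ _ (ENNReal.pow_ne_top ENNReal.coe_ne_top), ← h1, mul_zero]
  have h4 : ∀ᵐ x : Fin n → ℝ, x ∉ A := by
    rw [ae_iff]; simpa using h3
  filter_upwards [h4] with x hx hxC
  by_contra hcon
  exact hx ⟨hxC, hNs hcon⟩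

/-- Fubini's theorem for the shear `(x, t) ↦ x + t e_i`, whose sections at fixed `t` are
translations, followed by a translation of `t` by `x i`. -/
lemma ae_ae_update {p : (Fin n → ℝ) → Prop} (hp : ∀ᵐ x, p x) (i : Fin n) :
    ∀ᵐ x : Fin n → ℝ, ∀ᵐ t : ℝ, p (Function.update x i t) := by
  obtain ⟨N, hNs, hNm, hN0⟩ := exists_measurable_superset_of_null (ae_iff.1 hp)
  set g : (Fin n → ℝ) × ℝ → Fin n → ℝ := fun q => q.1 + Pi.single i q.2 with hg
  have hgm : Measurable g := by
    refine measurable_fst.add ?_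
    refine measurable_pi_lambda _ fun j => ?_
    by_cases hj : j = i
    · subst hj; simpa using measurable_snd
    · simp [hj]
  have h0 : ((volume : Measure (Fin n → ℝ)).prod (volume : Measure ℝ)) (g ⁻¹' N) = 0 := by
    rw [Measure.prod_apply_symm (hgm hNm)]
    refine (lintegral_congr fun t => ?_).trans lintegral_zero
    exact (measure_preimage_add_right (volume : Measure (Fin n → ℝ)) (Pi.single i t) N).trans hN0
  have h1 := Measure.ae_ae_of_ae_prod (measure_eq_zero_iff_ae_notMem.1 h0)
  filter_upwards [h1] with x hx
  have h2 := (measurePreserving_sub_right (volume : Measure ℝ) (x i)).quasiMeasurePreserving.ae hx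
  filter_upwards [h2] with t ht
  by_contra hcon
  apply ht
  have : g (x, t - x i) = Function.update x i t := by
    funext j
    by_cases hj : j = i
    · subst hj; simp [hg]
    · simp [hg, hj]
  rw [Set.mem_preimage, this]
  exact hNs hcon

/-! ### The transfer operator on indicators of boxes -/

/-- A third of the indicator of a box. -/
noncomputable def boxFun (C : Fin n → Set ℝ) : Cube n → ℝ :=
  (embed ⁻¹' Set.univ.pi C).indicator fun _ => 3⁻¹

lemma integrable_boxFun {C : Fin n → Set ℝ} (hC : ∀ i, MeasurableSet (C i)) :
    Integrable (boxFun C) volume :=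
  (integrable_const _).indicator (measurable_embed (MeasurableSet.univ_pi hC))

section Transfer

variable {S : Type} {f : Cube n → Cube n} {C : S → Fin n → Set ℝ}
  {ψ ψ' : S → Fin n → ℝ → ℝ} {c : ℝ≥0}

lemma ProductBranches.measurableSet (h : ProductBranches (ambient f) C ψ ψ' c) (s : S) (i : Fin n) :
    MeasurableSet (C s i) := (h.ordConnected s i).measurableSet

lemma ProductBranches.pi_subset (h : ProductBranches (ambient f) C ψ ψ' c) (s : S) :
    Set.univ.pi (C s) ⊆ unitBox n := fun _ hx i hi => h.subset s i (hx i hi)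

lemma ae_of_ae_cube {p : Cube n → Prop} (hp : ∀ᵐ z, p z) :
    ∀ᵐ y : Fin n → ℝ, y ∈ unitBox n → p (proj y) :=
  (ae_restrict_iff' measurableSet_unitBox).1 (measurePreserving_proj.quasiMeasurePreserving.ae hp)

lemma ProductBranches.ae_comp (h : ProductBranches (ambient f) C ψ ψ' c) (s : S)
    {p : Cube n → Prop} (hp : ∀ᵐ z, p z) :
    ∀ᵐ x : Fin n → ℝ, x ∈ Set.univ.pi (C s) → p (f (proj x)) := by
  filter_upwards [ae_comp_of_ae_prod (h.measurableSet s) (h.measurable s) (h.injOn s) (h.deriv s)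
    (h.expand s) (ae_of_ae_cube hp)] with x hx hxC
  have e := h.apply_eq s x fun i => hxC i trivial
  have h1 := hx hxC (by rw [← e]; exact ambient_mem f x)
  rwa [← e, proj_ambient] at h1

lemma ProductBranches.map_absolutelyContinuous (h : ProductBranches (ambient f) C ψ ψ' c) (s : S)
    (hf : Measurable f) :
    ((volume : Measure (Cube n)).restrict (embed ⁻¹' Set.univ.pi (C s))).map f ≪ volume := by
  have hB : MeasurableSet (embed ⁻¹' Set.univ.pi (C s) : Set (Cube n)) :=
    measurable_embed (MeasurableSet.univ_pi (h.measurableSet s))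
  refine Measure.AbsolutelyContinuous.mk fun N hN hN0 => ?_
  rw [Measure.map_apply hf hN, Measure.restrict_apply (hf hN)]
  have h1 := h.ae_comp s (measure_eq_zero_iff_ae_notMem.1 hN0)
  have h2 := measurePreserving_embed.quasiMeasurePreserving.ae (ae_restrict_of_ae h1)
  rw [measure_eq_zero_iff_ae_notMem]
  filter_upwards [h2] with z hz hz2
  have := hz hz2.2
  rw [proj_embed] at this
  exact this hz2.1

/-- The function is nonnegative, so the signed derivative defining `transfer` reduces to the
Radon–Nikodym derivative of an ordinary measure. -/
lemma transfer_boxFun (hf : Measurable f) {C : Fin n → Set ℝ} (hC : ∀ i, MeasurableSet (C i))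
    {ρ : Measure (Cube n)} (hρ : ρ = (((3 : ℝ≥0∞)⁻¹ •
      (volume : Measure (Cube n)).restrict (embed ⁻¹' Set.univ.pi C)).map f)) (hac : ρ ≪ volume) :
    transfer f (boxFun C) =ᵐ[volume] fun z => (ρ.rnDeriv volume z).toReal := by
  have hB : MeasurableSet (embed ⁻¹' Set.univ.pi C : Set (Cube n)) :=
    measurable_embed (MeasurableSet.univ_pi hC)
  have hfin : IsFiniteMeasure ((3 : ℝ≥0∞)⁻¹ •
      (volume : Measure (Cube n)).restrict (embed ⁻¹' Set.univ.pi C)) :=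
    Measure.smul_finite _ (by simp)
  have hρf : IsFiniteMeasure ρ := by rw [hρ]; infer_instance
  refine (SignedMeasure.eq_rnDeriv 0 _ Measure.integrable_toReal_rnDeriv
    VectorMeasure.MutuallySingular.zero_left ?_).symm
  ext A hA
  rw [zero_add, VectorMeasure.map_apply _ hf hA, withDensityᵥ_apply (integrable_boxFun hC) (hf hA),
    withDensityᵥ_apply Measure.integrable_toReal_rnDeriv hA, Measure.setIntegral_toReal_rnDeriv hac,
    boxFun, setIntegral_indicator hB, setIntegral_const, hρ, measureReal_def, measureReal_def,
    Measure.map_apply hf hA, Measure.smul_apply, Measure.restrict_apply (hf hA)]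
  simp [mul_comm]

/-- The image density, read at the image point, is the reciprocal Jacobian. The identity is obtained
by comparing integrals over measurable subsets of the box after a change of variables, so the branch
never has to be inverted. -/
lemma ProductBranches.transfer_boxFun_apply (h : ProductBranches (ambient f) C ψ ψ' c) (s : S)
    (hf : Measurable f) (hψ' : ∀ i, ContinuousOn (ψ' s i) (C s i)) :
    ∀ᵐ x : Fin n → ℝ, x ∈ Set.univ.pi (C s) →
      transfer f (boxFun (C s)) (f (proj x)) = 3⁻¹ * ∏ i, |ψ' s i (x i)|⁻¹ := by
  have hC := h.measurableSet s
  have hP : MeasurableSet (Set.univ.pi (C s)) := MeasurableSet.univ_pi hC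
  have hB : MeasurableSet (embed ⁻¹' Set.univ.pi (C s) : Set (Cube n)) := measurable_embed hP
  obtain ⟨ρ, hρ⟩ : ∃ ρ : Measure (Cube n), ρ = (((3 : ℝ≥0∞)⁻¹ •
      (volume : Measure (Cube n)).restrict (embed ⁻¹' Set.univ.pi (C s))).map f) := ⟨_, rfl⟩
  have hac : ρ ≪ volume := by
    rw [hρ, Measure.map_smul]
    exact (h.map_absolutelyContinuous s hf).smul_left _
  have hfin : IsFiniteMeasure ((3 : ℝ≥0∞)⁻¹ •
      (volume : Measure (Cube n)).restrict (embed ⁻¹' Set.univ.pi (C s))) :=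
    Measure.smul_finite _ (by simp)
  have hρf : IsFiniteMeasure ρ := by rw [hρ]; infer_instance
  have hL : ρ.HaveLebesgueDecomposition volume :=
    Measure.haveLebesgueDecomposition_of_sigmaFinite ρ volume
  set R := ρ.rnDeriv volume with hR
  have hRm : Measurable R := Measure.measurable_rnDeriv _ _
  set Ψ : (Fin n → ℝ) → Fin n → ℝ := fun x i => ψ s i (x i) with hΨ
  have hΨm : Measurable Ψ :=
    measurable_pi_lambda _ fun i => (h.measurable s i).comp (measurable_pi_apply i)
  have hamb : ∀ x ∈ Set.univ.pi (C s), ambient f x = Ψ x := fun x hx =>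
    h.apply_eq s x fun i => hx i trivial
  have hinj : Set.InjOn Ψ (Set.univ.pi (C s)) := fun x hx y hy hxy => funext fun i =>
    h.injOn s i (hx i trivial) (hy i trivial) (congrFun hxy i)
  have hJm : AEMeasurable (fun x : Fin n → ℝ => ENNReal.ofReal (∏ i, |ψ' s i (x i)|) *
      R (f (proj x))) (volume.restrict (Set.univ.pi (C s))) := by
    refine AEMeasurable.mul ?_ (hRm.comp (hf.comp measurable_proj)).aemeasurable
    refine AEMeasurable.ennreal_ofReal (ContinuousOn.aemeasurable ?_ hP)
    refine continuousOn_finsetProd _ fun i _ => ContinuousOn.abs ?_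
    exact (hψ' i).comp (continuous_apply i).continuousOn fun x hx => hx i trivial
  have hkey : (fun x : Fin n → ℝ => ENNReal.ofReal (∏ i, |ψ' s i (x i)|) * R (f (proj x)))
      =ᵐ[volume.restrict (Set.univ.pi (C s))] fun _ => 3⁻¹ := by
    refine ae_eq_of_forall_setLIntegral_eq_of_sigmaFinite₀ hJm aemeasurable_const fun A hA _ => ?_
    rw [Measure.restrict_restrict hA]
    set A' := A ∩ Set.univ.pi (C s) with hA'
    have hA'm : MeasurableSet A' := hA.inter hP
    have hsub : A' ⊆ Set.univ.pi (C s) := Set.inter_subset_right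
    have hE : MeasurableSet (Ψ '' A') :=
      hA'm.image_of_measurable_injOn hΨm (hinj.mono hsub)
    have h1 := lintegral_image_prod (h.injOn s) (h.deriv s) hA'm hsub fun y => R (proj y)
    have h2 : ∫⁻ x in A', ENNReal.ofReal (∏ i, |ψ' s i (x i)|) * R (proj fun i => ψ s i (x i)) =
        ∫⁻ x in A', ENNReal.ofReal (∏ i, |ψ' s i (x i)|) * R (f (proj x)) := by
      refine setLIntegral_congr_fun hA'm fun x hx => ?_
      have e : (fun i => ψ s i (x i)) = ambient f x := (hamb x (hsub hx)).symm
      simp only [e, proj_ambient]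
    rw [h2] at h1
    have hEU : Ψ '' A' ⊆ unitBox n := by
      rintro _ ⟨x, hx, rfl⟩
      rw [← hamb x (hsub hx)]
      exact ambient_mem f x
    have h3 := measurePreserving_embed.setLIntegral_comp_preimage hE (hRm.comp measurable_proj)
    rw [Measure.restrict_restrict hE, Set.inter_eq_left.2 hEU] at h3
    simp only [Function.comp_apply, proj_embed] at h3
    have h4 : f ⁻¹' (embed ⁻¹' (Ψ '' A')) ∩ embed ⁻¹' Set.univ.pi (C s) = embed ⁻¹' A' := by
      ext z
      have e : z ∈ embed ⁻¹' Set.univ.pi (C s) → embed (f z) = Ψ (embed z) := fun hz => by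
        rw [← hamb _ hz, ambient, proj_embed]
      constructor
      · rintro ⟨⟨x, hx, hxz⟩, hz⟩
        rw [e hz] at hxz
        have := hinj (hsub hx) hz hxz
        rwa [Set.mem_preimage, ← this]
      · intro hz
        exact ⟨⟨_, hz, (e (hsub hz)).symm⟩, hsub hz⟩
    rw [← h1]
    change ∫⁻ y in Ψ '' A', R (proj y) = _
    rw [← h3, Measure.setLIntegral_rnDeriv hac, hρ, Measure.map_apply hf (measurable_embed hE),
      Measure.smul_apply, Measure.restrict_apply (hf (measurable_embed hE)), h4,
      measurePreserving_embed.measure_preimage hA'm.nullMeasurableSet, Measure.restrict_apply hA'm,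
      Set.inter_eq_left.2 (hsub.trans (h.pi_subset s)), setLIntegral_const, smul_eq_mul]
  rw [Filter.EventuallyEq, ae_restrict_iff' hP] at hkey
  filter_upwards [hkey, h.ae_comp s (transfer_boxFun hf hC hρ hac)] with x hx1 hx2 hxC
  rw [hx2 hxC]
  have h5 := congrArg ENNReal.toReal (hx1 hxC)
  rw [ENNReal.toReal_mul, ENNReal.toReal_ofReal (Finset.prod_nonneg fun i _ => abs_nonneg _)] at h5
  have hpos : ∏ i, |ψ' s i (x i)| ≠ 0 := Finset.prod_ne_zero_iff.2 fun i _ h0 => by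
    have := h.expand s i _ (hxC i trivial)
    rw [h0, mul_zero] at this
    linarith
  rw [Finset.prod_inv_distrib]
  field_simp
  rw [mul_comm] at h5
  simp at h5
  linarith

end Transfer

end Jablonski

namespace Jablonski

variable {n : ℕ}

/-! ### A lower bound for the norm of the transfer operator on `BV` -/

lemma eVariationOn_sub_le {α : Type*} [LinearOrder α] (f g : α → ℝ) (s : Set α) :
    eVariationOn (fun t => f t - g t) s ≤ eVariationOn f s + eVariationOn g s := by
  refine iSup_le fun p => ?_
  calc ∑ i ∈ Finset.range p.1, edist (f (p.2.1 (i + 1)) - g (p.2.1 (i + 1)))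
        (f (p.2.1 i) - g (p.2.1 i))
      ≤ ∑ i ∈ Finset.range p.1, (edist (f (p.2.1 (i + 1))) (f (p.2.1 i)) +
          edist (g (p.2.1 (i + 1))) (g (p.2.1 i))) :=
        Finset.sum_le_sum fun i _ => by
          simp only [edist_dist]
          rw [← ENNReal.ofReal_add dist_nonneg dist_nonneg]
          exact ENNReal.ofReal_le_ofReal (dist_sub_sub_le _ _ _ _)
    _ = _ := Finset.sum_add_distrib
    _ ≤ _ := add_le_add (eVariationOn.sum_le p.2.2.1 p.2.2.2) (eVariationOn.sum_le p.2.2.1 p.2.2.2)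

/-- With `A` the set of points lying above some point of `C`, the indicator of `C` is the difference
of those of `A` and `A \ C`. Both sets are closed upwards, so both indicators are monotone. -/
lemma eVariationOn_indicator_le {C : Set unitInterval} (hC : C.OrdConnected) {κ : ℝ} (hκ : 0 ≤ κ) :
    eVariationOn (C.indicator fun _ => κ) Set.univ ≤ ENNReal.ofReal (2 * κ) := by
  classical
  have hmono : ∀ A : Set unitInterval, (∀ x ∈ A, ∀ y, x ≤ y → y ∈ A) →
      eVariationOn (A.indicator fun _ => κ) Set.univ ≤ ENNReal.ofReal κ := by
    intro A hA
    have hm : MonotoneOn (A.indicator fun _ => κ) Set.univ := by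
      intro x _ y _ hxy
      by_cases hx : x ∈ A
      · rw [Set.indicator_of_mem hx, Set.indicator_of_mem (hA x hx y hxy)]
      · rw [Set.indicator_of_notMem hx]
        exact Set.indicator_nonneg (fun _ _ => hκ) _
    have h := hm.eVariationOn_eq (Set.mem_univ 0) (Set.mem_univ 1)
    have hI : Set.univ ∩ Set.Icc (0 : unitInterval) 1 = Set.univ := by
      ext x; simp [unitInterval.le_one']
    rw [hI] at h
    rw [h]
    refine ENNReal.ofReal_le_ofReal ?_
    have h0 : 0 ≤ A.indicator (fun _ => κ) (0 : unitInterval) :=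
      Set.indicator_nonneg (fun _ _ => hκ) _
    have h1 : A.indicator (fun _ => κ) (1 : unitInterval) ≤ κ :=
      Set.indicator_le_self' (fun _ _ => hκ) _
    linarith
  set A : Set unitInterval := {x | ∃ y ∈ C, y ≤ x}
  have hA : ∀ x ∈ A, ∀ y, x ≤ y → y ∈ A := fun x ⟨z, hz, hzx⟩ y hxy => ⟨z, hz, hzx.trans hxy⟩
  have hB : ∀ x ∈ A \ C, ∀ y, x ≤ y → y ∈ A \ C := by
    rintro x ⟨⟨z, hz, hzx⟩, hxC⟩ y hxy
    exact ⟨⟨z, hz, hzx.trans hxy⟩, fun hy => hxC (hC.out hz hy ⟨hzx, hxy⟩)⟩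
  have e : (C.indicator fun _ => κ) = fun t => A.indicator (fun _ => κ) t -
      (A \ C).indicator (fun _ => κ) t := by
    funext t
    by_cases ht : t ∈ C
    · have : t ∈ A := ⟨t, ht, le_rfl⟩
      simp [ht, this]
    · by_cases htA : t ∈ A <;> simp [ht, htA]
  rw [e, two_mul, ENNReal.ofReal_add hκ hκ]
  exact (eVariationOn_sub_le _ _ _).trans (add_le_add (hmono A hA) (hmono _ hB))

lemma lineVariation_boxFun (C : Fin n → Set ℝ) (i : Fin n) (x : Cube n) :
    lineVariation i (boxFun C) x = ({x : Cube n | ∀ j, j ≠ i → (x j : ℝ) ∈ C j}).indicator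
      (fun _ => eVariationOn (((↑) ⁻¹' C i : Set unitInterval).indicator fun _ => (3⁻¹ : ℝ))
        Set.univ) x := by
  rw [lineVariation]
  by_cases hx : ∀ j, j ≠ i → (x j : ℝ) ∈ C j
  · rw [Set.indicator_of_mem (by exact hx)]
    congr 1
    funext t
    have e : Function.update x i t ∈ embed ⁻¹' Set.univ.pi C ↔
        t ∈ ((↑) ⁻¹' C i : Set unitInterval) := by
      simp only [Set.mem_preimage, Set.mem_pi, Set.mem_univ, true_imp_iff, embed]
      constructor
      · intro h
        simpa using h i
      · intro h j
        by_cases hj : j = i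
        · subst hj; simpa using h
        · simpa [hj] using hx j hj
    by_cases ht : t ∈ ((↑) ⁻¹' C i : Set unitInterval)
    · rw [boxFun, Set.indicator_of_mem (e.2 ht), Set.indicator_of_mem ht]
    · rw [boxFun, Set.indicator_of_notMem (fun h => ht (e.1 h)), Set.indicator_of_notMem ht]
  · rw [Set.indicator_of_notMem (by exact hx)]
    push Not at hx
    obtain ⟨j, hji, hj⟩ := hx
    refine eVariationOn.constant_on ?_
    rintro _ ⟨t, -, rfl⟩ _ ⟨t', -, rfl⟩
    have h0 : ∀ t : unitInterval, boxFun C (Function.update x i t) = 0 := by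
      intro t
      refine Set.indicator_of_notMem (fun h => hj ?_) _
      have := h j trivial
      simpa [embed, hji] using this
    simp only [h0]

/-- The integral is at most 1/3, and a line meets a box in an interval, which gives at most two
jumps of 1/3. This is the reason for the factor 1/3 in `boxFun`. -/
lemma bvNorm_boxFun_le {C : Fin n → Set ℝ} (hC : ∀ i, (C i).OrdConnected) :
    bvNorm (boxFun C) ≤ 1 := by
  have hm : ∀ i, MeasurableSet (C i) := fun i => (hC i).measurableSet
  have h1 : ∫⁻ x, ‖boxFun C x‖ₑ ≤ ENNReal.ofReal 3⁻¹ := by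
    calc ∫⁻ x, ‖boxFun C x‖ₑ ≤ ∫⁻ _, ENNReal.ofReal 3⁻¹ := by
          refine lintegral_mono fun x => ?_
          rw [← ofReal_norm]
          refine ENNReal.ofReal_le_ofReal ?_
          by_cases hx : x ∈ embed ⁻¹' Set.univ.pi C
          · rw [boxFun, Set.indicator_of_mem hx]; norm_num
          · rw [boxFun, Set.indicator_of_notMem hx]; norm_num
      _ = _ := by simp
  have h2 : totalVariation (boxFun C) ≤ ENNReal.ofReal (2 * 3⁻¹) := by
    refine iSup_le fun i => ?_
    have hvar : ∀ x, lineVariation i (boxFun C) x ≤ ENNReal.ofReal (2 * 3⁻¹) := by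
      intro x
      rw [lineVariation_boxFun]
      refine (Set.indicator_le_self' (fun _ _ => bot_le) x).trans ?_
      exact eVariationOn_indicator_le
        ((hC i).preimage_mono (Subtype.mono_coe _)) (by norm_num)
    refine (iInf₂_le_of_le (boxFun C) (Eventually.of_forall fun _ => rfl) (iInf_le_of_le ?_ le_rfl)).trans ?_
    · have e : lineVariation i (boxFun C) = _ := funext (lineVariation_boxFun C i)
      rw [e]
      refine measurable_const.indicator ?_
      have : {x : Cube n | ∀ j, j ≠ i → (x j : ℝ) ∈ C j} =
          ⋂ j, ⋂ _ : j ≠ i, {x : Cube n | (x j : ℝ) ∈ C j} := by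
        ext; simp
      rw [this]
      exact MeasurableSet.iInter fun j => MeasurableSet.iInter fun _ =>
        (measurable_subtype_coe.comp (measurable_pi_apply j)) (hm j)
    · calc ∫⁻ x, lineVariation i (boxFun C) x ≤ ∫⁻ _ : Cube n, ENNReal.ofReal (2 * 3⁻¹) :=
            lintegral_mono hvar
        _ = _ := by simp
  calc bvNorm (boxFun C) ≤ ENNReal.ofReal 3⁻¹ + ENNReal.ofReal (2 * 3⁻¹) := add_le_add h1 h2
    _ = 1 := by rw [← ENNReal.ofReal_add (by norm_num) (by norm_num)]; norm_num

section

variable {S : Type} {f : Cube n → Cube n} {C : S → Fin n → Set ℝ}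
  {ψ ψ' : S → Fin n → ℝ → ℝ} {c : ℝ≥0}

lemma ProductBranches.apply_proj_update (h : ProductBranches (ambient f) C ψ ψ' c) {s : S}
    {x : Fin n → ℝ} (hx : x ∈ Set.univ.pi (C s)) (i : Fin n) {t : ℝ} (ht : t ∈ C s i) :
    f (proj (Function.update x i t)) =
      Function.update (f (proj x)) i (Set.projIcc 0 1 zero_le_one (ψ s i t)) := by
  have hx' : ∀ j, Function.update x i t j ∈ C s j := by
    intro j
    by_cases hj : j = i
    · subst hj; simpa using ht
    · simpa [hj] using hx j trivial
  rw [← proj_ambient f, h.apply_eq s _ hx', ← proj_ambient f,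
    h.apply_eq s x fun i => hx i trivial]
  funext j
  by_cases hj : j = i
  · subst hj; simp [proj]
  · simp [proj, hj]

/-- On almost every line in direction `i`, the version `g` composed with the branch is almost
everywhere the explicit reciprocal Jacobian, in which only the factor `u` varies. Its variation is
at least a constant times `∫ |D|`, and composition with the monotone branch cannot increase
variation. -/
lemma ProductBranches.le_lineVariation (h : ProductBranches (ambient f) C ψ ψ' c) (s : S)
    (hf : Measurable f) (hψ' : ∀ i, ContinuousOn (ψ' s i) (C s i)) (i : Fin n) {a b : ℝ}
    (hab : Set.Ioo a b ⊆ C s i) {u D : ℝ → ℝ} (hu : Measurable u)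
    (hu' : ∀ t ∈ Set.Ioo a b, u t = |ψ' s i t|⁻¹) (hD : ∀ t ∈ Set.Ioo a b, HasDerivAt u (D t) t)
    {g : Cube n → ℝ} (hg : g =ᵐ[volume] transfer f (boxFun (C s))) :
    ∀ᵐ x : Fin n → ℝ, x ∈ Set.univ.pi (C s) →
      ENNReal.ofReal (3⁻¹ * ∏ j ∈ Finset.univ.erase i, |ψ' s j (x j)|⁻¹) *
        ∫⁻ t in Set.Ioo a b, ‖D t‖ₑ ≤ lineVariation i g (f (proj x)) := by
  have h1 : ∀ᵐ x : Fin n → ℝ, x ∈ Set.univ.pi (C s) →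
      g (f (proj x)) = 3⁻¹ * ∏ i, |ψ' s i (x i)|⁻¹ := by
    filter_upwards [h.transfer_boxFun_apply s hf hψ', h.ae_comp s hg] with x hx1 hx2 hxC
    rw [hx2 hxC, hx1 hxC]
  filter_upwards [ae_ae_update h1 i] with x hx hxC
  set κ : ℝ := 3⁻¹ * ∏ j ∈ Finset.univ.erase i, |ψ' s j (x j)|⁻¹ with hκ
  have hκ0 : 0 ≤ κ := mul_nonneg (by norm_num) (Finset.prod_nonneg fun j _ => by positivity)
  have hG : ∀ᵐ t, t ∈ Set.Ioo a b → (fun t => g (Function.update (f (proj x)) i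
      (Set.projIcc 0 1 zero_le_one (ψ s i t)))) t = κ * u t := by
    filter_upwards [hx] with t ht htab
    have hxt : Function.update x i t ∈ Set.univ.pi (C s) := by
      intro j _
      by_cases hj : j = i
      · subst hj; simpa using hab htab
      · simpa [hj] using hxC j trivial
    have h2 := ht hxt
    rw [h.apply_proj_update hxC i (hab htab)] at h2
    change g _ = _
    rw [h2, ← Finset.mul_prod_erase _ _ (Finset.mem_univ i), hu' t htab, hκ]
    have h3 : ∏ j ∈ Finset.univ.erase i, |ψ' s j (Function.update x i t j)|⁻¹ =
        ∏ j ∈ Finset.univ.erase i, |ψ' s j (x j)|⁻¹ :=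
      Finset.prod_congr rfl fun j hj => by simp [Finset.ne_of_mem_erase hj]
    rw [h3, Function.update_self]
    ring
  have h4 := lintegral_enorm_deriv_le_eVariationOn (measurable_const.mul hu)
    (fun t ht => (hD t ht).const_mul κ) hG
  simp only [enorm_mul, Real.enorm_of_nonneg hκ0] at h4
  rw [lintegral_const_mul' _ _ ENNReal.ofReal_ne_top] at h4
  refine h4.trans ?_
  rw [lineVariation]
  rcases h.mono s i with hm | hm
  · exact eVariationOn.comp_le_of_monotoneOn
      (fun r : unitInterval => g (Function.update (f (proj x)) i r)) (t := Set.Ioo a b)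
      (fun t => Set.projIcc 0 1 zero_le_one (ψ s i t))
      (fun x hx y hy hxy => Set.monotone_projIcc _ (hm (hab hx) (hab hy) hxy))
      (fun _ _ => Set.mem_univ _)
  · exact eVariationOn.comp_le_of_antitoneOn
      (fun r : unitInterval => g (Function.update (f (proj x)) i r)) (t := Set.Ioo a b)
      (fun t => Set.projIcc 0 1 zero_le_one (ψ s i t))
      (fun x hx y hy hxy => Set.monotone_projIcc _ (hm (hab hx) (hab hy) hxy))
      (fun _ _ => Set.mem_univ _)

/-- The variation of the reciprocal of the derivative of a branch is controlled by the norm of the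
transfer operator. -/
theorem ProductBranches.volume_mul_lintegral_le (h : ProductBranches (ambient f) C ψ ψ' c) (s : S)
    (hf : Measurable f) (hψ' : ∀ i, ContinuousOn (ψ' s i) (C s i)) (i : Fin n) {a b : ℝ}
    (hab : Set.Ioo a b ⊆ C s i) {u D : ℝ → ℝ} (hu : Measurable u)
    (hu' : ∀ t ∈ Set.Ioo a b, u t = |ψ' s i t|⁻¹) (hD : ∀ t ∈ Set.Ioo a b, HasDerivAt u (D t) t) :
    volume (Set.univ.pi (C s)) * ∫⁻ t in Set.Ioo a b, ‖D t‖ₑ ≤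
      3 * c * bvOpNorm (transfer f) := by
  have hP : MeasurableSet (Set.univ.pi (C s)) := MeasurableSet.univ_pi (h.measurableSet s)
  set X := ∫⁻ t in Set.Ioo a b, ‖D t‖ₑ with hX
  have hop : dirVariation i (transfer f (boxFun (C s))) ≤ bvOpNorm (transfer f) := by
    refine le_trans ?_ (le_iSup_of_le (boxFun (C s)) (le_iSup₂_of_le
      (integrable_boxFun (h.measurableSet s)) (bvNorm_boxFun_le (h.ordConnected s)) le_rfl))
    exact (le_iSup (fun i => dirVariation i (transfer f (boxFun (C s)))) i).trans le_add_self
  refine le_trans ?_ (mul_le_mul' le_rfl hop)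
  rcases eq_or_ne c 0 with rfl | hc
  · have : Set.univ.pi (C s) = ∅ := Set.eq_empty_of_forall_notMem fun x hx => by
      have := h.expand s i _ (hx i trivial)
      norm_num at this
    simp [this]
  have h3c : (3 * c : ℝ≥0∞) ≠ 0 := by simpa using hc
  have h3c' : (3 * c : ℝ≥0∞) ≠ ∞ := ENNReal.mul_ne_top (by simp) ENNReal.coe_ne_top
  simp only [dirVariation, ENNReal.mul_iInf_of_ne h3c h3c']
  refine le_iInf fun g => le_iInf fun hg => le_iInf fun hgm => ?_
  have hinj : Set.InjOn (fun (x : Fin n → ℝ) i => ψ s i (x i)) (Set.univ.pi (C s)) :=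
    fun x hx y hy hxy => funext fun i => h.injOn s i (hx i trivial) (hy i trivial) (congrFun hxy i)
  have hΨm : Measurable fun (x : Fin n → ℝ) i => ψ s i (x i) :=
    measurable_pi_lambda _ fun i => (h.measurable s i).comp (measurable_pi_apply i)
  have hE : MeasurableSet ((fun (x : Fin n → ℝ) i => ψ s i (x i)) '' Set.univ.pi (C s)) :=
    hP.image_of_measurable_injOn hΨm hinj
  have hamb : ∀ x ∈ Set.univ.pi (C s), ambient f x = fun i => ψ s i (x i) := fun x hx =>
    h.apply_eq s x fun i => hx i trivial
  have hEU : (fun (x : Fin n → ℝ) i => ψ s i (x i)) '' Set.univ.pi (C s) ⊆ unitBox n := by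
    rintro _ ⟨x, hx, rfl⟩
    change (fun i => ψ s i (x i)) ∈ unitBox n
    rw [← hamb x hx]
    exact ambient_mem f x
  -- The Jacobian cancels the reciprocals in the directions other than `i` and leaves `|ψ_i'|`, at
  -- least `1 / c`; the 3 cancels the factor of `boxFun`.
  have hpt : ∀ x ∈ Set.univ.pi (C s), X ≤ 3 * c * (ENNReal.ofReal (∏ i, |ψ' s i (x i)|) *
      (ENNReal.ofReal (3⁻¹ * ∏ j ∈ Finset.univ.erase i, |ψ' s j (x j)|⁻¹) * X)) := by
    intro x hx
    have hne : ∀ j, |ψ' s j (x j)| ≠ 0 := fun j h0 => by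
      have := h.expand s j _ (hx j trivial)
      rw [h0, mul_zero] at this
      linarith
    have e : (3 * c : ℝ≥0∞) = ENNReal.ofReal (3 * c) := by
      rw [ENNReal.ofReal_mul (by norm_num), ENNReal.ofReal_coe_nnreal]; simp
    rw [e, ← mul_assoc, ← mul_assoc, ← ENNReal.ofReal_mul (by positivity),
      ← ENNReal.ofReal_mul (by positivity)]
    refine le_mul_of_one_le_left bot_le (ENNReal.one_le_ofReal.2 ?_)
    rw [← Finset.mul_prod_erase _ _ (Finset.mem_univ i), Finset.prod_inv_distrib]
    have hprod : ∏ j ∈ Finset.univ.erase i, |ψ' s j (x j)| ≠ 0 :=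
      Finset.prod_ne_zero_iff.2 fun j _ => hne j
    field_simp
    exact h.expand s i _ (hx i trivial)
  calc volume (Set.univ.pi (C s)) * X = ∫⁻ _ in Set.univ.pi (C s), X := by
        rw [setLIntegral_const, mul_comm]
    _ ≤ ∫⁻ x in Set.univ.pi (C s), 3 * c * (ENNReal.ofReal (∏ i, |ψ' s i (x i)|) *
          lineVariation i g (proj fun i => ψ s i (x i))) := by
        refine setLIntegral_mono_ae' hP ?_
        filter_upwards [h.le_lineVariation s hf hψ' i hab hu hu' hD hg] with x hx hxC
        refine (hpt x hxC).trans ?_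
        rw [← hamb x hxC, proj_ambient]
        exact mul_le_mul' le_rfl (mul_le_mul' le_rfl (hx hxC))
    _ = 3 * c * ∫⁻ y in (fun (x : Fin n → ℝ) i => ψ s i (x i)) '' Set.univ.pi (C s),
          lineVariation i g (proj y) := by
        rw [lintegral_const_mul' _ _ h3c', lintegral_image_prod (h.injOn s) (h.deriv s) hP subset_rfl]
    _ ≤ 3 * c * ∫⁻ y in unitBox n, lineVariation i g (proj y) :=
        mul_le_mul' le_rfl (lintegral_mono_set hEU)
    _ = 3 * c * ∫⁻ z, lineVariation i g z := by
        rw [measurePreserving_proj.lintegral_comp hgm]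

end

end Jablonski

namespace Jablonski

variable {n : ℕ}

/-! ### The branches of a random Jabłoński map -/

section C2

variable {p q : ℝ → ℝ} {a b : ℝ}

lemma seqDeriv_eq_derivWithin (hp : ContDiffOn ℝ 1 p (Set.Icc a b)) (hq : Set.EqOn q p (Set.Ioo a b))
    {t : ℝ} (ht : t ∈ Set.Ioo a b) : seqDeriv q t = derivWithin p (Set.Icc a b) t := by
  refine seqDeriv_eq ((ContDiffOn.hasDerivAt_Ioo hp ht).congr_of_eventuallyEq ?_)
  filter_upwards [Ioo_mem_nhds ht.1 ht.2] with x hx using hq hx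

lemma contDiffOn_inv_abs_derivWithin (hab : a < b) (hp : ContDiffOn ℝ 2 p (Set.Icc a b))
    (hne : ∀ t ∈ Set.Icc a b, derivWithin p (Set.Icc a b) t ≠ 0) :
    ContDiffOn ℝ 1 (fun t => |derivWithin p (Set.Icc a b) t|⁻¹) (Set.Icc a b) :=
  ((hp.derivWithin (uniqueDiffOn_Icc hab) (by norm_num)).abs hne).inv
    fun t ht => abs_ne_zero.2 (hne t ht)

end C2

/-- The `i`-th side of a rectangle of a partition, as a half-open interval. -/
def RectPartition.halfSide (G : RectPartition n) (s : Fin G.q) (i : Fin n) : Set ℝ :=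
  {t | t ∈ Set.Icc 0 1 ∧ G.lo s i ≤ t ∧ (t < G.hi s i ∨ G.hi s i = 1)}

namespace RectPartition

variable (G : RectPartition n) (s : Fin G.q) (i : Fin n)

lemma Ioo_subset_halfSide : Set.Ioo (G.lo s i) (G.hi s i) ⊆ G.halfSide s i := fun _ ht =>
  ⟨⟨(G.zero_le_lo s i).trans ht.1.le, ht.2.le.trans (G.hi_le_one s i)⟩, ht.1.le, Or.inl ht.2⟩

lemma halfSide_subset_side : G.halfSide s i ⊆ G.side s i := by
  rintro t ⟨h1, h2, h3⟩
  refine ⟨h2, ?_⟩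
  rcases h3 with h | h
  · exact h.le
  · rw [h]; exact h1.2

lemma lo_mem_halfSide : G.lo s i ∈ G.halfSide s i :=
  ⟨⟨G.zero_le_lo s i, (G.lo_lt_hi s i).le.trans (G.hi_le_one s i)⟩, le_rfl,
    Or.inl (G.lo_lt_hi s i)⟩

lemma ordConnected_halfSide : (G.halfSide s i).OrdConnected := by
  refine ⟨fun x hx y hy t ht => ⟨⟨hx.1.1.trans ht.1, ht.2.trans hy.1.2⟩, hx.2.1.trans ht.1, ?_⟩⟩
  exact hy.2.2.imp (fun h => ht.2.trans_lt h) id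

lemma proj_mem_box {x : Fin n → ℝ} {s : Fin G.q} (hx : ∀ i, x i ∈ G.halfSide s i) :
    proj x ∈ G.box s := fun i => by
  simp only [proj, Set.projIcc_of_mem _ (hx i).1]
  exact (hx i).2

lemma proj_mem_box_iff {x : Fin n → ℝ} (hx : ∀ i, x i ∈ Set.Icc (0 : ℝ) 1) {s : Fin G.q} :
    proj x ∈ G.box s ↔ ∀ i, x i ∈ G.halfSide s i := by
  refine ⟨fun h i => ⟨hx i, ?_⟩, G.proj_mem_box⟩
  have := h i
  simpa only [proj, Set.projIcc_of_mem _ (hx i)] using this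

end RectPartition

section Rep

variable {f : Cube n → Cube n} {G : RectPartition n} (φ : Rep f G)

/-- The component of a map on the `i`-th side of a rectangle, expressed by the map itself. -/
noncomputable def branch (f : Cube n → Cube n) (G : RectPartition n) (s : Fin G.q) (i : Fin n)
    (t : ℝ) : ℝ :=
  ambient f (Function.update (G.lo s) i t) i

lemma Rep.ambient_apply {x : Fin n → ℝ} {s : Fin G.q} (hx : ∀ i, x i ∈ G.halfSide s i) (i : Fin n) :
    ambient f x i = φ.comp s i (x i) := by
  have h := φ.apply_eq s (proj x) (G.proj_mem_box hx) i
  rw [ambient, embed, h]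
  simp [proj, Set.projIcc_of_mem _ (hx i).1]

/-- The components are given for each parameter separately. Here they are expressed by the map,
whose joint measurability in parameter and point is available. -/
lemma Rep.branch_eq {s : Fin G.q} {i : Fin n} {t : ℝ} (ht : t ∈ G.halfSide s i) :
    branch f G s i t = φ.comp s i t := by
  rw [branch, φ.ambient_apply (s := s)]
  · simp
  · intro j
    by_cases hj : j = i
    · subst hj; simpa using ht
    · simpa [hj] using G.lo_mem_halfSide s j

lemma Rep.expansion_le {s : Fin G.q} {i : Fin n} {t : ℝ} (ht : t ∈ G.side s i) :
    φ.expansion i ≤ |derivWithin (φ.comp s i) (G.side s i) t| :=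
  csInf_le ⟨0, by rintro _ ⟨j, t, -, rfl⟩; exact abs_nonneg _⟩ ⟨s, t, ht, rfl⟩

/-- The reciprocal of the least expansion of a map. -/
noncomputable def Rep.contraction : ℝ≥0 :=
  ⟨Real.exp (-⨅ i, Real.log (φ.expansion i)), (Real.exp_pos _).le⟩

lemma Rep.one_le_contraction_mul (hpos : ∀ i, 0 < φ.expansion i) {s : Fin G.q} {i : Fin n} {t : ℝ}
    (ht : t ∈ G.side s i) :
    1 ≤ (φ.contraction : ℝ) * |derivWithin (φ.comp s i) (G.side s i) t| := by
  have h1 : ⨅ i, Real.log (φ.expansion i) ≤ Real.log (φ.expansion i) :=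
    ciInf_le (Set.finite_range _).bddBelow i
  have h2 := φ.expansion_le ht
  have h3 : Real.exp (⨅ i, Real.log (φ.expansion i)) ≤ φ.expansion i := by
    rw [← Real.le_log_iff_exp_le (hpos i)]; exact h1
  change 1 ≤ Real.exp (-⨅ i, Real.log (φ.expansion i)) * _
  rw [Real.exp_neg, inv_mul_eq_div, le_div_iff₀ (Real.exp_pos _), one_mul]
  exact h3.trans h2

variable {φ}

lemma Rep.Regular.contDiffOn_one (hφ : φ.Regular) (s : Fin G.q) (i : Fin n) :
    ContDiffOn ℝ 1 (φ.comp s i) (G.side s i) := (hφ s i).1.of_le (by norm_num)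

lemma Rep.Regular.hasDerivWithinAt (hφ : φ.Regular) {s : Fin G.q} {i : Fin n} {t : ℝ}
    (ht : t ∈ G.side s i) : HasDerivWithinAt (φ.comp s i)
      (derivWithin (φ.comp s i) (G.side s i) t) (G.side s i) t :=
  ((hφ.contDiffOn_one s i).differentiableOn one_ne_zero t ht).hasDerivWithinAt

lemma Rep.Regular.injOn (hφ : φ.Regular) (hpos : ∀ i, 0 < φ.expansion i) (s : Fin G.q)
    (i : Fin n) : Set.InjOn (φ.comp s i) (G.side s i) := by
  intro x hx y hy hxy
  by_contra hne
  wlog hlt : x < y generalizing x y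
  · exact this hy hx hxy.symm (Ne.symm hne) (lt_of_le_of_ne (le_of_not_gt hlt) (Ne.symm hne))
  have hsub : Set.Icc x y ⊆ G.side s i := Set.Icc_subset_Icc hx.1 hy.2
  obtain ⟨t, ht, ht0⟩ := exists_hasDerivAt_eq_zero hlt
    ((hφ.contDiffOn_one s i).continuousOn.mono hsub) hxy
    (f' := fun t => derivWithin (φ.comp s i) (G.side s i) t) fun t ht =>
      ContDiffOn.hasDerivAt_Ioo (hφ.contDiffOn_one s i) ⟨hx.1.trans_lt ht.1, ht.2.trans_le hy.2⟩
  have := φ.one_le_contraction_mul hpos (hsub (Set.Ioo_subset_Icc_self ht))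
  rw [ht0] at this
  norm_num at this

lemma Rep.Regular.productBranches (hφ : φ.Regular) (hpos : ∀ i, 0 < φ.expansion i)
    (hf : Measurable f) :
    ProductBranches (ambient f) G.halfSide (branch f G)
      (fun s i => derivWithin (φ.comp s i) (G.side s i)) φ.contraction where
  measurable_map := measurable_ambient hf
  ordConnected := G.ordConnected_halfSide
  subset s i t ht := ht.1
  mapsTo s i t ht := ambient_mem f _ i trivial
  measurable s i := (measurable_pi_apply i).comp ((measurable_ambient hf).comp
    (measurable_update (G.lo s)))
  mono s i := by
    have e : Set.EqOn (φ.comp s i) (branch f G s i) (G.halfSide s i) := fun t ht =>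
      (φ.branch_eq ht).symm
    exact (hφ s i).2.imp (fun h => (h.mono (G.halfSide_subset_side s i)).congr e)
      fun h => (h.mono (G.halfSide_subset_side s i)).congr e
  injOn s i := ((hφ.injOn hpos s i).mono (G.halfSide_subset_side s i)).congr
    fun t ht => (φ.branch_eq ht).symm
  deriv s i t ht := ((hφ.hasDerivWithinAt (G.halfSide_subset_side s i ht)).mono
    (G.halfSide_subset_side s i)).congr (fun x hx => φ.branch_eq hx) (φ.branch_eq ht)
  expand s i t ht := φ.one_le_contraction_mul hpos (G.halfSide_subset_side s i ht)
  cover x hx := by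
    obtain ⟨s, hs, -⟩ := G.existsUnique_mem (proj x)
    exact ⟨s, (G.proj_mem_box_iff hx).1 hs⟩
  disj s t x hs ht :=
    (G.existsUnique_mem (proj x)).unique (G.proj_mem_box hs) (G.proj_mem_box ht)
  apply_eq s x hx := by
    funext i
    rw [φ.ambient_apply hx, φ.branch_eq (hx i)]

/-- The reciprocal of the derivative of a component, as a measurable limit. -/
noncomputable def branchInv (f : Cube n → Cube n) (G : RectPartition n) (s : Fin G.q) (i : Fin n)
    (t : ℝ) : ℝ := |seqDeriv (branch f G s i) t|⁻¹

/-- The derivative of `branchInv`, as a measurable limit. -/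
noncomputable def branchInvDeriv (f : Cube n → Cube n) (G : RectPartition n) (s : Fin G.q)
    (i : Fin n) (t : ℝ) : ℝ := seqDeriv (branchInv f G s i) t

lemma Rep.Regular.seqDeriv_branch (hφ : φ.Regular) (s : Fin G.q) (i : Fin n) :
    ∀ t ∈ Set.Ioo (G.lo s i) (G.hi s i), seqDeriv (branch f G s i) t =
      derivWithin (φ.comp s i) (Set.Icc (G.lo s i) (G.hi s i)) t := fun _ ht =>
  seqDeriv_eq_derivWithin (hφ.contDiffOn_one s i)
    (fun _ hx => φ.branch_eq (G.Ioo_subset_halfSide s i hx)) ht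

lemma Rep.Regular.contDiffOn_inv (hφ : φ.Regular) (hpos : ∀ i, 0 < φ.expansion i) (s : Fin G.q)
    (i : Fin n) : ContDiffOn ℝ 1
      (fun t => |derivWithin (φ.comp s i) (Set.Icc (G.lo s i) (G.hi s i)) t|⁻¹)
      (Set.Icc (G.lo s i) (G.hi s i)) :=
  contDiffOn_inv_abs_derivWithin (G.lo_lt_hi s i) (hφ s i).1 fun t ht h0 => by
    have := φ.expansion_le (s := s) (i := i) ht
    rw [RectPartition.side, h0, abs_zero] at this
    exact absurd (hpos i) (not_lt.2 this)

lemma Rep.Regular.branchInvDeriv_eq (hφ : φ.Regular) (hpos : ∀ i, 0 < φ.expansion i)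
    (s : Fin G.q) (i : Fin n) :
    ∀ t ∈ Set.Ioo (G.lo s i) (G.hi s i), branchInvDeriv f G s i t = derivWithin
      (fun t => |derivWithin (φ.comp s i) (Set.Icc (G.lo s i) (G.hi s i)) t|⁻¹)
      (Set.Icc (G.lo s i) (G.hi s i)) t := fun _ ht =>
  seqDeriv_eq_derivWithin (hφ.contDiffOn_inv hpos s i)
    (fun x hx => by simp only [branchInv, hφ.seqDeriv_branch s i x hx]) ht

/-- The total variation of the reciprocals of the derivatives of the components. -/
noncomputable def branchVariation (f : Cube n → Cube n) (G : RectPartition n) : ℝ≥0∞ :=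
  ∑ s, ∑ i, ∫⁻ t in Set.Ioo (G.lo s i) (G.hi s i), ‖branchInvDeriv f G s i t‖ₑ

lemma Rep.Regular.branchVariation_ne_top (hφ : φ.Regular) (hpos : ∀ i, 0 < φ.expansion i) :
    branchVariation f G ≠ ∞ :=
  ENNReal.sum_ne_top.2 fun s _ => ENNReal.sum_ne_top.2 fun i _ =>
    lintegral_enorm_ne_top (G.lo_lt_hi s i) (hφ.contDiffOn_inv hpos s i)
      (hφ.branchInvDeriv_eq hpos s i)

lemma Rep.Regular.hasVariation_map (hφ : φ.Regular) (hpos : ∀ i, 0 < φ.expansion i)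
    (hf : Measurable f) {ν : Measure (Fin n → ℝ)} {v : ℝ≥0∞} (hν : HasVariation ν v) :
    HasVariation (ν.map (ambient f)) (G.q * (3 * φ.contraction + branchVariation f G) * v) := by
  have h := (hφ.productBranches hpos hf).hasVariation_map_of_variation (X := branchVariation f G)
    (fun s i => ⟨(volume.restrict (Set.Ioo (G.lo s i) (G.hi s i))).withDensity
      fun t => ‖branchInvDeriv f G s i t‖ₑ, ?_, ?_, ?_⟩) hν
  · simpa using h
  · exact isFiniteMeasure_withDensity (lintegral_enorm_ne_top (G.lo_lt_hi s i)
      (hφ.contDiffOn_inv hpos s i) (hφ.branchInvDeriv_eq hpos s i))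
  · rw [withDensity_apply _ MeasurableSet.univ, Measure.restrict_univ]
    exact (Finset.single_le_sum (f := fun i => ∫⁻ t in Set.Ioo (G.lo s i) (G.hi s i),
      ‖branchInvDeriv f G s i t‖ₑ) (fun _ _ => bot_le) (Finset.mem_univ i)).trans
      (Finset.single_le_sum (f := fun s => ∑ i, ∫⁻ t in Set.Ioo (G.lo s i) (G.hi s i),
        ‖branchInvDeriv f G s i t‖ₑ) (fun _ _ => bot_le) (Finset.mem_univ s))
  · intro x hx y hy
    exact ofReal_abs_sub_le_lintegral (hφ.contDiffOn_inv hpos s i) (hφ.branchInvDeriv_eq hpos s i)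
      (G.halfSide_subset_side s i hx) (G.halfSide_subset_side s i hy)

lemma RectPartition.volume_halfSide_pos (s : Fin G.q) :
    0 < volume (Set.univ.pi (G.halfSide s)) := by
  refine lt_of_lt_of_le ?_ (measure_mono (Set.pi_mono fun i _ => G.Ioo_subset_halfSide s i))
  rw [volume_pi_pi, pos_iff_ne_zero, Finset.prod_ne_zero_iff]
  intro i _
  rw [Real.volume_Ioo]
  simpa using G.lo_lt_hi s i

/-- The transfer operator, tested on the indicator of a rectangle, detects the variation on its
sides up to division by the volume of that rectangle. This volume depends on `G` only, so for a
partition common to all parameters the constant is uniform. -/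
lemma Rep.Regular.branchVariation_le (hφ : φ.Regular) (hpos : ∀ i, 0 < φ.expansion i)
    (hf : Measurable f) (hm : ∀ s i, Measurable (branchInv f G s i)) :
    branchVariation f G ≤ (∑ s, ∑ _i : Fin n, 3 * (volume (Set.univ.pi (G.halfSide s)))⁻¹) *
      (φ.contraction * bvOpNorm (transfer f)) := by
  rw [Finset.sum_mul]
  refine Finset.sum_le_sum fun s _ => ?_
  rw [Finset.sum_mul]
  refine Finset.sum_le_sum fun i _ => ?_
  have h := (hφ.productBranches hpos hf).volume_mul_lintegral_le s hf
    (fun j => (((hφ.contDiffOn_one s j).continuousOn_derivWithin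
      (uniqueDiffOn_Icc (G.lo_lt_hi s j)) le_rfl).mono (G.halfSide_subset_side s j)))
    i (G.Ioo_subset_halfSide s i) (hm s i)
    (fun t ht => by simp only [branchInv, hφ.seqDeriv_branch s i t ht]; rfl)
    (D := branchInvDeriv f G s i) (fun t ht => by
      rw [hφ.branchInvDeriv_eq hpos s i t ht]
      refine (ContDiffOn.hasDerivAt_Ioo (hφ.contDiffOn_inv hpos s i) ht).congr_of_eventuallyEq ?_
      filter_upwards [Ioo_mem_nhds ht.1 ht.2] with x hx
      simp only [branchInv, hφ.seqDeriv_branch s i x hx])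
  have hv0 := (G.volume_halfSide_pos s).ne'
  have hvt : volume (Set.univ.pi (G.halfSide s)) ≠ ∞ := by
    refine ne_top_of_le_ne_top ?_
      (measure_mono ((hφ.productBranches hpos hf).pi_subset s))
    rw [unitBox, volume_pi_pi]; simp
  calc ∫⁻ t in Set.Ioo (G.lo s i) (G.hi s i), ‖branchInvDeriv f G s i t‖ₑ
      = (volume (Set.univ.pi (G.halfSide s)))⁻¹ * (volume (Set.univ.pi (G.halfSide s)) *
          ∫⁻ t in Set.Ioo (G.lo s i) (G.hi s i), ‖branchInvDeriv f G s i t‖ₑ) := by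
        rw [← mul_assoc, ENNReal.inv_mul_cancel hv0 hvt, one_mul]
    _ ≤ (volume (Set.univ.pi (G.halfSide s)))⁻¹ * (3 * φ.contraction * bvOpNorm (transfer f)) :=
        mul_le_mul' le_rfl h
    _ = _ := by ring

end Rep

end Jablonski

namespace Jablonski

variable {n : ℕ}

/-! ### The branches as a measurable family -/

lemma Rep.log_contraction {f : Cube n → Cube n} {G : RectPartition n} (φ : Rep f G) :
    Real.log (φ.contraction : ℝ) = -⨅ i, Real.log (φ.expansion i) :=
  Real.log_exp _

section Family

variable {Ω : Type*} [MeasurableSpace Ω] {P : Measure Ω} {f : Ω → Cube n → Cube n}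
  {G : RectPartition n} {φ : ∀ ω, Rep (f ω) G}

lemma measurable_branch (hf : Measurable fun p : Ω × Cube n => f p.1 p.2) (s : Fin G.q)
    (i : Fin n) : Measurable fun p : Ω × ℝ => branch (f p.1) G s i p.2 := by
  have h1 : Measurable fun p : Ω × ℝ => f p.1 (proj (Function.update (G.lo s) i p.2)) :=
    hf.comp (measurable_fst.prodMk (measurable_proj.comp
      ((measurable_update (G.lo s)).comp measurable_snd)))
  exact measurable_subtype_coe.comp ((measurable_pi_apply i).comp h1)

lemma measurable_branchInv (hf : Measurable fun p : Ω × Cube n => f p.1 p.2) (s : Fin G.q)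
    (i : Fin n) : Measurable fun p : Ω × ℝ => branchInv (f p.1) G s i p.2 :=
  (measurable_norm.comp (measurable_seqDeriv (measurable_branch hf s i))).inv

lemma measurable_branchInv_apply (hf : Measurable fun p : Ω × Cube n => f p.1 p.2) (ω : Ω)
    (s : Fin G.q) (i : Fin n) : Measurable (branchInv (f ω) G s i) := by
  have h : Measurable ((fun p : Ω × ℝ => branchInv (f p.1) G s i p.2) ∘ fun t : ℝ => (ω, t)) :=
    (measurable_branchInv hf s i).comp measurable_prodMk_left
  exact h

lemma measurable_branchInvDeriv (hf : Measurable fun p : Ω × Cube n => f p.1 p.2) (s : Fin G.q)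
    (i : Fin n) : Measurable fun p : Ω × ℝ => branchInvDeriv (f p.1) G s i p.2 :=
  measurable_seqDeriv (u := fun p : Ω × ℝ => branchInv (f p.1) G s i p.2)
    (measurable_branchInv hf s i)

lemma measurable_branchVariation (hf : Measurable fun p : Ω × Cube n => f p.1 p.2) :
    Measurable fun ω => branchVariation (f ω) G :=
  Finset.measurable_sum _ fun s _ => Finset.measurable_sum _ fun i _ =>
    (measurable_branchInvDeriv hf s i).enorm.lintegral_prod_right'

/-- The measurable family of the components of a random map. -/
noncomputable def branchFamily (hf : Measurable fun p : Ω × Cube n => f p.1 p.2)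
    (hreg : ∀ ω, (φ ω).Regular) (hpos : ∀ᵐ ω ∂P, ∀ i, 0 < (φ ω).expansion i)
    (hint : Integrable (fun ω => ⨅ i, Real.log ((φ ω).expansion i)) P) :
    BranchFamily P fun ω => ambient (f ω) where
  S := Fin G.q
  C _ := G.halfSide
  ψ ω := branch (f ω) G
  ψ' ω s i := derivWithin ((φ ω).comp s i) (G.side s i)
  c ω := (φ ω).contraction
  L ω := ∑ s, ∑ i, (ratSup (branchInvDeriv (f ω) G s i) (G.lo s i) (G.hi s i)).toNNReal
  Γ ω := ∑ s, ∑ i, (ratSup (seqDeriv (branch (f ω) G s i)) (G.lo s i) (G.hi s i)).toNNReal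
  branches := by
    filter_upwards [hpos] with ω hω
    exact (hreg ω).productBranches hω (hf.comp measurable_prodMk_left)
  lip_inv_deriv := by
    filter_upwards [hpos] with ω hω s i x hx y hy
    refine (abs_sub_le_ratSup (G.lo_lt_hi s i) ((hreg ω).contDiffOn_inv hω s i)
      ((hreg ω).branchInvDeriv_eq hω s i) (G.halfSide_subset_side s i hx)
      (G.halfSide_subset_side s i hy)).trans ?_
    refine mul_le_mul_of_nonneg_right (NNReal.coe_le_coe.2 ?_) (abs_nonneg _)
    exact (Finset.single_le_sum (f := fun i => (ratSup (branchInvDeriv (f ω) G s i) (G.lo s i)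
      (G.hi s i)).toNNReal) (fun _ _ => bot_le) (Finset.mem_univ i)).trans
      (Finset.single_le_sum (f := fun s => ∑ i, (ratSup (branchInvDeriv (f ω) G s i) (G.lo s i)
      (G.hi s i)).toNNReal) (fun _ _ => bot_le) (Finset.mem_univ s))
  lip := by
    filter_upwards with ω s i x hx y hy
    rw [(φ ω).branch_eq hx, (φ ω).branch_eq hy]
    refine (abs_sub_le_ratSup (G.lo_lt_hi s i) ((hreg ω).contDiffOn_one s i)
      ((hreg ω).seqDeriv_branch s i) (G.halfSide_subset_side s i hx)
      (G.halfSide_subset_side s i hy)).trans ?_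
    refine mul_le_mul_of_nonneg_right (NNReal.coe_le_coe.2 ?_) (abs_nonneg _)
    exact (Finset.single_le_sum (f := fun i => (ratSup (seqDeriv (branch (f ω) G s i)) (G.lo s i)
      (G.hi s i)).toNNReal) (fun _ _ => bot_le) (Finset.mem_univ i)).trans
      (Finset.single_le_sum (f := fun s => ∑ i, (ratSup (seqDeriv (branch (f ω) G s i)) (G.lo s i)
      (G.hi s i)).toNNReal) (fun _ _ => bot_le) (Finset.mem_univ s))
  measurable_C s i := measurable_snd (G.ordConnected_halfSide s i).measurableSet
  measurable_ψ := measurable_branch hf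
  aemeasurable_c := by
    have h := (Real.measurable_exp.comp_aemeasurable hint.aemeasurable.neg).real_toNNReal
    refine h.congr (Eventually.of_forall fun ω => ?_)
    apply NNReal.coe_injective
    exact Real.coe_toNNReal _ (Real.exp_pos _).le
  aemeasurable_L := (Finset.measurable_sum _ fun s _ => Finset.measurable_sum _ fun i _ =>
    (measurable_ratSup (measurable_branchInvDeriv hf s i) _ _).ennreal_toNNReal).aemeasurable
  aemeasurable_Γ := (Finset.measurable_sum _ fun s _ => Finset.measurable_sum _ fun i _ =>
    (measurable_ratSup (measurable_seqDeriv (measurable_branch hf s i)) _ _).ennreal_toNNReal).aemeasurable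

lemma toENNReal_log_max_one_le (T : ℝ≥0∞) :
    (ENNReal.log (max 1 T)).toENNReal ≤ (ENNReal.log T).toENNReal := by
  rcases le_total T 1 with h | h
  · rw [max_eq_left h, ENNReal.log_one, EReal.toENNReal_zero]
    exact bot_le
  · rw [max_eq_right h]

lemma toENNReal_log_mul_le (x y : ℝ≥0∞) : (ENNReal.log (x * y)).toENNReal ≤
    (ENNReal.log x).toENNReal + (ENNReal.log y).toENNReal := by
  rw [ENNReal.log_mul_add]
  exact EReal.toENNReal_add_le

lemma toENNReal_log_coe {x : ℝ≥0} (hx : x ≠ 0) :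
    (ENNReal.log x).toENNReal = ENNReal.ofReal (Real.log x) := by
  rw [ENNReal.log_of_nnreal hx]
  rfl

/-- Raising `c` and `T` to at least 1 separates them into factors, so that the logarithm of the
bound becomes a sum of positive parts. -/
lemma max_one_mul_add_le {q K c X T : ℝ≥0∞} (hX : X ≤ K * (c * T)) :
    max 1 (q * (3 * c + X)) ≤ max 1 c * (q * (3 + K) + 1) * max 1 T := by
  have h1 : 1 ≤ max 1 c := le_max_left _ _
  have h2 : 1 ≤ max 1 T := le_max_left _ _
  have h3 : c * T ≤ max 1 c * max 1 T := mul_le_mul' (le_max_right _ _) (le_max_right _ _)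
  have h4 : c ≤ max 1 c * max 1 T := by
    simpa using mul_le_mul' (le_max_right 1 c) h2
  refine max_le ?_ ?_
  · simpa using mul_le_mul' (mul_le_mul' h1 (le_add_self : 1 ≤ q * (3 + K) + 1)) h2
  · calc q * (3 * c + X) ≤ q * (3 * (max 1 c * max 1 T) + K * (max 1 c * max 1 T)) :=
          mul_le_mul' le_rfl (add_le_add (mul_le_mul' le_rfl h4) (hX.trans (mul_le_mul' le_rfl h3)))
      _ = max 1 c * (q * (3 + K)) * max 1 T := by ring
      _ ≤ _ := mul_le_mul' (mul_le_mul' le_rfl le_self_add) le_rfl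

/-- A coarse bound for the growth of the variation, with integrable logarithm. -/
lemma exists_integrable_growth [IsProbabilityMeasure P]
    (hf : Measurable fun p : Ω × Cube n => f p.1 p.2)
    (hreg : ∀ ω, (φ ω).Regular) (hpos : ∀ᵐ ω ∂P, ∀ i, 0 < (φ ω).expansion i)
    (hint : Integrable (fun ω => ⨅ i, Real.log ((φ ω).expansion i)) P)
    (hlog : ∫⁻ ω, (ENNReal.log (bvOpNorm (transfer (f ω)))).toENNReal ∂P < ⊤) :
    ∃ A : Ω → ℝ≥0, (∀ ω, 0 < A ω) ∧ Integrable (fun ω => Real.log (A ω)) P ∧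
      ∀ᵐ ω ∂P, ∀ (ν : Measure (Fin n → ℝ)) (v : ℝ≥0∞),
        HasVariation ν v → HasVariation (ν.map (ambient (f ω))) (A ω * v) := by
  have hcm : AEMeasurable (fun ω => (φ ω).contraction) P := (branchFamily hf hreg hpos hint).aemeasurable_c
  set c : Ω → ℝ≥0 := fun ω => (φ ω).contraction with hc
  have hcpos : ∀ ω, 0 < c ω := fun ω => Real.exp_pos _
  -- The maximum with 1 makes `log A` nonnegative, so integrability needs an upper bound only.
  set A : Ω → ℝ≥0 := fun ω => max 1 (G.q * (3 * c ω + (branchVariation (f ω) G).toNNReal)) with hA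
  have hAm : AEMeasurable A P := by
    refine aemeasurable_const.max (aemeasurable_const.mul ((aemeasurable_const.mul hcm).add ?_))
    exact (measurable_branchVariation hf).ennreal_toNNReal.aemeasurable
  set K : ℝ≥0∞ := ∑ s : Fin G.q, ∑ _i : Fin n, 3 * (volume (Set.univ.pi (G.halfSide s)))⁻¹ with hK
  have hKtop : K ≠ ∞ := ENNReal.sum_ne_top.2 fun s _ => ENNReal.sum_ne_top.2 fun i _ =>
    ENNReal.mul_ne_top (by simp) (ENNReal.inv_ne_top.2 (G.volume_halfSide_pos s).ne')
  obtain ⟨K₁, hK₁⟩ : ∃ K₁ : ℝ≥0, (K₁ : ℝ≥0∞) = G.q * (3 + K) + 1 :=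
    ⟨_, ENNReal.coe_toNNReal (ENNReal.add_ne_top.2 ⟨ENNReal.mul_ne_top (by simp)
      (ENNReal.add_ne_top.2 ⟨by simp, hKtop⟩), by simp⟩)⟩
  have hK₁0 : K₁ ≠ 0 := by
    rintro rfl
    exact one_ne_zero (add_eq_zero.1 hK₁.symm).2
  refine ⟨A, fun ω => lt_of_lt_of_le one_pos (le_max_left _ _), ?_, ?_⟩
  · have hlogA : ∀ ω, 0 ≤ Real.log (A ω) := fun ω =>
      Real.log_nonneg (by exact_mod_cast le_max_left _ _)
    refine ⟨(Real.measurable_log.comp_aemeasurable hAm.coe_nnreal_real).aestronglyMeasurable, ?_⟩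
    rw [hasFiniteIntegral_iff_ofReal (Eventually.of_forall hlogA)]
    have hbound : ∀ᵐ ω ∂P, ENNReal.ofReal (Real.log (A ω)) ≤
        (‖⨅ i, Real.log ((φ ω).expansion i)‖ₑ + ENNReal.ofReal (Real.log K₁)) +
          (ENNReal.log (bvOpNorm (transfer (f ω)))).toENNReal := by
      filter_upwards [hpos] with ω hω
      have hX := (hreg ω).branchVariation_le hω (hf.comp measurable_prodMk_left)
        fun s i => measurable_branchInv_apply hf ω s i
      have hle : (A ω : ℝ≥0∞) ≤ (max 1 (c ω : ℝ≥0∞) * K₁) * max 1 (bvOpNorm (transfer (f ω))) := by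
        have e : (A ω : ℝ≥0∞) = max 1 (G.q * (3 * c ω + branchVariation (f ω) G)) := by
          simp only [hA, ENNReal.coe_max, ENNReal.coe_one, ENNReal.coe_mul, ENNReal.coe_add,
            ENNReal.coe_natCast, ENNReal.coe_ofNat,
            ENNReal.coe_toNNReal ((hreg ω).branchVariation_ne_top hω)]
        rw [e, hK₁]
        exact max_one_mul_add_le hX
      have hA0 : A ω ≠ 0 := (lt_of_lt_of_le one_pos (le_max_left _ _)).ne'
      rw [← toENNReal_log_coe hA0]
      refine (EReal.toENNReal_le_toENNReal (ENNReal.log_le_log hle)).trans ?_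
      refine (toENNReal_log_mul_le _ _).trans (add_le_add ?_ (toENNReal_log_max_one_le _))
      refine (toENNReal_log_mul_le _ _).trans (add_le_add ?_ (toENNReal_log_coe hK₁0).le)
      refine (toENNReal_log_max_one_le _).trans ?_
      rw [toENNReal_log_coe (hcpos ω).ne', Rep.log_contraction, ← ofReal_norm, Real.norm_eq_abs]
      exact ENNReal.ofReal_le_ofReal (neg_le_abs _)
    refine (lintegral_mono_ae hbound).trans_lt ?_
    -- Splitting the integral uses measurability of the first summand only; none is needed for the
    -- operator norm.
    rw [lintegral_add_left' (f := fun ω => ‖⨅ i, Real.log ((φ ω).expansion i)‖ₑ +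
        ENNReal.ofReal (Real.log K₁)) (hint.aemeasurable.enorm.add aemeasurable_const),
      lintegral_add_left' hint.aemeasurable.enorm]
    refine ENNReal.add_lt_top.2 ⟨ENNReal.add_lt_top.2 ⟨hint.2, ?_⟩, hlog⟩
    simp
  · filter_upwards [hpos] with ω hω ν v hν
    have h := (hreg ω).hasVariation_map hω (hf.comp measurable_prodMk_left) hν
    refine h.mono (mul_le_mul' ?_ le_rfl)
    calc (G.q * (3 * (φ ω).contraction + branchVariation (f ω) G) : ℝ≥0∞)
        = ((G.q * (3 * c ω + (branchVariation (f ω) G).toNNReal) : ℝ≥0) : ℝ≥0∞) := by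
          simp only [ENNReal.coe_mul, ENNReal.coe_add, ENNReal.coe_natCast, ENNReal.coe_ofNat,
            ENNReal.coe_toNNReal ((hreg ω).branchVariation_ne_top hω), hc]
      _ ≤ A ω := ENNReal.coe_le_coe.2 (le_max_right _ _)

/-- Long compositions of random maps that are expanding on average contract the variation on
average. -/
theorem exists_contracting_block [IsProbabilityMeasure P] {σ : Ω → Ω}
    (hσ : MeasurePreserving σ P P) (hf : Measurable fun p : Ω × Cube n => f p.1 p.2)
    (hreg : ∀ ω, (φ ω).Regular) (hpos : ∀ᵐ ω ∂P, ∀ i, 0 < (φ ω).expansion i)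
    (hint : Integrable (fun ω => ⨅ i, Real.log ((φ ω).expansion i)) P)
    (hexp : 0 < ∫ ω, ⨅ i, Real.log ((φ ω).expansion i) ∂P)
    (hlog : ∫⁻ ω, (ENNReal.log (bvOpNorm (transfer (f ω)))).toENNReal ∂P < ⊤) :
    ∃ (N : ℕ) (B : ℝ≥0) (a : Ω → ℝ≥0), (∀ ω, 0 < a ω) ∧
      Integrable (fun ω => Real.log (a ω)) P ∧ ∫ ω, Real.log (a ω) ∂P < 0 ∧
      ∀ᵐ ω ∂P, ∀ (ν : Measure (Fin n → ℝ)) (v : ℝ≥0∞), HasVariation ν v →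
        HasVariation (ν.map (fiberIter σ (fun ω => ambient (f ω)) N ω))
          (a ω * v + B * ν Set.univ) := by
  obtain ⟨A, hA1, hA2, hA3⟩ := exists_integrable_growth hf hreg hpos hint hlog
  have e : (fun ω => Real.log ((branchFamily hf hreg hpos hint).c ω)) =
      fun ω => -⨅ i, Real.log ((φ ω).expansion i) := funext fun ω => (φ ω).log_contraction
  refine (branchFamily hf hreg hpos hint).exists_block hσ (fun ω => Real.exp_pos _) ?_ ?_ hA1 hA2 hA3
  · rw [e]; exact hint.neg
  · rw [e, integral_neg]; linarith

end Family

end Jablonski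

namespace Jablonski

variable {n : ℕ}

/-! ### Counting the rectangles that meet a box -/

/-- The open box with opposite corners `a` and `b`. -/
def obox (a b : Fin n → ℝ) : Set (Fin n → ℝ) := Set.univ.pi fun i => Set.Ioo (a i) (b i)

lemma isOpen_obox (a b : Fin n → ℝ) : IsOpen (obox a b) :=
  isOpen_set_pi Set.finite_univ fun _ _ => isOpen_Ioo

/-- The volume of the open box with opposite corners `a` and `b`. -/
def boxVol (a b : Fin n → ℝ) : ℝ := ∏ i, (b i - a i)

/-- The corners `a`, `b` span a nondegenerate box in the unit cube. -/
def IsBox (a b : Fin n → ℝ) : Prop := ∀ i, 0 ≤ a i ∧ a i < b i ∧ b i ≤ 1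

lemma IsBox.boxVol_pos {a b : Fin n → ℝ} (h : IsBox a b) : 0 < boxVol a b :=
  Finset.prod_pos fun i _ => sub_pos.2 (h i).2.1

lemma IsBox.boxVol_le_one {a b : Fin n → ℝ} (h : IsBox a b) : boxVol a b ≤ 1 :=
  Finset.prod_le_one (fun i _ => (sub_pos.2 (h i).2.1).le) fun i _ => by
    linarith [(h i).1, (h i).2.2]

lemma volume_obox (a b : Fin n → ℝ) (h : ∀ i, a i ≤ b i) :
    volume (obox a b) = ENNReal.ofReal (boxVol a b) := by
  rw [obox, volume_pi_pi, boxVol, ENNReal.ofReal_prod_of_nonneg fun i _ => sub_nonneg.2 (h i)]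
  simp only [Real.volume_Ioo]

lemma exists_mem_Ioo_notMem {a b : ℝ} (hab : a < b) {A : Set ℝ} (hA : A.Finite) :
    ∃ t ∈ Set.Ioo a b, t ∉ A := by
  by_contra! h
  exact (Set.Ioo_infinite hab) (hA.subset h)

namespace RectPartition

variable (Q : RectPartition n)

/-- The endpoints of the `i`-th sides of the rectangles. -/
def ends (i : Fin n) : Set ℝ :=
  Set.range (fun j => Q.lo j i) ∪ Set.range (fun j => Q.hi j i)

lemma finite_ends (i : Fin n) : (Q.ends i).Finite :=
  (Set.finite_range _).union (Set.finite_range _)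

variable {Q}

lemma mem_halfSide_of_mem_openBox {j : Fin Q.q} {x : Fin n → ℝ} (hx : x ∈ Q.openBox j) (i : Fin n) :
    x i ∈ Q.halfSide j i := Q.Ioo_subset_halfSide j i (hx i)

lemma eq_of_mem_halfSide {j k : Fin Q.q} {x : Fin n → ℝ} (hj : ∀ i, x i ∈ Q.halfSide j i)
    (hk : ∀ i, x i ∈ Q.halfSide k i) : j = k :=
  (Q.existsUnique_mem (proj x)).unique (Q.proj_mem_box hj) (Q.proj_mem_box hk)

lemma eq_of_mem_openBox {j k : Fin Q.q} {x : Fin n → ℝ} (hj : x ∈ Q.openBox j)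
    (hk : x ∈ Q.openBox k) : j = k :=
  eq_of_mem_halfSide (mem_halfSide_of_mem_openBox hj) (mem_halfSide_of_mem_openBox hk)

lemma exists_mem_openBox {x : Fin n → ℝ} (hx : ∀ i, x i ∈ Set.Icc (0 : ℝ) 1)
    (hgen : ∀ i, x i ∉ Q.ends i) : ∃ j, x ∈ Q.openBox j := by
  obtain ⟨j, hj, -⟩ := Q.existsUnique_mem (proj x)
  have h := (Q.proj_mem_box_iff hx).1 hj
  refine ⟨j, fun i => ⟨lt_of_le_of_ne (h i).2.1 fun e => hgen i (Or.inl ⟨j, e⟩), ?_⟩⟩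
  exact lt_of_le_of_ne (Q.halfSide_subset_side j i (h i)).2 fun e => hgen i (Or.inr ⟨j, e.symm⟩)

lemma finite_crossingPoints : Q.crossingPoints.Finite := by
  refine (Set.finite_range fun p : Fin Q.q × (Fin n → Bool) =>
    fun i => if p.2 i then Q.lo p.1 i else Q.hi p.1 i).subset ?_
  rintro v ⟨-, j, hv⟩
  classical
  refine ⟨(j, fun i => decide (v i = Q.lo j i)), funext fun i => ?_⟩
  by_cases h : v i = Q.lo j i
  · simp [h]
  · simp only [h, decide_false, Bool.false_eq_true, if_false]
    exact ((hv i).resolve_left h).symm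

lemma ncard_le_complexity (z : ℝ) (d : Fin n) :
    {j | ({x : Fin n → ℝ | x d = z} ∩ Q.openBox j).Nonempty}.ncard ≤ Q.complexity := by
  have hb : ∀ (z : ℝ) (d : Fin n),
      {j | ({x : Fin n → ℝ | x d = z} ∩ Q.openBox j).Nonempty}.ncard ≤ Q.q := fun z d => by
    have := Set.ncard_le_ncard (Set.subset_univ
      {j | ({x : Fin n → ℝ | x d = z} ∩ Q.openBox j).Nonempty}) Set.finite_univ
    simpa [Set.ncard_univ] using this
  have hne : Nonempty (Fin n) := ⟨d⟩
  have h1 : ∀ z : ℝ, BddAbove (Set.range fun d : Fin n =>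
      {j | ({x : Fin n → ℝ | x d = z} ∩ Q.openBox j).Nonempty}.ncard) := fun z =>
    ⟨Q.q, by rintro _ ⟨d, rfl⟩; exact hb z d⟩
  have h2 : BddAbove (Set.range fun z : ℝ => ⨆ d : Fin n,
      {j | ({x : Fin n → ℝ | x d = z} ∩ Q.openBox j).Nonempty}.ncard) :=
    ⟨Q.q, by rintro _ ⟨z, rfl⟩; exact ciSup_le fun d => hb z d⟩
  exact (le_ciSup (h1 z) d).trans (le_ciSup h2 z)

lemma nonempty_openBox (j : Fin Q.q) : (Q.openBox j).Nonempty :=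
  ⟨fun i => (Q.lo j i + Q.hi j i) / 2, fun i => by
    have := Q.lo_lt_hi j i
    constructor <;> linarith⟩

lemma one_le_complexity (hn : 1 ≤ n) : 1 ≤ Q.complexity := by
  obtain ⟨j, -, -⟩ := Q.existsUnique_mem (proj fun _ => 0)
  obtain ⟨x, hx⟩ := Q.nonempty_openBox j
  refine le_trans ?_ (Q.ncard_le_complexity (x ⟨0, hn⟩) ⟨0, hn⟩)
  rw [Nat.one_le_iff_ne_zero]
  exact Set.ncard_ne_zero_of_mem (a := j) ⟨x, rfl, hx⟩

/-- A crossing point is a vertex of some rectangle `j` and lies inside the cube, so there is room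
beyond `j` in direction `i₀`. Moving a point of `j` there reaches another rectangle while the
coordinate `i₁` stays fixed: both rectangles meet the same hyperplane. -/
lemma two_le_complexity (hn : 2 ≤ n) (hc : Q.crossingPoints.Nonempty) : 2 ≤ Q.complexity := by
  obtain ⟨v, hv, j, hvj⟩ := hc
  set i₀ : Fin n := ⟨0, by omega⟩
  set i₁ : Fin n := ⟨1, by omega⟩
  have hi : i₁ ≠ i₀ := by simp [i₀, i₁]
  choose p hp hpg using fun i => exists_mem_Ioo_notMem (Q.lo_lt_hi j i) (Q.finite_ends i)
  obtain ⟨t, ht01, htout, htg⟩ : ∃ t ∈ Set.Ioo (0 : ℝ) 1, (t < Q.lo j i₀ ∨ Q.hi j i₀ < t) ∧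
      t ∉ Q.ends i₀ := by
    rcases hvj i₀ with h | h
    · obtain ⟨t, ht, htg⟩ := exists_mem_Ioo_notMem (h ▸ (hv i₀).1) (Q.finite_ends i₀)
      exact ⟨t, ⟨ht.1, ht.2.trans (h ▸ (hv i₀).2)⟩, Or.inl ht.2, htg⟩
    · obtain ⟨t, ht, htg⟩ := exists_mem_Ioo_notMem (h ▸ (hv i₀).2) (Q.finite_ends i₀)
      exact ⟨t, ⟨lt_trans (h ▸ (hv i₀).1) ht.1, ht.2⟩, Or.inr ht.1, htg⟩
  obtain ⟨k, hk⟩ := Q.exists_mem_openBox (x := Function.update p i₀ t) (fun i => by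
      by_cases h : i = i₀
      · subst h; simpa using ⟨ht01.1.le, ht01.2.le⟩
      · simpa [h] using ⟨(Q.zero_le_lo j i).trans (hp i).1.le, (hp i).2.le.trans (Q.hi_le_one j i)⟩)
    (fun i => by
      by_cases h : i = i₀
      · subst h; simpa using htg
      · simpa [h] using hpg i)
  have hjk : j ≠ k := by
    rintro rfl
    have := hk i₀
    simp only [Function.update_self] at this
    rcases htout with h | h <;> linarith [this.1, this.2]
  refine le_trans ?_ (Q.ncard_le_complexity (p i₁) i₁)
  rw [← Set.ncard_pair hjk]
  refine Set.ncard_le_ncard ?_ (Set.toFinite _)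
  rintro l (rfl | rfl)
  · exact ⟨p, rfl, hp⟩
  · exact ⟨Function.update p i₀ t, by simp [hi], hk⟩

/-- The rectangles that meet the open box with corners `a`, `b`. -/
def meeting (Q : RectPartition n) (a b : Fin n → ℝ) : Set (Fin Q.q) :=
  {j | (Q.openBox j ∩ obox a b).Nonempty}

/-- A rectangle is determined by a vertex together with the choice of lower or upper end in each
direction, because two rectangles with the same such corner overlap. So a point is a vertex of at
most `2 ^ n` rectangles. -/
lemma ncard_vertex_le (a b : Fin n → ℝ) (hab : IsBox a b) :
    {j : Fin Q.q | ∃ v ∈ obox a b, ∀ i, v i = Q.lo j i ∨ v i = Q.hi j i}.ncard ≤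
      2 ^ n * (Q.crossingPoints ∩ obox a b).ncard := by
  classical
  have hfin : (Q.crossingPoints ∩ obox a b).Finite := Q.finite_crossingPoints.inter_of_left _
  set A := {j : Fin Q.q | ∃ v ∈ obox a b, ∀ i, v i = Q.lo j i ∨ v i = Q.hi j i} with hA
  have hex : ∀ j : Fin Q.q, ∃ p : (Fin n → Bool) × (Fin n → ℝ), j ∈ A → p.2 ∈ obox a b ∧
      ∀ i, p.2 i = if p.1 i then Q.lo j i else Q.hi j i := by
    intro j
    by_cases hj : j ∈ A
    · obtain ⟨v, hv, hvj⟩ := hj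
      refine ⟨(fun i => decide (v i = Q.lo j i), v), fun _ => ⟨hv, fun i => ?_⟩⟩
      by_cases h : v i = Q.lo j i
      · simp [h]
      · simp only [h, decide_false, Bool.false_eq_true, if_false]
        exact (hvj i).resolve_left h
    · exact ⟨(fun _ => true, 0), fun h => absurd h hj⟩
  choose p hp using hex
  have hmaps : ∀ j ∈ A, p j ∈ (Set.univ : Set (Fin n → Bool)) ×ˢ (Q.crossingPoints ∩ obox a b) := by
    intro j hj
    obtain ⟨h1, h2⟩ := hp j hj
    refine ⟨trivial, ⟨fun i => ⟨(hab i).1.trans_lt (h1 i trivial).1,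
      (h1 i trivial).2.trans_le (hab i).2.2⟩, j, fun i => ?_⟩, h1⟩
    have := h2 i
    split_ifs at this
    · exact Or.inl this
    · exact Or.inr this
  have hinj : Set.InjOn p A := by
    intro j hj k hk hjk
    have h1 := (hp j hj).2
    have h2 := (hp k hk).2
    rw [← hjk] at h2
    refine eq_of_mem_openBox (x := fun i => if (p j).1 i then
      (Q.lo j i + min (Q.hi j i) (Q.hi k i)) / 2 else (Q.hi j i + max (Q.lo j i) (Q.lo k i)) / 2)
      (fun i => ?_) (fun i => ?_)
    all_goals
      have e1 := h1 i
      have e2 := h2 i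
      have l1 := Q.lo_lt_hi j i
      have l2 := Q.lo_lt_hi k i
      rw [e1] at e2
      simp only
      split_ifs at e2 ⊢
      · rcases min_cases (Q.hi j i) (Q.hi k i) with ⟨h, _⟩ | ⟨h, _⟩ <;> rw [h] <;>
          constructor <;> linarith
      · rcases max_cases (Q.lo j i) (Q.lo k i) with ⟨h, _⟩ | ⟨h, _⟩ <;> rw [h] <;>
          constructor <;> linarith
  have h := Set.ncard_le_ncard_of_injOn p hmaps hinj (Set.finite_univ.prod hfin)
  rw [Set.ncard_prod, Set.ncard_univ] at h
  simpa using h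

/-- If in every direction some end of the rectangle lies strictly within the box, these ends form a
vertex in the box. Otherwise, in some direction the rectangle spans the box and therefore crosses
its middle hyperplane. -/
lemma ncard_meeting_le_add (a b : Fin n → ℝ) (hab : IsBox a b) : (Q.meeting a b).ncard ≤
    n * Q.complexity + 2 ^ n * (Q.crossingPoints ∩ obox a b).ncard := by
  have hsub : Q.meeting a b ⊆
      (⋃ i : Fin n, {j | ({x : Fin n → ℝ | x i = (a i + b i) / 2} ∩ Q.openBox j).Nonempty}) ∪
      {j : Fin Q.q | ∃ v ∈ obox a b, ∀ i, v i = Q.lo j i ∨ v i = Q.hi j i} := by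
    rintro j ⟨x, hxj, hxJ⟩
    by_cases h : ∀ i, ∃ w ∈ Set.Ioo (a i) (b i), w = Q.lo j i ∨ w = Q.hi j i
    · choose v hv hvj using h
      exact Or.inr ⟨v, fun i _ => hv i, hvj⟩
    · push Not at h
      obtain ⟨i, hi⟩ := h
      refine Or.inl (Set.mem_iUnion.2 ⟨i, Function.update x i ((a i + b i) / 2), by simp, fun k => ?_⟩)
      by_cases hk : k = i
      · subst hk
        simp only [Function.update_self]
        have h1 := (hxJ k trivial).1
        have h2 := (hxJ k trivial).2
        have h3 := (hxj k).1
        have h4 := (hxj k).2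
        have h5 : Q.lo j k ≤ a k := by
          by_contra! hlt
          exact (hi _ ⟨hlt, h3.trans h2⟩).1 rfl
        have h6 : b k ≤ Q.hi j k := by
          by_contra! hlt
          exact (hi _ ⟨h1.trans h4, hlt⟩).2 rfl
        constructor <;> linarith
      · simpa [hk] using hxj k
  refine (Set.ncard_le_ncard hsub (Set.toFinite _)).trans ((Set.ncard_union_le _ _).trans
    (add_le_add ?_ (ncard_vertex_le a b hab)))
  refine (Set.ncard_iUnion_le_of_fintype _).trans ?_
  calc _ ≤ ∑ _i : Fin n, Q.complexity := Finset.sum_le_sum fun i _ => Q.ncard_le_complexity _ i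
    _ = n * Q.complexity := by simp

/-- In dimension one a hyperplane is a point and the complexity is 1, so the constant 2 of the
general count cannot be absorbed. Here the intervals are counted by their right ends: all but one of
them end inside the box. -/
lemma ncard_meeting_le_of_one (hn : n = 1) (a b : Fin n → ℝ) (hab : IsBox a b) :
    (Q.meeting a b).ncard ≤ (Q.crossingPoints ∩ obox a b).ncard + 1 := by
  have hfin : (Q.crossingPoints ∩ obox a b).Finite := Q.finite_crossingPoints.inter_of_left _
  set i₀ : Fin n := ⟨0, by omega⟩
  have hall : ∀ i, i = i₀ := fun i => Fin.ext (by have := i.2; simp only [i₀]; omega)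
  have h1 : {j ∈ Q.meeting a b | Q.hi j i₀ < b i₀}.ncard ≤
      (Q.crossingPoints ∩ obox a b).ncard := by
    refine Set.ncard_le_ncard_of_injOn (fun j => Q.hi j) ?_ ?_ hfin
    · rintro j ⟨⟨x, hxj, hxJ⟩, hj⟩
      have hv : ∀ i, Q.hi j i ∈ Set.Ioo (a i) (b i) := fun i => by
        rw [hall i]; exact ⟨(hxJ i₀ trivial).1.trans (hxj i₀).2, hj⟩
      exact ⟨⟨fun i => ⟨(hab i).1.trans_lt (hv i).1, (hv i).2.trans_le (hab i).2.2⟩, j,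
        fun i => Or.inr rfl⟩, fun i _ => hv i⟩
    · intro j _ k _ hjk
      refine eq_of_mem_openBox (x := fun i => (Q.hi j i + max (Q.lo j i) (Q.lo k i)) / 2)
        (fun i => ?_) (fun i => ?_)
      all_goals
        have e := congrFun hjk i
        have l1 := Q.lo_lt_hi j i
        have l2 := Q.lo_lt_hi k i
        simp only at e ⊢
        rcases max_cases (Q.lo j i) (Q.lo k i) with ⟨h, _⟩ | ⟨h, _⟩ <;> rw [h] <;>
          constructor <;> linarith
  have h2 : {j ∈ Q.meeting a b | ¬ Q.hi j i₀ < b i₀}.ncard ≤ 1 := by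
    rw [Set.ncard_le_one (Set.toFinite _)]
    rintro j ⟨⟨x, hxj, hxJ⟩, hj⟩ k ⟨⟨y, hyk, hyJ⟩, hk⟩
    refine eq_of_mem_openBox (x := fun i => (b i + max (Q.lo j i) (Q.lo k i)) / 2)
      (fun i => ?_) (fun i => ?_)
    all_goals
      rw [hall i]
      have l1 := (hxj i₀).1
      have l2 := (hxJ i₀ trivial).2
      have l3 := (hyk i₀).1
      have l4 := (hyJ i₀ trivial).2
      simp only
      rcases max_cases (Q.lo j i₀) (Q.lo k i₀) with ⟨h, _⟩ | ⟨h, _⟩ <;> rw [h] <;>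
        constructor <;> linarith
  have e : Q.meeting a b = {j ∈ Q.meeting a b | Q.hi j i₀ < b i₀} ∪
      {j ∈ Q.meeting a b | ¬ Q.hi j i₀ < b i₀} := by
    ext j
    simp only [Set.mem_union, Set.mem_ofPred_eq, ← and_or_left, em, and_true]
  rw [e]
  exact (Set.ncard_union_le _ _).trans (add_le_add h1 h2)

/-- The number of rectangles that meet a box, in terms of the crossing points in the box. -/
theorem ncard_meeting_le (hn : 1 ≤ n) (a b : Fin n → ℝ) (hab : IsBox a b) :
    (Q.meeting a b).ncard ≤
      Q.complexity * (2 ^ (n - 1) * ((Q.crossingPoints ∩ obox a b).ncard + 1)) := by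
  have hM := Q.one_le_complexity hn
  rcases hn.eq_or_lt with h1 | h2
  · refine (ncard_meeting_le_of_one h1.symm a b hab).trans ?_
    have e : 2 ^ (n - 1) = 1 := by rw [← h1, Nat.sub_self, pow_zero]
    rw [e, one_mul]
    exact Nat.le_mul_of_pos_left _ hM
  · refine (ncard_meeting_le_add a b hab).trans ?_
    obtain ⟨m, rfl⟩ : ∃ m, n = m + 1 := ⟨n - 1, by omega⟩
    rw [Nat.add_sub_cancel]
    -- The hyperplane term is absorbed by `n ≤ 2 ^ (n - 1)`. The vertex term carries one factor 2
    -- too many; a crossing point forces the complexity to be at least 2, which pays for it.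
    have hm : m + 1 ≤ 2 ^ m := Nat.lt_two_pow_self
    rcases Nat.eq_zero_or_pos (Q.crossingPoints ∩ obox a b).ncard with h0 | h0
    · rw [h0]; simp only [mul_zero, add_zero, zero_add, mul_one]
      rw [mul_comm]
      exact Nat.mul_le_mul_left _ hm
    · have hne : Q.crossingPoints.Nonempty :=
        (Set.nonempty_of_ncard_ne_zero h0.ne').mono Set.inter_subset_left
      have hM2 := Q.two_le_complexity h2 hne
      set c := (Q.crossingPoints ∩ obox a b).ncard
      calc (m + 1) * Q.complexity + 2 ^ (m + 1) * c
          ≤ 2 ^ m * Q.complexity + 2 ^ m * (Q.complexity * c) := by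
            rw [pow_succ, mul_assoc]
            gcongr
        _ = _ := by ring

end RectPartition

end Jablonski

namespace Jablonski

variable {n : ℕ}

/-! ### The image of a box contains a box of controlled volume -/

lemma obox_inter_openBox {Q : RectPartition n} (j : Fin Q.q) (a b : Fin n → ℝ) :
    Q.openBox j ∩ obox a b =
      obox (fun i => max (a i) (Q.lo j i)) (fun i => min (b i) (Q.hi j i)) := by
  ext x
  simp only [RectPartition.openBox, obox, Set.mem_inter_iff, Set.mem_ofPred_eq, Set.mem_pi,
    Set.mem_univ, true_imp_iff, Set.mem_Ioo, max_lt_iff, lt_min_iff]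
  constructor
  · rintro ⟨h1, h2⟩ i
    exact ⟨⟨(h2 i).1, (h1 i).1⟩, (h2 i).2, (h1 i).2⟩
  · intro h
    exact ⟨fun i => ⟨(h i).1.2, (h i).2.2⟩, fun i => ⟨(h i).1.1, (h i).2.1⟩⟩

lemma ae_notMem_ends (Q : RectPartition n) : ∀ᵐ x : Fin n → ℝ, ∀ i, x i ∉ Q.ends i := by
  rw [ae_all_iff]
  intro i
  have h : (volume : Measure ℝ) (Q.ends i) = 0 := (Q.finite_ends i).measure_zero _
  exact (Measure.quasiMeasurePreserving_eval (fun _ : Fin n => (volume : Measure ℝ)) i).ae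
    (measure_eq_zero_iff_ae_notMem.1 h)

/-- Some rectangle contains a definite part of a box. -/
lemma exists_large_piece (Q : RectPartition n) (a b : Fin n → ℝ) (hab : IsBox a b) :
    ∃ (j : Fin Q.q) (a' b' : Fin n → ℝ), IsBox a' b' ∧ obox a' b' ⊆ obox a b ∧
      (∀ i, Q.lo j i ≤ a' i ∧ b' i ≤ Q.hi j i) ∧
      boxVol a b ≤ (Q.meeting a b).ncard * boxVol a' b' := by
  classical
  have hfin : (Q.meeting a b).Finite := Set.toFinite _
  set A := hfin.toFinset with hA
  set a' : Fin Q.q → Fin n → ℝ := fun j i => max (a i) (Q.lo j i) with ha'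
  set b' : Fin Q.q → Fin n → ℝ := fun j i => min (b i) (Q.hi j i) with hb'
  have hbox : ∀ j ∈ A, IsBox (a' j) (b' j) := by
    intro j hj
    obtain ⟨x, hx⟩ : (Q.openBox j ∩ obox a b).Nonempty := hfin.mem_toFinset.1 hj
    rw [obox_inter_openBox] at hx
    exact fun i => ⟨(hab i).1.trans (le_max_left _ _), (hx i trivial).1.trans (hx i trivial).2,
      (min_le_left _ _).trans (hab i).2.2⟩
  have hcov : volume (obox a b) ≤ ∑ j ∈ A, volume (obox (a' j) (b' j)) := by
    have h1 : volume (obox a b) ≤ volume (⋃ j ∈ A, obox (a' j) (b' j)) := by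
      refine measure_mono_ae ?_
      filter_upwards [ae_notMem_ends Q] with x hx hxJ
      obtain ⟨j, hj⟩ := Q.exists_mem_openBox (fun i => ⟨(hab i).1.trans (hxJ i trivial).1.le,
        (hxJ i trivial).2.le.trans (hab i).2.2⟩) hx
      refine Set.mem_iUnion₂.2 ⟨j, hfin.mem_toFinset.2 ⟨x, hj, hxJ⟩, ?_⟩
      rw [ha', hb', ← obox_inter_openBox]
      exact ⟨hj, hxJ⟩
    exact h1.trans (measure_biUnion_finset_le _ _)
  have hcov' : boxVol a b ≤ ∑ j ∈ A, boxVol (a' j) (b' j) := by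
    rw [volume_obox a b fun i => (hab i).2.1.le, Finset.sum_congr rfl fun j hj =>
      volume_obox (a' j) (b' j) fun i => (hbox j hj i).2.1.le,
      ← ENNReal.ofReal_sum_of_nonneg fun j hj => (hbox j hj).boxVol_pos.le] at hcov
    exact (ENNReal.ofReal_le_ofReal_iff
      (Finset.sum_nonneg fun j hj => (hbox j hj).boxVol_pos.le)).1 hcov
  have hne : A.Nonempty := by
    rw [Finset.nonempty_iff_ne_empty]
    intro h0
    rw [h0, Finset.sum_empty] at hcov'
    exact absurd hab.boxVol_pos (not_lt.2 hcov')
  -- The largest piece has at least the average volume.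
  obtain ⟨j, hj, hmax⟩ := A.exists_max_image (fun j => boxVol (a' j) (b' j)) hne
  refine ⟨j, a' j, b' j, hbox j hj, ?_, fun i => ⟨le_max_right _ _, min_le_right _ _⟩, ?_⟩
  · rw [ha', hb', ← obox_inter_openBox]
    exact Set.inter_subset_right
  · refine hcov'.trans ((Finset.sum_le_card_nsmul _ _ _ hmax).trans (le_of_eq ?_))
    rw [nsmul_eq_mul, Set.ncard_eq_toFinset_card _ hfin]

section Image

variable {f : Cube n → Cube n} {Q G : RectPartition n} {ρ : Rep f Q} {φ : Rep f G}

/-- The derivatives of the components do not depend on the partition. -/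
lemma Rep.Regular.expansion_le_abs_derivWithin (hρ : ρ.Regular) (hφ : φ.Regular) {j : Fin Q.q}
    {i : Fin n} {t : ℝ} (ht : t ∈ Set.Ioo (Q.lo j i) (Q.hi j i)) (hG : t ∉ G.ends i) :
    φ.expansion i ≤ |derivWithin (ρ.comp j i) (Set.Icc (Q.lo j i) (Q.hi j i)) t| := by
  choose p hp hpg using fun k => exists_mem_Ioo_notMem (Q.lo_lt_hi j k) (G.finite_ends k)
  set x := Function.update p i t with hx
  have hxQ : ∀ k, x k ∈ Set.Ioo (Q.lo j k) (Q.hi j k) := fun k => by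
    by_cases hk : k = i
    · subst hk; simpa [hx] using ht
    · simpa [hx, hk] using hp k
  have hxg : ∀ k, x k ∉ G.ends k := fun k => by
    by_cases hk : k = i
    · subst hk; simpa [hx] using hG
    · simpa [hx, hk] using hpg k
  obtain ⟨s, hs⟩ := G.exists_mem_openBox (x := x) (fun k => (Q.Ioo_subset_halfSide j k (hxQ k)).1) hxg
  have hts : t ∈ Set.Ioo (G.lo s i) (G.hi s i) := by simpa [hx] using hs i
  have heq : ρ.comp j i =ᶠ[𝓝 t] φ.comp s i := by
    filter_upwards [Ioo_mem_nhds ht.1 ht.2, Ioo_mem_nhds hts.1 hts.2] with u hu hus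
    have h1 := ρ.ambient_apply (x := Function.update x i u) (s := j) (fun k => by
      by_cases hk : k = i
      · subst hk; simpa using Q.Ioo_subset_halfSide j k hu
      · simpa [hk] using Q.Ioo_subset_halfSide j k (hxQ k)) i
    have h2 := φ.ambient_apply (x := Function.update x i u) (s := s) (fun k => by
      by_cases hk : k = i
      · subst hk; simpa using G.Ioo_subset_halfSide s k hus
      · simpa [hk] using G.Ioo_subset_halfSide s k (hs k)) i
    rw [Function.update_self] at h1 h2
    rw [← h1, h2]
  have hd1 := ContDiffOn.hasDerivAt_Ioo (hρ.contDiffOn_one j i) ht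
  have hd2 := ContDiffOn.hasDerivAt_Ioo (hφ.contDiffOn_one s i) hts
  rw [hd1.unique (hd2.congr_of_eventuallyEq heq)]
  exact φ.expansion_le (Set.Ioo_subset_Icc_self hts)

/-- The ends of the common partition are finitely many, and the derivative is continuous across
them. -/
lemma Rep.Regular.expansion_le_abs_derivWithin_Ioo (hρ : ρ.Regular) (hφ : φ.Regular) {j : Fin Q.q}
    {i : Fin n} {t : ℝ} (ht : t ∈ Set.Ioo (Q.lo j i) (Q.hi j i)) :
    φ.expansion i ≤ |derivWithin (ρ.comp j i) (Set.Icc (Q.lo j i) (Q.hi j i)) t| := by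
  have hc := (hρ.contDiffOn_one j i).continuousOn_derivWithin (uniqueDiffOn_Icc (Q.lo_lt_hi j i)) le_rfl
  have hc' : ContinuousAt (fun u => |derivWithin (ρ.comp j i) (Set.Icc (Q.lo j i) (Q.hi j i)) u|) t :=
    (hc.continuousAt (Icc_mem_nhds ht.1 ht.2)).abs
  have hd : Dense (G.ends i)ᶜ := (G.finite_ends i).countable.dense_compl ℝ
  have hne : (𝓝[(G.ends i)ᶜ] t).NeBot := mem_closure_iff_nhdsWithin_neBot.1 (hd t)
  have htend : Tendsto (fun u => |derivWithin (ρ.comp j i) (Set.Icc (Q.lo j i) (Q.hi j i)) u|)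
      (𝓝[(G.ends i)ᶜ] t) (𝓝 |derivWithin (ρ.comp j i) (Set.Icc (Q.lo j i) (Q.hi j i)) t|) :=
    hc'.tendsto.mono_left nhdsWithin_le_nhds
  refine ge_of_tendsto htend ?_
  filter_upwards [self_mem_nhdsWithin, nhdsWithin_le_nhds (Ioo_mem_nhds ht.1 ht.2)] with u hu hu2
  exact hρ.expansion_le_abs_derivWithin hφ hu2 hu

lemma Rep.Regular.expansion_mul_le (hρ : ρ.Regular) (hφ : φ.Regular) {j : Fin Q.q}
    {i : Fin n} {x y : ℝ} (hx : Q.lo j i ≤ x) (hxy : x < y) (hy : y ≤ Q.hi j i) :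
    φ.expansion i * (y - x) ≤ |ρ.comp j i y - ρ.comp j i x| := by
  have hsub : Set.Icc x y ⊆ Set.Icc (Q.lo j i) (Q.hi j i) := Set.Icc_subset_Icc hx hy
  obtain ⟨t, ht, hte⟩ := exists_hasDerivAt_eq_slope (ρ.comp j i)
    (fun t => derivWithin (ρ.comp j i) (Set.Icc (Q.lo j i) (Q.hi j i)) t) hxy
    ((hρ.contDiffOn_one j i).continuousOn.mono hsub) fun t ht =>
      ContDiffOn.hasDerivAt_Ioo (hρ.contDiffOn_one j i) ⟨hx.trans_lt ht.1, ht.2.trans_le hy⟩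
  have h := hρ.expansion_le_abs_derivWithin_Ioo hφ (j := j) (i := i)
    ⟨hx.trans_lt ht.1, ht.2.trans_le hy⟩
  have hpos : 0 < y - x := sub_pos.2 hxy
  rw [hte, abs_div, abs_of_pos hpos, le_div_iff₀ hpos] at h
  exact h

/-- The image of a box in the support of a measure contains a box in the support of the image
measure, of controlled volume. -/
theorem Rep.Regular.exists_image_box (hn : 1 ≤ n) (hρ : ρ.Regular) (hφ : φ.Regular)
    (hpos : ∀ i, 0 < φ.expansion i) {S S' : Set (Fin n → ℝ)}
    (hS : volume (S ∩ ambient f ⁻¹' S'ᶜ) = 0) {a b : Fin n → ℝ} (hab : IsBox a b)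
    (habS : volume (obox a b \ S) = 0) :
    ∃ a' b', IsBox a' b' ∧ volume (obox a' b' \ S') = 0 ∧
      (∏ i, φ.expansion i) * boxVol a b ≤
        Q.complexity * (2 ^ (n - 1) * ((Q.crossingPoints ∩ obox a b).ncard + 1)) *
          boxVol a' b' := by
  obtain ⟨j, u, v, huv, hsub, hj, hvol⟩ := exists_large_piece Q a b hab
  set ψ : Fin n → ℝ → ℝ := fun i => ρ.comp j i with hψ
  have hlohi : ∀ i, Set.Icc (u i) (v i) ⊆ Q.side j i := fun i => Set.Icc_subset_Icc (hj i).1 (hj i).2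
  set a' : Fin n → ℝ := fun i => min (ψ i (u i)) (ψ i (v i)) with ha'
  set b' : Fin n → ℝ := fun i => max (ψ i (u i)) (ψ i (v i)) with hb'
  have hlen : ∀ i, φ.expansion i * (v i - u i) ≤ b' i - a' i := fun i => by
    rw [ha', hb', max_sub_min_eq_abs]
    exact hρ.expansion_mul_le hφ (hj i).1 (huv i).2.1 (hj i).2
  have hlenpos : ∀ i, 0 < φ.expansion i * (v i - u i) := fun i =>
    mul_pos (hpos i) (sub_pos.2 (huv i).2.1)
  have hmu : ∀ i, ψ i (u i) ∈ Set.Icc (0 : ℝ) 1 := fun i =>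
    ρ.mapsTo j i (hlohi i (Set.left_mem_Icc.2 (huv i).2.1.le))
  have hmv : ∀ i, ψ i (v i) ∈ Set.Icc (0 : ℝ) 1 := fun i =>
    ρ.mapsTo j i (hlohi i (Set.right_mem_Icc.2 (huv i).2.1.le))
  have hbox' : IsBox a' b' := fun i => ⟨le_min (hmu i).1 (hmv i).1, by
    linarith [hlen i, hlenpos i], max_le (hmu i).2 (hmv i).2⟩
  have hhalf : ∀ x ∈ obox u v, ∀ i, x i ∈ Q.halfSide j i := fun x hx i =>
    Q.Ioo_subset_halfSide j i ⟨(hj i).1.trans_lt (hx i trivial).1,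
      (hx i trivial).2.trans_le (hj i).2⟩
  have hamb : ∀ x ∈ obox u v, ambient f x = fun i => ψ i (x i) := fun x hx =>
    funext fun i => ρ.ambient_apply (hhalf x hx) i
  have hnull : volume (obox u v ∩ ambient f ⁻¹' S'ᶜ) = 0 := by
    refine measure_mono_null (fun x hx => ?_) (measure_union_null hS habS)
    by_cases hxS : x ∈ S
    · exact Or.inl ⟨hxS, hx.2⟩
    · exact Or.inr ⟨hsub hx.1, hxS⟩
  have hinj : ∀ i, Set.InjOn (ψ i) (Set.Ioo (u i) (v i)) := by
    intro i x hx y hy hxy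
    by_contra hne
    wlog hlt : x < y generalizing x y
    · exact this hy hx hxy.symm (Ne.symm hne) (lt_of_le_of_ne (le_of_not_gt hlt) (Ne.symm hne))
    have := hρ.expansion_mul_le hφ (j := j) (i := i) ((hj i).1.trans hx.1.le) hlt
      (hy.2.le.trans (hj i).2)
    have e : ρ.comp j i x = ρ.comp j i y := hxy
    rw [e, sub_self, abs_zero] at this
    exact absurd (mul_pos (hpos i) (sub_pos.2 hlt)) (not_lt.2 this)
  refine ⟨a', b', hbox', ?_, ?_⟩
  -- By the intermediate value theorem every point of the new box is the image of a point of the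
  -- piece. Points outside `S'` come from a null set, and its image under the differentiable branch
  -- is null.
  · obtain ⟨N, hNs, hNm, hN0⟩ := exists_measurable_superset_of_null hnull
    have hA : MeasurableSet (N ∩ obox u v) := hNm.inter (isOpen_obox u v).measurableSet
    have himg := lintegral_image_prod (C := fun i => Set.Ioo (u i) (v i)) (ψ := ψ)
      (ψ' := fun i => derivWithin (ρ.comp j i) (Q.side j i)) hinj
      (fun i t ht => (hρ.hasDerivWithinAt (hlohi i (Set.Ioo_subset_Icc_self ht))).mono
        (Set.Ioo_subset_Icc_self.trans (hlohi i))) hA Set.inter_subset_right fun _ => 1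
    rw [setLIntegral_const, one_mul, Measure.restrict_eq_zero.2
      (measure_mono_null Set.inter_subset_left hN0), lintegral_zero_measure] at himg
    refine measure_mono_null ?_ himg
    rintro y ⟨hy, hyS⟩
    have hsurj : ∀ i, ∃ t ∈ Set.Ioo (u i) (v i), ψ i t = y i := by
      intro i
      have hc : ContinuousOn (ψ i) (Set.Icc (u i) (v i)) :=
        (hρ.contDiffOn_one j i).continuousOn.mono (hlohi i)
      have hyi := hy i trivial
      rcases le_total (ψ i (u i)) (ψ i (v i)) with h | h
      · simp only [ha', hb', min_eq_left h, max_eq_right h] at hyi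
        exact intermediate_value_Ioo (huv i).2.1.le hc hyi
      · simp only [ha', hb', min_eq_right h, max_eq_left h] at hyi
        exact intermediate_value_Ioo' (huv i).2.1.le hc hyi
    choose x hx hxy using hsurj
    have hxJ : x ∈ obox u v := fun i _ => hx i
    have hxy' : (fun i => ψ i (x i)) = y := funext hxy
    refine ⟨x, ⟨hNs ⟨hxJ, ?_⟩, hxJ⟩, hxy'⟩
    rw [Set.mem_preimage, hamb x hxJ, hxy']
    exact hyS
  · have h1 : (∏ i, φ.expansion i) * boxVol u v ≤ boxVol a' b' := by
      rw [boxVol, boxVol, ← Finset.prod_mul_distrib]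
      exact Finset.prod_le_prod (fun i _ => (hlenpos i).le) fun i _ => hlen i
    have hγ : 0 < ∏ i, φ.expansion i := Finset.prod_pos fun i _ => hpos i
    have h2 : ((Q.meeting a b).ncard : ℝ) ≤
        Q.complexity * (2 ^ (n - 1) * ((Q.crossingPoints ∩ obox a b).ncard + 1)) := by
      exact_mod_cast RectPartition.ncard_meeting_le hn a b hab
    calc (∏ i, φ.expansion i) * boxVol a b
        ≤ (∏ i, φ.expansion i) * ((Q.meeting a b).ncard * boxVol u v) := by gcongr
      _ = (Q.meeting a b).ncard * ((∏ i, φ.expansion i) * boxVol u v) := by ring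
      _ ≤ _ := mul_le_mul h2 h1 (mul_nonneg hγ.le huv.boxVol_pos.le) (by positivity)

end Image

end Jablonski

namespace Jablonski

variable {n : ℕ}

/-! ### Fibre densities of invariant measures of a skew product -/

/-- Take finite intersections of a countable generating family. Identities of measures proved for
one set at a time, almost surely, then hold for all sets off a single null set. -/
lemma exists_countable_piSystem (α : Type*) [m : MeasurableSpace α]
    [MeasurableSpace.CountablyGenerated α] : ∃ 𝒞 : Set (Set α), 𝒞.Countable ∧ IsPiSystem 𝒞 ∧
      m = MeasurableSpace.generateFrom 𝒞 := by
  obtain ⟨b, hb, rfl⟩ := MeasurableSpace.CountablyGenerated.isCountablyGenerated (α := α)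
  refine ⟨Set.sInter '' {t : Set (Set α) | t.Finite ∧ t ⊆ b},
    (Set.countable_ofPred_finite_subset hb).image _, ?_, le_antisymm ?_ ?_⟩
  · rintro _ ⟨t, ⟨ht, htb⟩, rfl⟩ _ ⟨u, ⟨hu, hub⟩, rfl⟩ _
    exact ⟨t ∪ u, ⟨ht.union hu, Set.union_subset htb hub⟩, Set.sInter_union t u⟩
  · refine MeasurableSpace.generateFrom_mono fun s hs => ?_
    exact ⟨{s}, ⟨Set.finite_singleton s, Set.singleton_subset_iff.2 hs⟩, Set.sInter_singleton s⟩
  · refine MeasurableSpace.generateFrom_le ?_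
    rintro _ ⟨t, ⟨ht, htb⟩, rfl⟩
    exact MeasurableSet.sInter ht.countable fun s hs =>
      MeasurableSpace.measurableSet_generateFrom (htb hs)

section Fiber

variable {Ω : Type*} [MeasurableSpace Ω] {P : Measure Ω} {μ : Measure (Ω × Cube n)}

/-- The fibre measures of an absolutely continuous measure on a product with the cube. -/
noncomputable def fiberMeasure (P : Measure Ω) (μ : Measure (Ω × Cube n)) (ω : Ω) :
    Measure (Cube n) :=
  volume.withDensity fun z => μ.rnDeriv (P.prod volume) (ω, z)

/-- The fibre densities, on `ℝ^n`. -/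
noncomputable def fiberDensity (P : Measure Ω) (μ : Measure (Ω × Cube n)) (p : Ω × (Fin n → ℝ)) :
    ℝ≥0∞ :=
  (Prod.snd ⁻¹' Set.univ.pi fun _ => Set.Ico (0 : ℝ) 1).indicator
    (fun p => μ.rnDeriv (P.prod volume) (p.1, proj p.2)) p

lemma measurable_fiberDensity : Measurable (fiberDensity P μ) :=
  ((Measure.measurable_rnDeriv _ _).comp (measurable_fst.prodMk
    (measurable_proj.comp measurable_snd))).indicator
      (measurable_snd (MeasurableSet.univ_pi fun _ => measurableSet_Ico))

/-- The half-open cube, which the grids partition, differs from the closed cube by a null set. -/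
lemma withDensity_fiberDensity (ω : Ω) : volume.withDensity (fun x => fiberDensity P μ (ω, x)) =
    (fiberMeasure P μ ω).map embed := by
  have hI : MeasurableSet (Set.univ.pi fun _ : Fin n => Set.Ico (0 : ℝ) 1) :=
    MeasurableSet.univ_pi fun _ => measurableSet_Ico
  have hg : Measurable fun z : Cube n => μ.rnDeriv (P.prod volume) (ω, z) :=
    (Measure.measurable_rnDeriv _ _).comp measurable_prodMk_left
  have hIU : (volume : Measure (Fin n → ℝ)).restrict (Set.univ.pi fun _ : Fin n => Set.Ico (0 : ℝ) 1) =
      volume.restrict (unitBox n) := by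
    refine Measure.restrict_congr_set ?_
    have h := Measure.univ_pi_Ico_ae_eq_Icc (μ := fun _ : Fin n => (volume : Measure ℝ))
      (f := fun _ => 0) (g := fun _ => 1)
    rwa [← Set.pi_univ_Icc] at h
  ext A hA
  rw [withDensity_apply _ hA, Measure.map_apply measurable_embed hA, fiberMeasure,
    withDensity_apply _ (measurable_embed hA)]
  have h1 := measurePreserving_embed.setLIntegral_comp_preimage hA (hg.comp measurable_proj)
  simp only [Function.comp_apply, proj_embed] at h1
  rw [h1, ← hIU, Measure.restrict_restrict hA, Set.inter_comm, ← Measure.restrict_restrict hI,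
    ← lintegral_indicator hI]
  rfl

lemma withDensity_fiberDensity_compl (ω : Ω) : volume.withDensity
    (fun x => fiberDensity P μ (ω, x)) (Set.univ.pi fun _ => Set.Ico (0 : ℝ) 1)ᶜ = 0 := by
  have hI : MeasurableSet (Set.univ.pi fun _ : Fin n => Set.Ico (0 : ℝ) 1) :=
    MeasurableSet.univ_pi fun _ => measurableSet_Ico
  rw [withDensity_apply _ hI.compl, setLIntegral_congr_fun (g := fun _ => 0) hI.compl]
  · simp
  · intro x hx
    exact Set.indicator_of_notMem (by exact hx) _

/-- The support of a fibre density. -/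
def fiberSupport (P : Measure Ω) (μ : Measure (Ω × Cube n)) (ω : Ω) : Set (Fin n → ℝ) :=
  {x | fiberDensity P μ (ω, x) ≠ 0}

lemma mem_of_mem_fiberSupport {ω : Ω} {x : Fin n → ℝ} (hx : x ∈ fiberSupport P μ ω) :
    x ∈ (Set.univ.pi fun _ : Fin n => Set.Ico (0 : ℝ) 1) ∧
      μ.rnDeriv (P.prod volume) (ω, proj x) ≠ 0 := by
  have h : fiberDensity P μ (ω, x) ≠ 0 := hx
  rw [fiberDensity] at h
  by_cases h1 : (ω, x) ∈ (Prod.snd ⁻¹' Set.univ.pi fun _ => Set.Ico (0 : ℝ) 1 :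
      Set (Ω × (Fin n → ℝ)))
  · rw [Set.indicator_of_mem h1] at h
    exact ⟨h1, h⟩
  · rw [Set.indicator_of_notMem h1] at h
    exact absurd rfl h

lemma measurable_fiberMeasure_preimage {D : Set (Ω × Cube n)} (hD : MeasurableSet D) :
    Measurable fun ω => fiberMeasure P μ ω (Prod.mk ω ⁻¹' D) := by
  have h : ∀ ω, fiberMeasure P μ ω (Prod.mk ω ⁻¹' D) =
      ∫⁻ z, D.indicator (μ.rnDeriv (P.prod volume)) (ω, z) := fun ω => by
    rw [fiberMeasure, withDensity_apply _ (measurable_prodMk_left hD),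
      ← lintegral_indicator (measurable_prodMk_left hD)]
    rfl
  simp only [h]
  exact ((Measure.measurable_rnDeriv _ _).indicator hD).lintegral_prod_right'

variable [IsProbabilityMeasure P] [IsProbabilityMeasure μ]

lemma lintegral_fiberMeasure (hac : μ ≪ P.prod volume) {D : Set (Ω × Cube n)}
    (hD : MeasurableSet D) : ∫⁻ ω, fiberMeasure P μ ω (Prod.mk ω ⁻¹' D) ∂P = μ D := by
  have h : ∀ ω, fiberMeasure P μ ω (Prod.mk ω ⁻¹' D) =
      ∫⁻ z, D.indicator (μ.rnDeriv (P.prod volume)) (ω, z) := fun ω => by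
    rw [fiberMeasure, withDensity_apply _ (measurable_prodMk_left hD),
      ← lintegral_indicator (measurable_prodMk_left hD)]
    rfl
  simp only [h]
  rw [← lintegral_prod _ ((Measure.measurable_rnDeriv _ _).indicator hD).aemeasurable,
    lintegral_indicator hD, Measure.setLIntegral_rnDeriv hac]

variable {σ : Ω → Ω} {f : Ω → Cube n → Cube n}

/-- Both sides have the same integral over every `σ ⁻¹' A`, by invariance of `μ` on `A ×ˢ B` and of
`P`. By `hσe` these are all the measurable sets, so the two functions agree almost everywhere. -/
lemma ae_fiberMeasure_preimage (hac : μ ≪ P.prod volume) (hσ : MeasurePreserving σ P P)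
    (hσe : ∀ C : Set Ω, MeasurableSet C → ∃ A, MeasurableSet A ∧ C = σ ⁻¹' A)
    (hT : MeasurePreserving (fun p : Ω × Cube n => (σ p.1, f p.1 p.2)) μ μ)
    {B : Set (Cube n)} (hB : MeasurableSet B) :
    ∀ᵐ ω ∂P, fiberMeasure P μ ω (f ω ⁻¹' B) = fiberMeasure P μ (σ ω) B := by
  have hf : Measurable fun p : Ω × Cube n => f p.1 p.2 := measurable_snd.comp hT.measurable
  have hm1 : Measurable fun ω => fiberMeasure P μ ω (f ω ⁻¹' B) :=
    measurable_fiberMeasure_preimage (D := (fun p : Ω × Cube n => f p.1 p.2) ⁻¹' B) (hf hB)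
  have hm2 : Measurable fun ω => fiberMeasure P μ ω B := by
    have := measurable_fiberMeasure_preimage (P := P) (μ := μ) (measurable_snd (α := Ω) hB)
    exact this
  refine ae_eq_of_forall_setLIntegral_eq_of_sigmaFinite hm1 (hm2.comp hσ.measurable) fun C hC _ => ?_
  obtain ⟨A, hA, rfl⟩ := hσe C hC
  have h1 := hT.measure_preimage (hA.prod hB).nullMeasurableSet
  rw [← lintegral_fiberMeasure hac (hA.prod hB),
    ← lintegral_fiberMeasure hac (hT.measurable (hA.prod hB))] at h1
  have h2 : ∀ ω, fiberMeasure P μ ω (Prod.mk ω ⁻¹' ((fun p : Ω × Cube n => (σ p.1, f p.1 p.2)) ⁻¹'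
      A ×ˢ B)) = (σ ⁻¹' A).indicator (fun ω => fiberMeasure P μ ω (f ω ⁻¹' B)) ω := by
    intro ω
    by_cases h : σ ω ∈ A
    · have e : Prod.mk ω ⁻¹' ((fun p : Ω × Cube n => (σ p.1, f p.1 p.2)) ⁻¹' A ×ˢ B) = f ω ⁻¹' B := by
        ext z; simp [h]
      rw [e, Set.indicator_of_mem (show ω ∈ σ ⁻¹' A from h)]
    · have e : Prod.mk ω ⁻¹' ((fun p : Ω × Cube n => (σ p.1, f p.1 p.2)) ⁻¹' A ×ˢ B) = ∅ := by
        ext z; simp [h]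
      rw [e, measure_empty, Set.indicator_of_notMem (show ω ∉ σ ⁻¹' A from h)]
  have h3 : ∀ ω, fiberMeasure P μ ω (Prod.mk ω ⁻¹' A ×ˢ B) =
      A.indicator (fun ω => fiberMeasure P μ ω B) ω := by
    intro ω
    by_cases h : ω ∈ A
    · rw [Set.indicator_of_mem h, Set.mk_preimage_prod_right h]
    · rw [Set.indicator_of_notMem h, Set.mk_preimage_prod_right_eq_empty h, measure_empty]
  simp only [h2, h3] at h1
  rw [lintegral_indicator (hσ.measurable hA), lintegral_indicator hA,
    ← hσ.setLIntegral_comp_preimage hA hm2] at h1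
  exact h1

/-- The mass of the fibre measure is a `σ`-invariant function, hence constant by ergodicity, and its
mean is one. -/
lemma ae_fiberMeasure_univ (hac : μ ≪ P.prod volume) (hσ : Ergodic σ P)
    (hσe : ∀ C : Set Ω, MeasurableSet C → ∃ A, MeasurableSet A ∧ C = σ ⁻¹' A)
    (hT : MeasurePreserving (fun p : Ω × Cube n => (σ p.1, f p.1 p.2)) μ μ) :
    ∀ᵐ ω ∂P, fiberMeasure P μ ω Set.univ = 1 := by
  have h1 := ae_fiberMeasure_preimage hac hσ.toMeasurePreserving hσe hT MeasurableSet.univ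
  have hm : Measurable fun ω => fiberMeasure P μ ω Set.univ := by
    have := measurable_fiberMeasure_preimage (P := P) (μ := μ)
      (MeasurableSet.univ (α := Ω × Cube n))
    exact this
  obtain ⟨c, hc⟩ := hσ.ae_eq_const_of_ae_eq_comp₀ hm.nullMeasurable
    (g := fun ω => fiberMeasure P μ ω Set.univ) (by
      filter_upwards [h1] with ω hω
      rw [Set.preimage_univ] at hω
      exact hω.symm)
  have h2 := lintegral_fiberMeasure hac (MeasurableSet.univ (α := Ω × Cube n))
  simp only [Set.preimage_univ] at h2
  rw [lintegral_congr_ae hc, measure_univ] at h2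
  simp only [Function.const_apply, lintegral_const, measure_univ, mul_one] at h2
  filter_upwards [hc] with ω hω
  rw [hω, Function.const_apply, h2]

lemma ae_map_fiberMeasure (hac : μ ≪ P.prod volume) (hσ : Ergodic σ P)
    (hσe : ∀ C : Set Ω, MeasurableSet C → ∃ A, MeasurableSet A ∧ C = σ ⁻¹' A)
    (hT : MeasurePreserving (fun p : Ω × Cube n => (σ p.1, f p.1 p.2)) μ μ) :
    ∀ᵐ ω ∂P, (fiberMeasure P μ ω).map (f ω) = fiberMeasure P μ (σ ω) := by
  have hf : Measurable fun p : Ω × Cube n => f p.1 p.2 := measurable_snd.comp hT.measurable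
  obtain ⟨𝒞, hcount, hpi, hgen⟩ := exists_countable_piSystem (Cube n)
  have hmeas : ∀ B ∈ 𝒞, MeasurableSet B := fun B hB => by
    rw [hgen]; exact MeasurableSpace.measurableSet_generateFrom hB
  have h1 : ∀ᵐ ω ∂P, ∀ B ∈ 𝒞, fiberMeasure P μ ω (f ω ⁻¹' B) = fiberMeasure P μ (σ ω) B :=
    (ae_ball_iff hcount).2 fun B hB =>
      ae_fiberMeasure_preimage hac hσ.toMeasurePreserving hσe hT (hmeas B hB)
  have hone := ae_fiberMeasure_univ hac hσ hσe hT
  filter_upwards [h1, hone, hσ.quasiMeasurePreserving.ae hone] with ω hω h2 h3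
  have hfω : Measurable (f ω) := hf.comp measurable_prodMk_left
  have hfin : IsFiniteMeasure (fiberMeasure P μ ω) := ⟨by rw [h2]; simp⟩
  refine ext_of_generate_finite 𝒞 hgen hpi (fun B hB => ?_) ?_
  · rw [Measure.map_apply hfω (hmeas B hB)]
    exact hω B hB
  · rw [Measure.map_apply hfω MeasurableSet.univ, Set.preimage_univ, h2, h3]

lemma ae_map_fiberDensity (hac : μ ≪ P.prod volume) (hσ : Ergodic σ P)
    (hσe : ∀ C : Set Ω, MeasurableSet C → ∃ A, MeasurableSet A ∧ C = σ ⁻¹' A)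
    (hT : MeasurePreserving (fun p : Ω × Cube n => (σ p.1, f p.1 p.2)) μ μ) :
    ∀ᵐ ω ∂P, (volume.withDensity fun x => fiberDensity P μ (ω, x)).map (ambient (f ω)) =
      volume.withDensity fun x => fiberDensity P μ (σ ω, x) := by
  have hf : Measurable fun p : Ω × Cube n => f p.1 p.2 := measurable_snd.comp hT.measurable
  filter_upwards [ae_map_fiberMeasure hac hσ hσe hT] with ω hω
  have hfω : Measurable (f ω) := hf.comp measurable_prodMk_left
  rw [withDensity_fiberDensity, withDensity_fiberDensity, ← hω,
    Measure.map_map (measurable_ambient hfω) measurable_embed, Measure.map_map measurable_embed hfω]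
  congr 1
  funext z
  simp [ambient]

lemma ae_withDensity_fiberDensity_univ (hac : μ ≪ P.prod volume) (hσ : Ergodic σ P)
    (hσe : ∀ C : Set Ω, MeasurableSet C → ∃ A, MeasurableSet A ∧ C = σ ⁻¹' A)
    (hT : MeasurePreserving (fun p : Ω × Cube n => (σ p.1, f p.1 p.2)) μ μ) :
    ∀ᵐ ω ∂P, volume.withDensity (fun x => fiberDensity P μ (ω, x)) Set.univ = 1 := by
  filter_upwards [ae_fiberMeasure_univ hac hσ hσe hT] with ω hω
  rw [withDensity_fiberDensity, Measure.map_apply measurable_embed MeasurableSet.univ,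
    Set.preimage_univ, hω]

lemma ae_fiberSupport_null (hac : μ ≪ P.prod volume) (hσ : Ergodic σ P)
    (hσe : ∀ C : Set Ω, MeasurableSet C → ∃ A, MeasurableSet A ∧ C = σ ⁻¹' A)
    (hT : MeasurePreserving (fun p : Ω × Cube n => (σ p.1, f p.1 p.2)) μ μ) :
    ∀ᵐ ω ∂P, volume (fiberSupport P μ ω ∩ ambient (f ω) ⁻¹' (fiberSupport P μ (σ ω))ᶜ) = 0 := by
  have hf : Measurable fun p : Ω × Cube n => f p.1 p.2 := measurable_snd.comp hT.measurable
  filter_upwards [ae_map_fiberDensity hac hσ hσe hT] with ω hω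
  have hfω : Measurable (ambient (f ω)) := measurable_ambient (hf.comp measurable_prodMk_left)
  have hm : ∀ ω, Measurable fun x => fiberDensity P μ (ω, x) := fun ω =>
    measurable_fiberDensity.comp measurable_prodMk_left
  have hS : MeasurableSet (fiberSupport P μ (σ ω))ᶜ :=
    (hm (σ ω) (measurableSet_singleton 0).compl).compl
  have h0 : volume.withDensity (fun x => fiberDensity P μ (σ ω, x)) (fiberSupport P μ (σ ω))ᶜ = 0 := by
    rw [withDensity_apply_eq_zero (hm (σ ω))]
    convert! measure_empty
    · exact Set.inter_compl_self (fiberSupport P μ (σ ω))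
    · infer_instance
  rw [← hω, Measure.map_apply hfω hS, withDensity_apply_eq_zero (hm ω)] at h0
  exact h0

lemma ae_fiberSupport_inter_null {μ' : Measure (Ω × Cube n)} [IsProbabilityMeasure μ']
    (hac : μ ≪ P.prod volume) (hac' : μ' ≪ P.prod volume) (h : μ ⟂ₘ μ') :
    ∀ᵐ ω ∂P, volume (fiberSupport P μ ω ∩ fiberSupport P μ' ω) = 0 := by
  obtain ⟨s, hs, h1, h2⟩ := h
  have key : ∀ (μ : Measure (Ω × Cube n)) [IsProbabilityMeasure μ] (_ : μ ≪ P.prod volume)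
      (s : Set (Ω × Cube n)) (_ : μ s = 0),
      ∀ᵐ p ∂P.prod volume, p ∈ s → μ.rnDeriv (P.prod volume) p = 0 := by
    intro μ _ hac s hs0
    rw [← Measure.withDensity_rnDeriv_eq μ _ hac,
      withDensity_apply_eq_zero (Measure.measurable_rnDeriv _ _)] at hs0
    filter_upwards [measure_eq_zero_iff_ae_notMem.1 hs0] with p hp hps
    by_contra hne
    exact hp ⟨hne, hps⟩
  have h3 : ∀ᵐ p ∂P.prod volume, μ.rnDeriv (P.prod volume) p = 0 ∨
      μ'.rnDeriv (P.prod volume) p = 0 := by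
    filter_upwards [key μ hac s h1, key μ' hac' sᶜ h2] with p hp hp'
    by_cases hps : p ∈ s
    · exact Or.inl (hp hps)
    · exact Or.inr (hp' hps)
  filter_upwards [Measure.ae_ae_of_ae_prod h3] with ω hω
  rw [measure_eq_zero_iff_ae_notMem]
  filter_upwards [ae_of_ae_cube hω] with x hx hxS
  have hU : x ∈ unitBox n := fun i hi =>
    Set.Ico_subset_Icc_self ((mem_of_mem_fiberSupport hxS.1).1 i hi)
  rcases hx hU with h | h
  · exact (mem_of_mem_fiberSupport hxS.1).2 h
  · exact (mem_of_mem_fiberSupport hxS.2).2 h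

end Fiber

end Jablonski

namespace Jablonski

variable {n : ℕ}

/-! ### The supports of ergodic measures contain boxes -/

/-- Up to a null set, `S` contains a nondegenerate box of the unit cube. -/
def HasBox (S : Set (Fin n → ℝ)) : Prop :=
  ∃ a b : Fin n → ℝ, IsBox a b ∧ volume (obox a b \ S) = 0

/-- Shrinking a box to rational corners turns its existence into a countable union, hence a
measurable event. -/
lemma hasBox_iff_rat {S : Set (Fin n → ℝ)} : HasBox S ↔ ∃ a b : Fin n → ℚ,
    IsBox (fun i => (a i : ℝ)) (fun i => (b i : ℝ)) ∧
      volume (obox (fun i => (a i : ℝ)) (fun i => (b i : ℝ)) \ S) = 0 := by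
  constructor
  · rintro ⟨a, b, hab, h⟩
    choose p hp1 hp2 using fun i => exists_rat_btwn (hab i).2.1
    choose q hq1 hq2 using fun i => exists_rat_btwn (hp2 i)
    refine ⟨p, q, fun i => ⟨(hab i).1.trans (hp1 i).le, hq1 i, (hq2 i).le.trans (hab i).2.2⟩,
      measure_mono_null (Set.sdiff_subset_sdiff_left ?_) h⟩
    exact Set.pi_mono fun i _ => Set.Ioo_subset_Ioo (hp1 i).le (hq2 i).le
  · rintro ⟨a, b, h⟩
    exact ⟨_, _, h⟩

lemma measurableSet_hasBox {Ω : Type*} [MeasurableSpace Ω] {h : Ω × (Fin n → ℝ) → ℝ≥0∞}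
    (hh : Measurable h) : MeasurableSet {ω | HasBox {x | h (ω, x) ≠ 0}} := by
  simp only [hasBox_iff_rat, Set.ofPred_exists]
  refine MeasurableSet.iUnion fun a => MeasurableSet.iUnion fun b => ?_
  refine MeasurableSet.inter (MeasurableSet.const _) ?_
  have hs : MeasurableSet ((Prod.snd ⁻¹' obox (fun i => (a i : ℝ)) (fun i => (b i : ℝ))) \
      {p : Ω × (Fin n → ℝ) | h p ≠ 0}) :=
    (measurable_snd (isOpen_obox _ _).measurableSet).diff (hh (measurableSet_singleton 0).compl)
  exact measurable_measure_prodMk_left (ν := (volume : Measure (Fin n → ℝ))) hs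
    (measurableSet_singleton 0)

lemma hasBox_of_gridCell {S : Set (Fin n → ℝ)} {m : ℕ} (hm : 0 < m) {q : Fin n → Fin m}
    (h : volume (Sᶜ ∩ gridCell m q) = 0) : HasBox S := by
  have hm' : (0 : ℝ) < m := by exact_mod_cast hm
  refine ⟨fun i => (q i : ℕ) / m, fun i => ((q i : ℕ) + 1) / m, fun i => ⟨by positivity, ?_, ?_⟩,
    measure_mono_null ?_ h⟩
  · rw [div_lt_div_iff_of_pos_right hm']; linarith
  · rw [div_le_one hm']; exact_mod_cast (q i).2
  · rintro x ⟨hx, hxS⟩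
    exact ⟨hxS, fun i hi => Set.Ioo_subset_Ico_self (hx i hi)⟩

section

variable {Ω : Type*} [MeasurableSpace Ω] {P : Measure Ω} [IsProbabilityMeasure P]
  {σ : Ω ≃ᵐ Ω} {F : Ω → JablonskiMap n} {G : RectPartition n} {φ : ∀ ω, Rep (F ω).toFun G}
  {μ : Measure (Ω × Cube n)}

lemma exists_preimage_eq (C : Set Ω) (hC : MeasurableSet C) :
    ∃ A, MeasurableSet A ∧ C = σ ⁻¹' A :=
  ⟨σ.symm ⁻¹' C, σ.symm.measurable hC, by rw [← Set.preimage_comp]; simp⟩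

/-- The support of an absolutely continuous invariant measure contains, in almost every fibre, a
box. -/
theorem ae_hasBox_fiberSupport (hn : 1 ≤ n) (hσ : Ergodic σ P)
    (hown : ∀ ω, (F ω).rep.Regular)
    (hreg : ∀ ω, (φ ω).Regular) (hpos : ∀ᵐ ω ∂P, ∀ i, 0 < (φ ω).expansion i)
    (hint : Integrable (fun ω => ⨅ i, Real.log ((φ ω).expansion i)) P)
    (hexp : 0 < ∫ ω, ⨅ i, Real.log ((φ ω).expansion i) ∂P) (hlog : LogIntegrableTransfer P F)
    (hμ : IsErgodicACIP P σ F μ) : ∀ᵐ ω ∂P, HasBox (fiberSupport P μ ω) := by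
  have hprob := hμ.prob
  have hac := hμ.ac
  have hT : MeasurePreserving (fun p : Ω × Cube n => (σ p.1, (F p.1).toFun p.2)) μ μ :=
    hμ.ergodic.toMeasurePreserving
  have hf : Measurable fun p : Ω × Cube n => (F p.1).toFun p.2 := measurable_snd.comp hT.measurable
  have hσm := hσ.toMeasurePreserving
  have hτm : MeasurePreserving σ.symm P P := MeasurePreserving.symm σ hσm
  have hf' : ∀ᵐ ω ∂P, Measurable (ambient (F ω).toFun) :=
    Eventually.of_forall fun ω => measurable_ambient (hf.comp measurable_prodMk_left)
  obtain ⟨N, B, a, ha0, haint, haneg, ha⟩ := exists_contracting_block (f := fun ω => (F ω).toFun)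
    hσm hf hreg hpos hint hexp hlog
  have hmass := ae_withDensity_fiberDensity_univ (f := fun ω => (F ω).toFun) hac hσ exists_preimage_eq hT
  have hmap := ae_map_fiberDensity (f := fun ω => (F ω).toFun) hac hσ exists_preimage_eq hT
  have hστ : ∀ ω, σ^[N] (σ.symm^[N] ω) = ω :=
    Function.LeftInverse.iterate (fun ω => σ.apply_symm_apply ω) N
  have hτσ : ∀ ω, σ.symm^[N] (σ^[N] ω) = ω :=
    Function.LeftInverse.iterate (fun ω => σ.symm_apply_apply ω) N
  have hinv : ∀ᵐ ω ∂P, (volume.withDensity fun x => fiberDensity P μ (ω, x)).map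
      (fiberIter σ (fun ω => ambient (F ω).toFun) N ω) =
      volume.withDensity fun x => fiberDensity P μ (σ^[N] ω, x) := by
    filter_upwards [(hσm.iterate N).quasiMeasurePreserving.ae
      (ae_map_fiberIter_backward (P := P) (τ := σ.symm)
        (ν := fun ω => volume.withDensity fun x => fiberDensity P μ (ω, x)) hσm hτm
        (fun ω => σ.apply_symm_apply ω) hf' hmap N)] with ω hω
    rwa [hτσ] at hω
  -- The iterate `σ^[N]` need not be ergodic, so boxes are obtained with positive probability only.
  -- Ergodicity of `σ` itself is used below.
  have hbox := exists_gridCell_subset_support hn (hσm.iterate N) (hτm.iterate N) hστ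
    (ae_measurable_fiberIter hσm hf' N) ha0 haint haneg ha measurable_fiberDensity hmass
    (Eventually.of_forall fun ω => withDensity_fiberDensity_compl ω) hinv
  have hE : MeasurableSet {ω | HasBox (fiberSupport P μ ω)} :=
    measurableSet_hasBox measurable_fiberDensity
  -- The event is forward invariant, since the image of a box in a support contains a box in the
  -- next one.
  have hle : {ω | HasBox (fiberSupport P μ ω)} ≤ᵐ[P] σ ⁻¹' {ω | HasBox (fiberSupport P μ ω)} := by
    filter_upwards [ae_fiberSupport_null (f := fun ω => (F ω).toFun) hac hσ exists_preimage_eq hT, hpos] with ω h1 h2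
    rintro ⟨a, b, hab, habS⟩
    obtain ⟨a', b', hab', habS', -⟩ :=
      (hown ω).exists_image_box hn (hreg ω) h2 h1 hab habS
    exact ⟨a', b', hab', habS'⟩
  rcases hσ.ae_empty_or_univ_of_ae_le_preimage hE.nullMeasurableSet hle
    with h | h
  · exfalso
    apply hbox
    filter_upwards [h] with ω hω
    rintro ⟨m, hm, q, hq⟩
    have h1 : ω ∈ {ω | HasBox (fiberSupport P μ ω)} := hasBox_of_gridCell hm hq
    exact (Set.notMem_empty ω) (Eq.mp hω h1)
  · filter_upwards [h] with ω hω
    exact Eq.mpr hω trivial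

end

/-! ### Growth of boxes in the supports -/

/-- An open null set is empty. True disjointness, not only up to null sets, is needed because
crossing points are single points. -/
lemma obox_inter_eq_empty {S S' : Set (Fin n → ℝ)} {a b a' b' : Fin n → ℝ}
    (h : volume (obox a b \ S) = 0) (h' : volume (obox a' b' \ S') = 0)
    (hSS' : volume (S ∩ S') = 0) : Disjoint (obox a b) (obox a' b') := by
  rw [Set.disjoint_iff_inter_eq_empty]
  refine ((isOpen_obox a b).inter (isOpen_obox a' b')).eq_empty_of_measure_zero (μ := volume) ?_
  refine measure_mono_null (fun x hx => ?_) (measure_union_null (measure_union_null h h') hSS')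
  by_cases h1 : x ∈ S
  · by_cases h2 : x ∈ S'
    · exact Or.inr ⟨h1, h2⟩
    · exact Or.inl (Or.inr ⟨hx.2, h2⟩)
  · exact Or.inl (Or.inl ⟨hx.1, h1⟩)

lemma sum_ncard_inter_le {α ι : Type*} [Fintype ι] {A : Set α} (hA : A.Finite) {J : ι → Set α}
    (hJ : Pairwise fun i j => Disjoint (J i) (J j)) : ∑ i, (A ∩ J i).ncard ≤ A.ncard := by
  classical
  have hfin : ∀ i, (A ∩ J i).Finite := fun i => hA.inter_of_left _
  calc ∑ i, (A ∩ J i).ncard = ∑ i, (hfin i).toFinset.card :=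
        Finset.sum_congr rfl fun i _ => Set.ncard_eq_toFinset_card _ (hfin i)
    _ = (Finset.univ.biUnion fun i => (hfin i).toFinset).card := by
        refine (Finset.card_biUnion fun i _ j _ hij => ?_).symm
        change Disjoint (hfin i).toFinset (hfin j).toFinset
        rw [Set.Finite.disjoint_toFinset]
        exact (hJ hij).mono Set.inter_subset_right Set.inter_subset_right
    _ ≤ hA.toFinset.card := by
        refine Finset.card_le_card fun x hx => ?_
        obtain ⟨i, -, hi⟩ := Finset.mem_biUnion.1 hx
        exact hA.mem_toFinset.2 ((hfin i).mem_toFinset.1 hi).1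
    _ = A.ncard := (Set.ncard_eq_toFinset_card _ hA).symm

lemma sum_log_le_mul_log {r : ℕ} (hr : 1 ≤ r) {x : Fin r → ℝ} (hx : ∀ i, 0 < x i) :
    ∑ i, Real.log (x i) ≤ r * Real.log ((∑ i, x i) / r) := by
  have hr' : (0 : ℝ) < r := by exact_mod_cast hr
  have h := strictConcaveOn_log_Ioi.concaveOn.le_map_sum (t := Finset.univ)
    (w := fun _ : Fin r => (r : ℝ)⁻¹) (p := x) (fun _ _ => by positivity)
    (by simp [hr'.ne']) fun i _ => hx i
  simp only [smul_eq_mul, ← Finset.mul_sum] at h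
  rw [inv_mul_le_iff₀ hr'] at h
  rwa [div_eq_inv_mul]

/-- The cost, in the growth of the boxes, of cutting along a partition. -/
noncomputable def cuttingCost (r : ℕ) (Q : RectPartition n) : ℝ :=
  Real.log Q.complexity + Real.log (2 ^ (n - 1) * ((Q.numCrossing : ℝ) / r + 1))

lemma cuttingCost_nonneg (hn : 1 ≤ n) (r : ℕ) (Q : RectPartition n) : 0 ≤ cuttingCost r Q := by
  refine add_nonneg (Real.log_nonneg (by exact_mod_cast Q.one_le_complexity hn)) (Real.log_nonneg ?_)
  have h1 : (1 : ℝ) ≤ 2 ^ (n - 1) := one_le_pow₀ (by norm_num)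
  have h2 : (1 : ℝ) ≤ (Q.numCrossing : ℝ) / r + 1 := by
    have : (0 : ℝ) ≤ (Q.numCrossing : ℝ) / r := by positivity
    linarith
  nlinarith

/-- A single box may contain all the crossing points, so only the sum of the `r` logarithms is
controlled. The boxes share the crossing points, and by Jensen's inequality the sum of `log (c i +
1)` is largest when they are shared equally. -/
lemma exists_image_boxes {f : Cube n → Cube n} {Q G : RectPartition n} {ρ : Rep f Q} {φ : Rep f G}
    (hn : 1 ≤ n) (hρ : ρ.Regular) (hφ : φ.Regular) (hpos : ∀ i, 0 < φ.expansion i) {r : ℕ}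
    (hr : 1 ≤ r) {S S' : Fin r → Set (Fin n → ℝ)}
    (hS : ∀ i, volume (S i ∩ ambient f ⁻¹' (S' i)ᶜ) = 0)
    (hdisj : ∀ i j, i ≠ j → volume (S i ∩ S j) = 0) {a b : Fin r → Fin n → ℝ}
    (hab : ∀ i, IsBox (a i) (b i)) (habS : ∀ i, volume (obox (a i) (b i) \ S i) = 0) :
    ∃ a' b' : Fin r → Fin n → ℝ, (∀ i, IsBox (a' i) (b' i)) ∧
      (∀ i, volume (obox (a' i) (b' i) \ S' i) = 0) ∧
      ∑ i, Real.log (boxVol (a i) (b i)) +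
        r * (Real.log (∏ i, φ.expansion i) - cuttingCost r Q) ≤
      ∑ i, Real.log (boxVol (a' i) (b' i)) := by
  choose a' b' h1 h2 h3 using fun i => hρ.exists_image_box hn hφ hpos (hS i) (hab i) (habS i)
  refine ⟨a', b', h1, h2, ?_⟩
  set c : Fin r → ℕ := fun i => (Q.crossingPoints ∩ obox (a i) (b i)).ncard with hc
  have hr' : (0 : ℝ) < r := by exact_mod_cast hr
  have hM : (0 : ℝ) < Q.complexity := by exact_mod_cast Q.one_le_complexity hn
  have hγ : 0 < ∏ i, φ.expansion i := Finset.prod_pos fun i _ => hpos i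
  have hci : ∀ i, (0 : ℝ) < c i + 1 := fun i => by positivity
  have hstep : ∀ i, Real.log (boxVol (a i) (b i)) + (Real.log (∏ i, φ.expansion i) -
      Real.log Q.complexity - Real.log (2 ^ (n - 1))) - Real.log (c i + 1) ≤
        Real.log (boxVol (a' i) (b' i)) := by
    intro i
    have h := Real.log_le_log (mul_pos hγ (hab i).boxVol_pos) (h3 i)
    rw [Real.log_mul hγ.ne' (hab i).boxVol_pos.ne',
      Real.log_mul (mul_pos hM (mul_pos (by positivity) (hci i))).ne' (h1 i).boxVol_pos.ne',
      Real.log_mul hM.ne' (mul_pos (by positivity) (hci i)).ne',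
      Real.log_mul (by positivity) (hci i).ne'] at h
    linarith
  have hsum := Finset.sum_le_sum fun i (_ : i ∈ Finset.univ) => hstep i
  rw [Finset.sum_sub_distrib, Finset.sum_add_distrib, Finset.sum_const, Finset.card_univ,
    Fintype.card_fin, nsmul_eq_mul] at hsum
  have hcross : (∑ i, (c i : ℝ)) ≤ Q.numCrossing := by
    have := sum_ncard_inter_le Q.finite_crossingPoints
      (J := fun i => obox (a i) (b i)) fun i j hij =>
        obox_inter_eq_empty (habS i) (habS j) (hdisj i j hij)
    exact_mod_cast this
  have hlog : ∑ i, Real.log ((c i : ℝ) + 1) ≤ r * Real.log ((Q.numCrossing : ℝ) / r + 1) := by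
    refine (sum_log_le_mul_log hr hci).trans ?_
    have hs : ∑ i, ((c i : ℝ) + 1) = ∑ i, (c i : ℝ) + r := by
      rw [Finset.sum_add_distrib]; simp
    have hs0 : 0 ≤ ∑ i, (c i : ℝ) := Finset.sum_nonneg fun i _ => by positivity
    rw [hs, add_div, div_self hr'.ne']
    have : (∑ i, (c i : ℝ)) / r ≤ (Q.numCrossing : ℝ) / r := by gcongr
    gcongr
  have hcost : cuttingCost r Q = Real.log Q.complexity + (Real.log (2 ^ (n - 1)) +
      Real.log ((Q.numCrossing : ℝ) / r + 1)) := by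
    rw [cuttingCost, Real.log_mul (by positivity) (by positivity)]
  rw [hcost]
  linarith

/-- Follow one box in each support. The logarithms of the volumes stay nonpositive, so the
accumulated gain is bounded by the initial deficit. -/
lemma sum_expansion_sub_cuttingCost_le {Ω : Type*} {σ : Ω → Ω} {F : Ω → JablonskiMap n}
    {G : RectPartition n} {φ : ∀ ω, Rep (F ω).toFun G} (hn : 1 ≤ n)
    (hown : ∀ ω, (F ω).rep.Regular) (hreg : ∀ ω, (φ ω).Regular) {r : ℕ} (hr : 1 ≤ r)
    {S : Fin r → Ω → Set (Fin n → ℝ)} {ω : Ω}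
    (hpos : ∀ k, ∀ i, 0 < (φ (σ^[k] ω)).expansion i)
    (hS : ∀ k, ∀ i, volume (S i (σ^[k] ω) ∩
      ambient (F (σ^[k] ω)).toFun ⁻¹' (S i (σ (σ^[k] ω)))ᶜ) = 0)
    (hdisj : ∀ k, ∀ i j, i ≠ j → volume (S i (σ^[k] ω) ∩ S j (σ^[k] ω)) = 0)
    (hbox : ∀ i, HasBox (S i ω)) :
    ∃ C : ℝ, ∀ k, ∑ l ∈ Finset.range k, (Real.log (∏ i, (φ (σ^[l] ω)).expansion i) -
      cuttingCost r (F (σ^[l] ω)).part) ≤ C := by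
  choose a b hab habS using hbox
  have hr' : (0 : ℝ) < r := by exact_mod_cast hr
  have key : ∀ k, ∃ a' b' : Fin r → Fin n → ℝ, (∀ i, IsBox (a' i) (b' i)) ∧
      (∀ i, volume (obox (a' i) (b' i) \ S i (σ^[k] ω)) = 0) ∧
      ∑ i, Real.log (boxVol (a i) (b i)) +
        r * ∑ l ∈ Finset.range k, (Real.log (∏ i, (φ (σ^[l] ω)).expansion i) -
          cuttingCost r (F (σ^[l] ω)).part) ≤ ∑ i, Real.log (boxVol (a' i) (b' i)) := by
    intro k
    induction k with
    | zero => exact ⟨a, b, hab, habS, by simp⟩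
    | succ k ih =>
      obtain ⟨a', b', h1, h2, h3⟩ := ih
      obtain ⟨a₂, b₂, h4, h5, h6⟩ := exists_image_boxes hn (hown (σ^[k] ω)) (hreg (σ^[k] ω))
        (hpos k) hr (S := fun i => S i (σ^[k] ω)) (S' := fun i => S i (σ (σ^[k] ω)))
        (hS k) (hdisj k) h1 h2
      refine ⟨a₂, b₂, h4, fun i => ?_, ?_⟩
      · rw [Function.iterate_succ_apply']; exact h5 i
      · rw [Finset.sum_range_succ, mul_add]
        linarith
  refine ⟨-(∑ i, Real.log (boxVol (a i) (b i))) / r, fun k => ?_⟩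
  obtain ⟨a', b', h1, h2, h3⟩ := key k
  have h4 : ∑ i, Real.log (boxVol (a' i) (b' i)) ≤ 0 :=
    Finset.sum_nonpos fun i _ => Real.log_nonpos (h1 i).boxVol_pos.le (h1 i).boxVol_le_one
  rw [le_div_iff₀ hr']
  linarith

end Jablonski
-- The theorem: growth of boxes against the drift.
open MeasureTheory Jablonski in
theorem lemma5p1 {Ω : Type*} [TopologicalSpace Ω] [PolishSpace Ω] [MeasurableSpace Ω]
    [BorelSpace Ω] (P : Measure Ω) [IsProbabilityMeasure P]
    (σ : Ω ≃ᵐ Ω) (hσ : Ergodic σ P) {n : ℕ} (hn : 1 ≤ n)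
    (F : Ω → JablonskiMap n) (G : RectPartition n) (φ : ∀ ω, Rep (F ω).toFun G)
    (hF : IsAdmissible P F G φ) (hlog : LogIntegrableTransfer P F)
    (hct : AEMeasurable (ct σ F) P)
    (hδ : 0 < delta P σ F φ)
    (r : ℕ) (hr : 1 ≤ r) (μ : Fin r → Measure (Ω × Cube n))
    (hμ : ∀ i, IsErgodicACIP P σ F (μ i))
    (hsing : Pairwise fun i j => μ i ⟂ₘ μ j) :
    ENNReal.ofReal (delta P σ F φ) ≤
      ∫⁻ ω, ENNReal.ofReal (Real.log (2 ^ (n - 1) * ((ct σ F ω : ℝ) / r + 1))) ∂P := by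
  have hprob : ∀ i, IsProbabilityMeasure (μ i) := fun i => (hμ i).prob
  have hσm := hσ.toMeasurePreserving
  obtain ⟨γ, hγ0, hγ⟩ := hF.expanding
  have hexp : 0 < ∫ ω, ⨅ i, Real.log ((φ ω).expansion i) ∂P := hγ0.trans hγ
  -- A nonintegrable function has Bochner integral 0 by convention, so a positive integral includes
  -- integrability.
  have hint : Integrable (fun ω => ⨅ i, Real.log ((φ ω).expansion i)) P :=
    Integrable.of_integral_ne_zero hexp.ne'
  have hδint : Integrable (fun ω => Real.log ((∏ i, (φ ω).expansion i) / (M σ F ω : ℝ))) P :=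
    Integrable.of_integral_ne_zero hδ.ne'
  have hT : ∀ i, MeasurePreserving (fun p : Ω × Cube n => (σ p.1, (F p.1).toFun p.2)) (μ i) (μ i) :=
    fun i => (hμ i).ergodic.toMeasurePreserving
  by_contra! hcon
  set ℓ : Ω → ℝ := fun ω => Real.log (2 ^ (n - 1) * ((ct σ F ω : ℝ) / r + 1)) with hℓ
  have hℓ0 : ∀ ω, 0 ≤ ℓ ω := by
    intro ω
    refine Real.log_nonneg ?_
    have h1 : (1 : ℝ) ≤ 2 ^ (n - 1) := one_le_pow₀ (by norm_num)
    have h2 : (1 : ℝ) ≤ (ct σ F ω : ℝ) / r + 1 := by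
      have : (0 : ℝ) ≤ (ct σ F ω : ℝ) / r := by positivity
      linarith
    nlinarith
  have hℓm : AEMeasurable ℓ P := by
    refine Real.measurable_log.comp_aemeasurable (aemeasurable_const.mul
      (AEMeasurable.add ?_ aemeasurable_const))
    exact (measurable_from_top.comp_aemeasurable hct : AEMeasurable (fun ω => (ct σ F ω : ℝ)) P).div_const _
  have hℓint : Integrable ℓ P := by
    refine ⟨hℓm.aestronglyMeasurable, ?_⟩
    rw [hasFiniteIntegral_iff_ofReal (Filter.Eventually.of_forall hℓ0)]
    exact hcon.trans ENNReal.ofReal_lt_top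
  have hlt : ∫ ω, ℓ ω ∂P < delta P σ F φ := by
    rw [← ENNReal.ofReal_lt_ofReal_iff hδ,
      ofReal_integral_eq_lintegral_ofReal hℓint (Filter.Eventually.of_forall hℓ0)]
    exact hcon
  -- The cost then has negative drift against the gain, and its Birkhoff sums decrease linearly with
  -- positive probability. The boxes show that almost surely they are bounded below.
  obtain ⟨c, hc, hnot⟩ := exists_birkhoffSum_le_sub_mul hσm (hℓint.sub hδint) (by
    rw [integral_sub' hℓint hδint]
    exact sub_neg.2 hlt)
  apply hnot
  have hbox : ∀ᵐ ω ∂P, ∀ i, HasBox (fiberSupport P (μ i) ω) := by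
    rw [ae_all_iff]
    exact fun i => ae_hasBox_fiberSupport hn hσ hF.regular hF.common_regular hF.expansion_pos hint
      hexp hlog (hμ i)
  have hall : ∀ᵐ ω ∂P, ∀ k, (∀ i, 0 < (φ (σ^[k] ω)).expansion i) ∧
      (∀ i, volume (fiberSupport P (μ i) (σ^[k] ω) ∩
        ambient (F (σ^[k] ω)).toFun ⁻¹' (fiberSupport P (μ i) (σ (σ^[k] ω)))ᶜ) = 0) ∧
      ∀ i j, i ≠ j → volume (fiberSupport P (μ i) (σ^[k] ω) ∩
        fiberSupport P (μ j) (σ^[k] ω)) = 0 := by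
    rw [ae_all_iff]
    intro k
    have h1 : ∀ᵐ ω ∂P, ∀ i, volume (fiberSupport P (μ i) ω ∩
        ambient (F ω).toFun ⁻¹' (fiberSupport P (μ i) (σ ω))ᶜ) = 0 :=
      ae_all_iff.2 fun i => ae_fiberSupport_null (f := fun ω => (F ω).toFun) (hμ i).ac hσ exists_preimage_eq (hT i)
    have h2 : ∀ᵐ ω ∂P, ∀ i j, i ≠ j →
        volume (fiberSupport P (μ i) ω ∩ fiberSupport P (μ j) ω) = 0 := by
      simp only [ae_all_iff]
      exact fun i j hij => ae_fiberSupport_inter_null (hμ i).ac (hμ j).ac (hsing hij)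
    exact (hσm.iterate k).quasiMeasurePreserving.ae
      (hF.expansion_pos.and (h1.and h2))
  filter_upwards [hbox, hall] with ω hω1 hω2
  rintro ⟨C, hC⟩
  obtain ⟨D, hD⟩ := sum_expansion_sub_cuttingCost_le (σ := σ) hn hF.regular hF.common_regular hr
    (S := fun i => fiberSupport P (μ i)) (fun k => (hω2 k).1) (fun k => (hω2 k).2.1)
    (fun k => (hω2 k).2.2) hω1
  -- `ℓ` and `M` refer to the partition at `σ ω`, whereas the boxes over `ω` are cut along the
  -- partition at `ω`. The difference telescopes: the final cost is nonnegative and the initial one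
  -- is constant in `k`.
  have hbirk : ∀ k, -(D + cuttingCost r (F ω).part) ≤ birkhoffSum σ
      (fun ω => ℓ ω - Real.log ((∏ i, (φ ω).expansion i) / (M σ F ω : ℝ))) k ω := by
    intro k
    have hterm : ∀ l, ℓ (σ^[l] ω) -
        Real.log ((∏ i, (φ (σ^[l] ω)).expansion i) / (M σ F (σ^[l] ω) : ℝ)) =
        cuttingCost r (F (σ^[l + 1] ω)).part - cuttingCost r (F (σ^[l] ω)).part -
          (Real.log (∏ i, (φ (σ^[l] ω)).expansion i) - cuttingCost r (F (σ^[l] ω)).part) := by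
      intro l
      have hprod : 0 < ∏ i, (φ (σ^[l] ω)).expansion i := Finset.prod_pos fun i _ => (hω2 l).1 i
      have hM : (0 : ℝ) < M σ F (σ^[l] ω) := by
        exact_mod_cast (F (σ (σ^[l] ω))).part.one_le_complexity hn
      rw [Real.log_div hprod.ne' hM.ne', Function.iterate_succ_apply']
      simp only [hℓ, cuttingCost, ct, M]
      ring
    rw [birkhoffSum, Finset.sum_congr rfl fun l _ => hterm l, Finset.sum_sub_distrib,
      Finset.sum_range_sub (fun l => cuttingCost r (F (σ^[l] ω)).part)]
    have h1 := hD k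
    have h2 := cuttingCost_nonneg hn r (F (σ^[k] ω)).part
    simp only [Function.iterate_zero, id_eq]
    linarith
  obtain ⟨k, hk⟩ := exists_nat_gt ((C + D + cuttingCost r (F ω).part) / c)
  rw [div_lt_iff₀ hc] at hk
  have h1 := hbirk k
  have h2 : _ ≤ C - c * k := hC k
  have h3 : birkhoffSum σ (fun ω => ℓ ω - Real.log ((∏ i, (φ ω).expansion i) / (M σ F ω : ℝ))) k ω ≤
      C - c * k := h2
  linarith
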